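/- Let $(V,\omega)$ be a finite-dimensional real symplectic vector space, $\dim V=2n$, with an adapted complex structure $J$, i.e. $J^2=-1$, $\omega(Ju,Jv)=\omega(u,v)$, and $\omega(Jv,v)>0$ for $v\neq 0$. Let $G=V\oplus\mathbb R$ be the Heisenberg group with product $(v,t)\cdot(v',t')=(v+v',\,t+t'+\tfrac12\omega(v,v'))$, dilations $\delta_s(v,t)=(sv,s^2t)$ for $s>0$, homogeneous dimension $Q=2n+2$, and Haar measure equal to Lebesgue measure. A distribution $k$ on $G$ is *regular* if it is given by a smooth function on $G\setminus\{0\}$, and *homogeneous of degree* $d$ if $\langle k,\varphi\circ\delta_s\rangle=s^{-Q-d}\langle k,\varphi\rangle$ for all $s>0$ and $\varphi\in C_c^\infty(G)$. An *order zero model operator* on $G$ is an operator $P\varphi=k*\varphi$, $(k*\varphi)(g)=\langle k(h),\varphi(h^{-1}g)\rangle$, with $k$ regular and homogeneous of degree $-Q$; $P^{op}$ is the model operator of the distribution $k^{op}$ given by $\langle k^{op},\varphi\rangle=\langle k,\varphi^{op}\rangle$, $\varphi^{op}(v,t)=\varphi(v,-t)$. Extend $\omega$ complex bilinearly to $V\otimes\mathbb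 C=V^{1,0}\oplus V^{0,1}$ (the $\pm i$ eigenspaces of $J$), let $Z_1,\dots,Z_n$ be a basis of $V^{1,0}$ that is orthonormal for $\langle z,w\rangle=2i\,\omega(z,\bar w)$, and let $z_1,\dots,z_n$ be the coordinates on $V^{0,1}$ for the basis $\bar Z_1,\dots,\bar Z_n$. The Bargmann–Fock space $\mathcal H^{BF}$ is the Hilbert space of holomorphic functions $f$ on $V^{0,1}$ with $\|f\|^2=\int|f(z)|^2e^{-|z|^2}dz<\infty$. Fix $c>0$. The Bargmann–Fock representation $\pi$ is the irreducible unitary representation of $G$ on $\mathcal H^{BF}$ which integrates $$\pi(Z_j)=ic\,z_j,\qquad \pi(\bar Z_j)=ic\,\frac{\partial}{\partial z_j},\qquad \pi(1)=2ic^2 ,$$ where $1$ is the central element $(0,1)\in V\oplus\mathbb R$ of the Lie algebra. For $f\in L^1(G)$ put $\pi(f)=\int_G f(g)\pi(g)\,dg$. For a model operator $P$ with kernel $k$, $\pi(P)=\pi(k)$ denotes the bounded operator on $\mathcal H^{BF}$ determined by $\pi(k)\pi(\varphi)=\pi(k*\varphi)$ for all $\varphi\in C_c^\infty(G)$ with $\int_G\varphi=0$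 (for these, $k*\varphi\in L^1(G)$). **Lemma.** Let $P$ be an order zero model operator on $G$. Then $P$ extends uniquely to a bounded operator on $L^2(G)$, the bounded operators $\pi(P)$ and $\pi(P^{op})$ exist and are uniquely determined, and the operator norms satisfy $$\|P\|=\max\{\|\pi(P)\|,\ \|\pi(P^{op})\|\}.$$ -/

import Mathlib

open MeasureTheory TopologicalSpace
open scoped Distributions

namespace HeisenbergCalculus

set_option linter.unusedSectionVars false

/-! ### Symplectic vector spaces with an adapted complex structure -/

/-- An alternating form `ω` on a real vector space `V` together with a complex structure `J`
adapted to it: `J² = -1`, `ω(Ju, Jv) = ω(u, v)` and `ω(Jv, v) > 0` for `v ≠ 0`.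
The last condition makes `ω` nondegenerate, so `ω` is a symplectic form. -/
structure AdaptedSymplectic (V : Type*) [NormedAddCommGroup V] [NormedSpace ℝ V] where
  ω : V →L[ℝ] V →L[ℝ] ℝ
  J : V →L[ℝ] V
  ω_self : ∀ v, ω v v = 0
  J_J : ∀ v, J (J v) = -v
  ω_J_J : ∀ u v, ω (J u) (J v) = ω u v
  ω_J_pos : ∀ v, v ≠ 0 → 0 < ω (J v) v

section Group

variable {V : Type*} [NormedAddCommGroup V] [NormedSpace ℝ V]

lemma AdaptedSymplectic.ω_swap (S : AdaptedSymplectic V) (u v : V) : S.ω u v = -S.ω v u := by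
  have h := S.ω_self (u + v)
  simp only [map_add, _root_.add_apply, S.ω_self] at h
  linarith

lemma AdaptedSymplectic.ω_J_right (S : AdaptedSymplectic V) (u v : V) :
    S.ω u (S.J v) = -S.ω (S.J u) v := by
  have h := S.ω_J_J u (S.J v)
  rw [S.J_J, map_neg] at h
  linarith

/-! ### The Heisenberg group `G = V ⊕ ℝ` -/

/-- The product `(v, t) · (v', t') = (v + v', t + t' + ½ ω(v, v'))` on `V × ℝ`. -/
noncomputable def mul (S : AdaptedSymplectic V) (g h : V × ℝ) : V × ℝ :=
  (g.1 + h.1, g.2 + h.2 + S.ω g.1 h.1 / 2)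

/-- The inverse for `mul`; the neutral element is `(0, 0)`. -/
def inv (g : V × ℝ) : V × ℝ := (-g.1, -g.2)

lemma mul_assoc' (S : AdaptedSymplectic V) (a b c : V × ℝ) :
    mul S (mul S a b) c = mul S a (mul S b c) := by
  ext
  · simp [mul, add_assoc]
  · simp [mul]; ring

lemma inv_mul_cancel' (S : AdaptedSymplectic V) (g : V × ℝ) : mul S (inv g) g = 0 := by
  ext <;> simp [mul, inv, S.ω_self]

lemma mul_inv_cancel' (S : AdaptedSymplectic V) (g : V × ℝ) : mul S g (inv g) = 0 := by
  ext <;> simp [mul, inv, S.ω_self]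

/-- The map `h ↦ h⁻¹ · g` as a homeomorphism of the group. -/
noncomputable def invMulHomeo (S : AdaptedSymplectic V) (g : V × ℝ) : (V × ℝ) ≃ₜ (V × ℝ) where
  toFun h := mul S (inv h) g
  invFun h := mul S g (inv h)
  left_inv h := by
    ext
    · simp [mul, inv]
    · simp [mul, inv, S.ω_self, S.ω_swap g.1 h.1]; ring
  right_inv h := by
    ext
    · simp [mul, inv]
    · simp [mul, inv, S.ω_self, S.ω_swap g.1 h.1]; ring
  continuous_toFun := by unfold mul inv; fun_prop
  continuous_invFun := by unfold mul inv; fun_prop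

/-- The dilation `δ_s (v, t) = (s v, s² t)`, for `s > 0`. -/
noncomputable def dilation (s : ℝ) (hs : 0 < s) : (V × ℝ) ≃L[ℝ] (V × ℝ) where
  toFun g := (s • g.1, s ^ 2 * g.2)
  invFun g := (s⁻¹ • g.1, (s ^ 2)⁻¹ * g.2)
  map_add' g h := by ext <;> simp [mul_add]
  map_smul' a g := by
    ext
    · simp [smul_comm s a]
    · simp; ring
  left_inv g := by ext <;> simp [hs.ne']
  right_inv g := by ext <;> simp [hs.ne']
  continuous_toFun := by fun_prop
  continuous_invFun := by fun_prop

/-- The anti-automorphism `op (v, t) = (v, -t)`. -/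
def opMap : (V × ℝ) ≃ₗᵢ[ℝ] (V × ℝ) where
  toFun g := (g.1, -g.2)
  invFun g := (g.1, -g.2)
  map_add' g h := by ext <;> simp [add_comm]
  map_smul' a g := by ext <;> simp
  left_inv g := by simp
  right_inv g := by simp
  norm_map' g := by simp [Prod.norm_def]

lemma opMap_mul (S : AdaptedSymplectic V) (g h : V × ℝ) :
    opMap (mul S g h) = mul S (opMap h) (opMap g) := by
  ext
  · simp [opMap, mul, add_comm]
  · simp [opMap, mul, S.ω_swap h.1 g.1]; ring

/-! ### Test functions and distributions on the group -/

/-- Complex test functions on `G`. -/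
abbrev Test (V : Type*) [NormedAddCommGroup V] [NormedSpace ℝ V] :=
  𝓓((⊤ : Opens (V × ℝ)), ℂ)

/-- Complex distributions on `G`: continuous `ℂ`-linear functionals on `C_c^∞(G)`. -/
abbrev Distr (V : Type*) [NormedAddCommGroup V] [NormedSpace ℝ V] := Test V →L[ℂ] ℂ

/-- `φ ∘ e` for a smooth homeomorphism `e` of `G`. -/
noncomputable def Test.comp (φ : Test V) (e : (V × ℝ) ≃ₜ (V × ℝ)) (he : ContDiff ℝ (⊤ : ℕ∞) e) : Test V where
  toFun g := φ (e g)
  contDiff' := φ.contDiff.comp he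
  hasCompactSupport' := φ.hasCompactSupport.comp_homeomorph e
  tsupport_subset' := by simp

/-- `φ_s (g) = φ (δ_s g)`. -/
noncomputable def Test.dilate (φ : Test V) (s : ℝ) (hs : 0 < s) : Test V :=
  φ.comp (dilation s hs).toHomeomorph
    (show ContDiff ℝ (⊤ : ℕ∞) (dilation (V := V) s hs) from
      (dilation (V := V) s hs).contDiff)

/-- `φ^op (v, t) = φ (v, -t)`. -/
noncomputable def Test.op (φ : Test V) : Test V := φ.comp opMap.toHomeomorph
    (show ContDiff ℝ (⊤ : ℕ∞) (opMap (V := V)) from (opMap (V := V)).toContinuousLinearEquiv.contDiff)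

lemma contDiff_invMulHomeo (S : AdaptedSymplectic V) (g : V × ℝ) :
    ContDiff ℝ (⊤ : ℕ∞) (invMulHomeo S g) := by
  change ContDiff ℝ (⊤ : ℕ∞) fun h : V × ℝ => mul S (inv h) g
  unfold mul inv
  fun_prop

/-- The distribution `k^op`, `⟨k^op, φ⟩ = ⟨k, φ^op⟩`. -/
noncomputable def Distr.op (k : Distr V) : Distr V :=
  TestFunction.mkCLM ℂ (fun φ : Test V => k φ.op)
    (fun φ ψ => by
      rw [← map_add]; exact congrArg k (TestFunction.ext fun _ => rfl))
    (fun c φ => by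
      rw [← map_smul]; exact congrArg k (TestFunction.ext fun _ => rfl))
    (fun K hK => by
      let K' : Compacts (V × ℝ) := ⟨opMap ⁻¹' K, by
        exact (opMap (V := V)).toHomeomorph.isCompact_preimage.2 K.isCompact⟩
      let T := ContDiffMapSupportedIn.mkCLM ℂ (E := V × ℝ) (F := ℂ) (F' := ℂ) (n₁ := ⊤) (n₂ := ⊤)
        (K₁ := K) (K₂ := K') (fun f x => f (opMap x)) (fun f g x => rfl) (fun c f x => rfl)
        (fun f => f.contDiff.comp (opMap (V := V)).toContinuousLinearEquiv.contDiff)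
        (fun f x hx => f.zero_on_compl hx)
        (fun i hi => ⟨{i}, 1, zero_le_one, fun f x hx => by
          have := (opMap (V := V)).norm_iteratedFDeriv_comp_right (𝕜 := ℝ) f x i
          simp only [Function.comp_def] at this
          rw [this]
          simpa using ContDiffMapSupportedIn.norm_iteratedFDeriv_apply_le_seminorm ℂ hi⟩)
      exact (k.continuous.comp (TestFunction.continuous_ofSupportedIn (Set.subset_univ _))).comp
        T.continuous)

/-- The homogeneous dimension `Q = 2n + 2`, where `2n = dim V`. -/
noncomputable def homDim (V : Type*) [NormedAddCommGroup V] [NormedSpace ℝ V] : ℕ :=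
  Module.finrank ℝ V + 2

/-- `k` is homogeneous of degree `d`: `⟨k, φ_s⟩ = s^(-Q-d) ⟨k, φ⟩` for all `s > 0`. -/
def Distr.IsHomogeneous (k : Distr V) (d : ℝ) : Prop :=
  ∀ (s : ℝ) (hs : 0 < s) (φ : Test V),
    k (φ.dilate s hs) = ((s ^ (-(homDim V : ℝ) - d) : ℝ) : ℂ) * k φ

/-- The convolution `(k ∗ φ)(g) = ⟨k(h), φ(h⁻¹ g)⟩`. -/
noncomputable def conv (S : AdaptedSymplectic V) (k : Distr V) (φ : Test V) : V × ℝ → ℂ :=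
  fun g => k (φ.comp (invMulHomeo S g) (contDiff_invMulHomeo S g))

end Group

section Measure

variable {V : Type*} [NormedAddCommGroup V] [NormedSpace ℝ V] [FiniteDimensional ℝ V]
  [MeasureSpace V] [BorelSpace V] [(volume : Measure V).IsAddHaarMeasure]

/-- `k` is regular: its restriction to `G ∖ {0}` is a smooth function. Here `V` carries a
Lebesgue measure, and the product measure on `V × ℝ` is the Haar measure of `G`. -/
def Distr.IsRegular (k : Distr V) : Prop :=
  ∃ K : V × ℝ → ℂ, ContDiffOn ℝ (⊤ : ℕ∞) K {0}ᶜ ∧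
    ∀ φ : Test V, (0 : V × ℝ) ∉ tsupport φ → k φ = ∫ g, K g * φ g

lemma Test.memLp (φ : Test V) : MemLp φ 2 (volume : Measure (V × ℝ)) :=
  φ.continuous.memLp_of_hasCompactSupport φ.hasCompactSupport

/-- The bounded operator `P` on `L²(G)` is the right invariant operator `φ ↦ k ∗ φ`. As
`C_c^∞(G)` is dense in `L²(G)`, there is at most one such `P`. -/
def IsConvolutionOperator (S : AdaptedSymplectic V) (k : Distr V)
    (P : Lp ℂ 2 (volume : Measure (V × ℝ)) →L[ℂ] Lp ℂ 2 (volume : Measure (V × ℝ))) : Prop :=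
  ∀ φ : Test V, P (φ.memLp.toLp φ) =ᵐ[volume] conv S k φ

/-! ### The Bargmann–Fock space

`V` is identified with `V^{0,1}`, the `-i`-eigenspace of `J` in `V ⊗ ℂ`, by
`u ↦ u^{0,1} = ½ (u + i J u)`. Multiplication by `i` on `V^{0,1}` corresponds to `-J` on `V`.
For the hermitian form `⟨z, w⟩ = 2 i ω(z, w̄)` on `V^{1,0}`, an orthonormal basis `Z_1, …, Z_n` of
`V^{1,0}` and `u^{0,1} = ∑ z_j Z̄_j` we have `|z|² = ∑ |z_j|² = ω(Ju, u)`. -/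

/-- The Gaussian measure `e^{-|z|²} dz` on `V^{0,1} ≅ V`. -/
noncomputable def gaussian (S : AdaptedSymplectic V) : Measure V :=
  (volume : Measure V).withDensity fun u => ENNReal.ofReal (Real.exp (-S.ω (S.J u) u))

/-- `F` is holomorphic as a function on `V^{0,1} ≅ V`. -/
def IsHolomorphic (S : AdaptedSymplectic V) (F : V → ℂ) : Prop :=
  Differentiable ℝ F ∧ ∀ u h, fderiv ℝ F u (-S.J h) = Complex.I * fderiv ℝ F u h

/-- The holomorphic functions on `V^{0,1} ≅ V` that are square integrable for the Gaussian
measure. -/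
def bargmannFockSubmodule (S : AdaptedSymplectic V) : Submodule ℂ (V → ℂ) where
  carrier := {F | IsHolomorphic S F ∧ MemLp F 2 (gaussian S)}
  add_mem' {F G} hF hG := by
    refine ⟨⟨hF.1.1.add hG.1.1, fun u h => ?_⟩, hF.2.add hG.2⟩
    rw [fderiv_add (hF.1.1 u) (hG.1.1 u)]
    simp only [_root_.add_apply, hF.1.2, hG.1.2, mul_add]
  zero_mem' := ⟨⟨differentiable_const 0, fun u h => by
    have : fderiv ℝ (0 : V → ℂ) u = 0 := by simp
    simp [this]⟩, MemLp.zero⟩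
  smul_mem' c F hF := by
    refine ⟨⟨hF.1.1.const_smul c, fun u h => ?_⟩, hF.2.const_smul c⟩
    rw [fderiv_const_smul (hF.1.1 u)]
    simp only [_root_.smul_apply, hF.1.2, smul_eq_mul]
    ring

/-- The Bargmann–Fock space `H^{BF}`. -/
def BargmannFock (S : AdaptedSymplectic V) : Type _ := bargmannFockSubmodule S

namespace BargmannFock

variable (S : AdaptedSymplectic V)

instance : AddCommGroup (BargmannFock S) := inferInstanceAs (AddCommGroup (bargmannFockSubmodule S))

instance : Module ℂ (BargmannFock S) := inferInstanceAs (Module ℂ (bargmannFockSubmodule S))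

variable {S} in
/-- The function on `V^{0,1} ≅ V` underlying an element of `H^{BF}`. -/
def fn (F : BargmannFock S) : V → ℂ := F.1

/-- The inclusion of `H^{BF}` in the `L²`-space of the Gaussian measure. -/
noncomputable def toL2 : BargmannFock S →ₗ[ℂ] Lp ℂ 2 (gaussian S) where
  toFun F := MemLp.toLp F.1 F.2.2
  map_add' _ _ := rfl
  map_smul' _ _ := rfl

lemma volume_ac_gaussian : (volume : Measure V) ≪ gaussian S := by
  refine withDensity_absolutelyContinuous' ?_ ?_
  · fun_prop
  · exact Filter.Eventually.of_forall fun u => by simp [Real.exp_pos]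

lemma toL2_injective : Function.Injective (toL2 S) := by
  intro F G h
  have h' : F.1 =ᵐ[gaussian S] G.1 := (MemLp.toLp_eq_toLp_iff F.2.2 G.2.2).1 h
  exact Subtype.ext ((F.2.1.1.continuous.ae_eq_iff_eq volume G.2.1.1.continuous).1
    ((volume_ac_gaussian S).ae_eq h'))

noncomputable instance : NormedAddCommGroup (BargmannFock S) :=
  NormedAddCommGroup.induced _ _ (toL2 S) (toL2_injective S)

/-- The inner product `⟨F, G⟩ = ∫ F Ḡ e^{-|z|²} dz` (Mathlib's `inner` is conjugate linear in its
first variable). -/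
noncomputable instance : InnerProductSpace ℂ (BargmannFock S) where
  norm_smul_le c F := by
    change ‖toL2 S (c • F)‖ ≤ ‖c‖ * ‖toL2 S F‖
    rw [map_smul]
    exact norm_smul_le _ _
  inner F G := inner ℂ (toL2 S F) (toL2 S G)
  norm_sq_eq_re_inner F := norm_sq_eq_re_inner (𝕜 := ℂ) (toL2 S F)
  conj_inner_symm F G := inner_conj_symm (toL2 S F) (toL2 S G)
  add_left F G H := by rw [map_add]; exact inner_add_left ..
  smul_left F G c := by rw [map_smul]; exact inner_smul_left ..

lemma inner_eq (F G : BargmannFock S) :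
    inner ℂ F G = ∫ u, G.fn u * star (F.fn u) ∂(gaussian S) := by
  change inner ℂ (toL2 S F) (toL2 S G) = _
  rw [L2.inner_def]
  refine integral_congr_ae ?_
  filter_upwards [MemLp.coeFn_toLp F.2.2, MemLp.coeFn_toLp G.2.2] with u hF hG
  change inner ℂ ((MemLp.toLp F.1 F.2.2 : V → ℂ) u) ((MemLp.toLp G.1 G.2.2 : V → ℂ) u) = _
  rw [hF, hG]
  rfl

end BargmannFock

/-! ### The Bargmann–Fock representation

The real parameter `c > 0` only rescales the group: `π = π₁ ∘ δ_c` with `π₁` the case `c = 1`.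
For `c > 0` this is the irreducible unitary representation of `G` which integrates
`π(Z_j) = i c z_j`, `π(Z̄_j) = i c ∂/∂z_j`, `π(1) = 2 i c²`
(recall that `[Z_j, Z̄_k] = ω(Z_j, Z̄_k) = δ_jk / (2 i)`). For `v = ∑ (a_j Z_j + ā_j Z̄_j)`
in `V` it is given by
`(π(v, t) F)(z) = e^{2 i c² t} e^{i c ∑ (a_j z_j + ā_j ∂/∂z_j)} F (z)
  = e^{2 i c² t - c² |a|² / 2 + i c ∑ a_j z_j} F(z + i c ā)`.
If `z` are the coordinates of `u^{0,1}`, then `|a|² = ω(Jv, v)` and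
`∑ a_j z_j = 2 i ω(v, u^{0,1}) = ω(Ju, v) + i ω(v, u)`, and `z + i c ā` are the coordinates
of `(u - c J v)^{0,1}`. -/

section Representation

variable (S : AdaptedSymplectic V) (c : ℝ)

/-- The exponential factor in `(π(v, t) F)(u)`. -/
noncomputable def repFactor (g : V × ℝ) (u : V) : ℂ :=
  Complex.exp (2 * Complex.I * c ^ 2 * g.2 - c ^ 2 / 2 * S.ω (S.J g.1) g.1
    + Complex.I * c * (S.ω (S.J u) g.1 + Complex.I * S.ω g.1 u))

/-- The function `π(g) F` on `V^{0,1} ≅ V`. -/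
noncomputable def repFun (g : V × ℝ) (F : V → ℂ) : V → ℂ :=
  fun u => repFactor S c g u * F (u - c • S.J g.1)

lemma repFun_norm (g : V × ℝ) (F : V → ℂ) (u : V) :
    ENNReal.ofReal (Real.exp (-S.ω (S.J u) u)) * ‖repFun S c g F u‖ₑ ^ (2 : ℝ) =
      ENNReal.ofReal (Real.exp (-S.ω (S.J (u - c • S.J g.1)) (u - c • S.J g.1))) *
        ‖F (u - c • S.J g.1)‖ₑ ^ (2 : ℝ) := by
  have h1 : ‖repFactor S c g u‖ₑ ^ (2 : ℝ) = ENNReal.ofReal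
      (Real.exp (2 * (-(c ^ 2 / 2 * S.ω (S.J g.1) g.1) - c * S.ω g.1 u))) := by
    rw [← ofReal_norm, repFactor, Complex.norm_exp,
      ENNReal.ofReal_rpow_of_pos (Real.exp_pos _), ← Real.exp_mul]
    congr 2
    rw [mul_comm]
    congr 1
    have : (c : ℂ) ^ 2 = ((c ^ 2 : ℝ) : ℂ) := by push_cast; rfl
    rw [this]
    simp
    norm_cast
    ring
  have h2 : ‖repFun S c g F u‖ₑ ^ (2 : ℝ) =
      ‖repFactor S c g u‖ₑ ^ (2 : ℝ) * ‖F (u - c • S.J g.1)‖ₑ ^ (2 : ℝ) := by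
    rw [repFun, enorm_mul, ENNReal.mul_rpow_of_nonneg _ _ (by norm_num)]
  rw [h2, h1, ← mul_assoc, ← ENNReal.ofReal_mul (Real.exp_pos _).le, ← Real.exp_add]
  congr 3
  simp only [map_sub, map_smul, _root_.sub_apply, _root_.smul_apply, smul_eq_mul, S.J_J,
    S.ω_J_J, map_neg, _root_.neg_apply, S.ω_swap g.1 u, S.ω_J_right]
  ring

lemma eLpNorm_gaussian (F : V → ℂ) :
    eLpNorm F 2 (gaussian S) =
      (∫⁻ u, ENNReal.ofReal (Real.exp (-S.ω (S.J u) u)) * ‖F u‖ₑ ^ (2 : ℝ)) ^ (1 / 2 : ℝ) := by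
  rw [eLpNorm_eq_lintegral_rpow_enorm_toReal (by simp) (by simp), gaussian,
    lintegral_withDensity_eq_lintegral_mul_non_measurable]
  · simp
  · fun_prop
  · exact Filter.Eventually.of_forall fun u => by simp

/-- The operators `π(g)` are isometric. -/
lemma eLpNorm_repFun (g : V × ℝ) (F : V → ℂ) :
    eLpNorm (repFun S c g F) 2 (gaussian S) = eLpNorm F 2 (gaussian S) := by
  rw [eLpNorm_gaussian, eLpNorm_gaussian]
  simp only [repFun_norm]
  rw [lintegral_sub_right_eq_self (μ := volume)
    (fun u : V => ENNReal.ofReal (Real.exp (-S.ω (S.J u) u)) * ‖F u‖ₑ ^ (2 : ℝ)) (c • S.J g.1)]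

lemma isHolomorphic_repFun (g : V × ℝ) {F : V → ℂ} (hF : IsHolomorphic S F) :
    IsHolomorphic S (repFun S c g F) := by
  let β : V →L[ℝ] ℂ := (Complex.I * c) • ((Complex.ofRealCLM ∘L (S.ω.flip g.1 ∘L S.J)) +
    Complex.I • (Complex.ofRealCLM ∘L S.ω g.1))
  have hβ : ∀ u, β u = Complex.I * c * (S.ω (S.J u) g.1 + Complex.I * S.ω g.1 u) := fun u => by
    simp [β]
    ring
  have hβJ : ∀ h, β (-S.J h) = Complex.I * β h := fun h => by
    rw [hβ, hβ, map_neg S.J, S.J_J, neg_neg, map_neg (S.ω g.1), S.ω_J_right, neg_neg,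
      S.ω_swap g.1 h, S.ω_swap (S.J g.1) h, S.ω_J_right, neg_neg]
    push_cast
    linear_combination (Complex.I * c * S.ω h g.1) * Complex.I_sq
  let α : ℂ := 2 * Complex.I * c ^ 2 * g.2 - c ^ 2 / 2 * S.ω (S.J g.1) g.1
  have hE : ∀ u, HasFDerivAt (repFactor S c g) (repFactor S c g u • β) u := fun u => by
    have h := ((β.hasFDerivAt (x := u)).const_add α).cexp
    have e : repFactor S c g = fun u => Complex.exp (α + β u) := by
      funext u; rw [hβ]; rfl
    rw [e]
    exact h
  have hT : ∀ u, HasFDerivAt (fun u => F (u - c • S.J g.1))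
      (fderiv ℝ F (u - c • S.J g.1)) u := fun u => by
    simpa [Function.comp_def] using (hF.1 (u - c • S.J g.1)).hasFDerivAt.comp u
      ((hasFDerivAt_id (𝕜 := ℝ) u).sub_const (c • S.J g.1))
  have hR : ∀ u, HasFDerivAt (repFun S c g F) _ u := fun u => (hE u).mul (hT u)
  refine ⟨fun u => (hR u).differentiableAt, fun u h => ?_⟩
  rw [(hR u).fderiv]
  simp only [_root_.add_apply, _root_.smul_apply, smul_eq_mul, hβJ, hF.2]
  ring

lemma repFun_mul (g h : V × ℝ) (F : V → ℂ) :
    repFun S c (mul S g h) F = repFun S c g (repFun S c h F) := by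
  funext u
  have e : u - c • S.J (mul S g h).1 = u - c • S.J g.1 - c • S.J h.1 := by
    simp only [mul, map_add, smul_add]
    abel
  simp only [repFun, e, ← mul_assoc]
  congr 1
  simp only [repFactor, ← Complex.exp_add]
  congr 1
  simp only [mul, map_add, map_sub, map_smul, _root_.add_apply, _root_.sub_apply,
    _root_.smul_apply, smul_eq_mul, S.J_J, map_neg, _root_.neg_apply, S.ω_J_right]
  rw [S.ω_swap (S.J h.1) g.1, S.ω_J_right]
  push_cast
  linear_combination (-(c : ℂ) ^ 2 * S.ω (S.J g.1) h.1) * Complex.I_sq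

lemma repFun_mem (g : V × ℝ) (F : BargmannFock S) :
    repFun S c g F.fn ∈ bargmannFockSubmodule S :=
  ⟨isHolomorphic_repFun S c g F.2.1,
    (isHolomorphic_repFun S c g F.2.1).1.continuous.aestronglyMeasurable,
    (eLpNorm_repFun S c g F.fn).trans_lt F.2.2.2⟩

/-- The unitary operator `π(g)` on `H^{BF}`. -/
noncomputable def rep (g : V × ℝ) : BargmannFock S →ₗᵢ[ℂ] BargmannFock S where
  toFun F := ⟨repFun S c g F.fn, repFun_mem S c g F⟩
  map_add' F G := Subtype.ext (funext fun u => mul_add _ _ _)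
  map_smul' a F := Subtype.ext (funext fun u => mul_left_comm _ _ _)
  norm_map' F := by
    change ‖MemLp.toLp (repFun S c g F.fn) (repFun_mem S c g F).2‖ = ‖MemLp.toLp F.1 F.2.2‖
    rw [Lp.norm_toLp, Lp.norm_toLp]
    exact congrArg ENNReal.toReal (eLpNorm_repFun S c g F.fn)

lemma rep_mul (g h : V × ℝ) : rep S c (mul S g h) = (rep S c g).comp (rep S c h) :=
  LinearIsometry.ext fun F => Subtype.ext (repFun_mul S c g h F.fn)

lemma rep_zero : rep S c 0 = LinearIsometry.id :=
  LinearIsometry.ext fun F => Subtype.ext (funext fun u => by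
    change repFun S c 0 F.fn u = F.fn u
    simp [repFun, repFactor])

/-- `π(f) = ∫ f(g) π(g) dg` for a function `f ∈ L¹(G)`. -/
noncomputable def repIntegral (f : V × ℝ → ℂ) (F : BargmannFock S) : BargmannFock S :=
  ∫ g, f g • rep S c g F

/-- The bounded operator `A` on `H^{BF}` is `π(k)`, that is, `A π(φ) = π(k ∗ φ)`.
Here `k` is meant to be regular and homogeneous of degree `-Q`. In that case, `k ∗ φ` is
integrable if the test function `φ` has mean zero, and the vectors `π(φ) F`, for such `φ`, span a
dense subspace of `H^{BF}`, so that there is at most one such `A`. -/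
def IsRepresentedBy (k : Distr V) (A : BargmannFock S →L[ℂ] BargmannFock S) : Prop :=
  ∀ φ : Test V, (∫ g, φ g) = 0 →
    ∀ F : BargmannFock S, A (repIntegral S c φ F) = repIntegral S c (conv S k φ) F

end Representation
end Measure
end HeisenbergCalculus

/-! Dyadic decomposition. A regular kernel of degree `-Q` is `k = a δ₀ + ∑ f_j`, where the `f_j` are
the L¹-normalized dyadic dilates of a single test function `f` of mean zero
(`Distr.exists_hasKernel`). In every strongly continuous unitary representation `ρ` on a Hilbert
space the operators `ρ(f_j)` are almost orthogonal: products at scales `i` and `j` are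
`O(2^(-|i-j|))`, because a mean zero function at a fine scale meets a function that is smooth at the
coarser scale. The Cotlar–Stein lemma then sums them to a bounded operator `ρ(k)`, called
`UnitaryRep.mult`. For `φ` of mean zero, `k ∗ φ` is integrable and `ρ(k) ρ(φ) = ρ(k ∗ φ)`
(`UnitaryRep.mult_integ`). The left regular representation yields `P`, the Bargmann–Fock
representation `π_c` yields `π(P)`, and density of the vectors reached by test functions yields
uniqueness. Since `π_c ∘ δ_s = π_(cs)` and `k` is homogeneous, `π_c(k)` is the same operator for all
`c > 0` (`Distr.HasKernel.mult_bf_eq`).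

Upper bound for `‖P‖`. The Fourier transform in the central variable splits `‖φ‖²` into slices of
frequency `s`. For `s = 2c² > 0` the slice is, up to a constant, `∫ ‖π_c(φ) π_c(v,0) Ω‖² dv` with
`Ω` the vacuum (`exists_lintegral_integ_sq`), so passing from `φ` to `k ∗ φ` enlarges it at most by
the factor `‖π(k)‖²`. The map `φ♯(v,t) = conj φ(-v,t)` turns negative frequencies into positive ones
and `k` into `k♯`. As `op` composed with inversion is `(v,t) ↦ (-v,t)`, the kernel `k♯` is the
adjoint kernel of `k^op`, whence `‖π(k♯)‖ = ‖π(k^op)‖`.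

Lower bound. The coefficients `g ↦ (π(g⁻¹) F)(0)` are square integrable modulo the centre.
Multiplied by long normalized cutoffs in the central variable they define multiples of isometries
into `L²(G)` which intertwine `π` with the regular representation in the limit
(`exists_asympIntertwiner`). Hence `‖π(k)‖ ≤ ‖P‖`, and likewise for `k♯`, whose convolution operator
has norm at most `‖P‖` because `φ ↦ φ♯` is isometric. -/

namespace HeisenbergCalculus

set_option linter.unusedSectionVars false

/-! ### The Cotlar–Stein lemma -/

section CotlarStein

variable {A : Type*} [NormedRing A] [StarRing A] [CStarRing A] {ι : Type} [Fintype ι]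

/-- The expansion of `T (T⋆ T) ^ m`, for `T = ∑ T i`, in words with two bounds for each. -/
lemma cotlarStein_words (T : ι → A) (a : ι → ι → ℝ) (ha : ∀ i j, 0 ≤ a i j) (M : ℝ)
    (h1 : ∀ i j, ‖star (T i) * T j‖ ≤ a i j ^ 2) (h2 : ∀ i j, ‖T i * star (T j)‖ ≤ a i j ^ 2)
    (hr : ∀ i, ∑ j, a i j ≤ M) (m : ℕ) :
    ∃ (W : Type) (_ : Fintype W) (Y : W → A) (e : W → ι) (α β : W → ℝ),
      (∀ w, 0 ≤ α w) ∧ (∀ w, 0 ≤ β w) ∧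
      ∑ w, Y w * T (e w) = (∑ i, T i) * (star (∑ i, T i) * ∑ i, T i) ^ m ∧
      (∀ w, ‖Y w * T (e w)‖ ≤ α w) ∧ (∀ w, ‖Y w‖ ≤ β w) ∧
      ∑ w, √(α w * β w) ≤ (∑ i, √(‖T i‖ * ‖(1 : A)‖)) * M ^ (2 * m) := by
  induction m with
  | zero =>
    -- The factor `‖1‖` is kept because it is `0` in the trivial ring.
    exact ⟨ι, inferInstance, fun _ => 1, id, fun i => ‖T i‖, fun _ => ‖(1 : A)‖,
      fun _ => norm_nonneg _, fun _ => norm_nonneg _, by simp, fun i => by simp,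
      fun _ => le_rfl, by simp⟩
  | succ m ih =>
    obtain ⟨W, hW, Y, e, α, β, hα, hβ, hsum, hX, hY, hb⟩ := ih
    -- A word is prolonged by `T_j⋆ T_l`. The bound of the whole word groups these two new letters,
    -- the bound of the prefix groups the old last letter with `T_j⋆`. In the geometric mean of the
    -- two bounds every adjacent pair then contributes one factor `a`, and the sums over `l` and `j`
    -- give `M ^ 2`.
    refine ⟨W × ι × ι, inferInstance, fun w => Y w.1 * T (e w.1) * star (T w.2.1),
      fun w => w.2.2, fun w => α w.1 * a w.2.1 w.2.2 ^ 2, fun w => β w.1 * a (e w.1) w.2.1 ^ 2,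
      fun w => mul_nonneg (hα _) (sq_nonneg _), fun w => mul_nonneg (hβ _) (sq_nonneg _),
      ?_, fun w => ?_, fun w => ?_, ?_⟩
    · rw [pow_succ, ← mul_assoc, ← hsum, star_sum]
      simp only [Fintype.sum_prod_type, mul_assoc, ← Finset.mul_sum, ← Finset.sum_mul]
      simp only [← mul_assoc, ← Finset.sum_mul]
    · rw [mul_assoc]
      exact (norm_mul_le _ _).trans
        (mul_le_mul (hX _) (h1 _ _) (norm_nonneg _) (hα _))
    · dsimp only
      rw [mul_assoc]
      exact (norm_mul_le _ _).trans
        (mul_le_mul (hY _) (h2 _ _) (norm_nonneg _) (hβ _))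
    · have hs : ∀ w : W × ι × ι, √(α w.1 * a w.2.1 w.2.2 ^ 2 * (β w.1 * a (e w.1) w.2.1 ^ 2)) =
          √(α w.1 * β w.1) * (a (e w.1) w.2.1 * a w.2.1 w.2.2) := fun w => by
        rw [← Real.sqrt_sq (mul_nonneg (ha (e w.1) w.2.1) (ha w.2.1 w.2.2)),
          ← Real.sqrt_mul (mul_nonneg (hα _) (hβ _))]
        congr 1
        ring
      simp only [hs, Fintype.sum_prod_type, ← Finset.mul_sum]
      have hM : ∀ i : ι, ∑ j, a i j * ∑ l, a j l ≤ M ^ 2 := fun i => by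
        have hM0 : 0 ≤ M := (Finset.sum_nonneg fun j _ => ha i j).trans (hr i)
        calc ∑ j, a i j * ∑ l, a j l ≤ ∑ j, a i j * M :=
              Finset.sum_le_sum fun j _ => mul_le_mul_of_nonneg_left (hr j) (ha i j)
          _ = (∑ j, a i j) * M := by rw [Finset.sum_mul]
          _ ≤ M ^ 2 := by rw [sq]; exact mul_le_mul_of_nonneg_right (hr i) hM0
      calc ∑ w, √(α w * β w) * ∑ j, a (e w) j * ∑ l, a j l
          ≤ ∑ w, √(α w * β w) * M ^ 2 :=
            Finset.sum_le_sum fun w _ => mul_le_mul_of_nonneg_left (hM _) (Real.sqrt_nonneg _)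
        _ = (∑ w, √(α w * β w)) * M ^ 2 := by rw [Finset.sum_mul]
        _ ≤ _ := by
            rw [mul_add, pow_add, ← mul_assoc]
            exact mul_le_mul_of_nonneg_right hb (by positivity)

/-- The Cotlar–Stein lemma. -/
theorem norm_sum_le_of_almost_orthogonal (T : ι → A) (a : ι → ι → ℝ) (ha : ∀ i j, 0 ≤ a i j)
    (M : ℝ) (hM : 0 < M)
    (h1 : ∀ i j, ‖star (T i) * T j‖ ≤ a i j ^ 2) (h2 : ∀ i j, ‖T i * star (T j)‖ ≤ a i j ^ 2)
    (hr : ∀ i, ∑ j, a i j ≤ M) : ‖∑ i, T i‖ ≤ M := by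
  set t := ∑ i, T i with ht
  set b := ∑ i, ‖T i‖
  set D := ∑ i, √(‖T i‖ * ‖(1 : A)‖)
  have hD : 0 ≤ D := Finset.sum_nonneg fun _ _ => Real.sqrt_nonneg _
  have key : ∀ m : ℕ, ‖t * (star t * t) ^ m‖ ≤ √b * D * M ^ (2 * m) := fun m => by
    obtain ⟨W, hW, Y, e, α, β, hα, hβ, hsum, hX, hY, hb⟩ :=
      cotlarStein_words T a ha M h1 h2 hr m
    rw [← ht] at hsum
    rw [← hsum, mul_assoc]
    refine (norm_sum_le _ _).trans (le_trans ?_ (mul_le_mul_of_nonneg_left hb (Real.sqrt_nonneg _)))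
    rw [Finset.mul_sum]
    refine Finset.sum_le_sum fun w _ => ?_
    -- Bounding the last letter by `b` makes `β w * b` a second bound for the whole word, so its
    -- norm is at most the geometric mean of `α w` and `β w * b`.
    have hTe : ‖T (e w)‖ ≤ b :=
      Finset.single_le_sum (f := fun i => ‖T i‖) (fun _ _ => norm_nonneg _) (Finset.mem_univ _)
    have hy : ‖Y w * T (e w)‖ ≤ β w * b := (norm_mul_le _ _).trans
      (mul_le_mul (hY w) hTe (norm_nonneg _) (hβ w))
    rw [← Real.sqrt_mul (Finset.sum_nonneg fun _ _ => norm_nonneg _)]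
    refine Real.le_sqrt_of_sq_le ?_
    rw [sq]
    calc _ ≤ α w * (β w * b) := mul_le_mul (hX w) hy (norm_nonneg _) (hα w)
      _ = _ := by ring
  have hsq : ‖star t * t‖ = ‖t‖ ^ 2 := by rw [CStarRing.norm_star_mul_self, sq]
  -- The C⋆-identity turns `‖t‖` into norms of high powers of `t⋆ t`, where the constants `b` and
  -- `D` become harmless: were `‖t‖ > M`, the left side would be unbounded in `n`.
  have key2 : ∀ n : ℕ, (‖t‖ ^ 2 / M ^ 2) ^ 2 ^ n ≤ ‖t‖ * (√b * D) / M ^ 2 := fun n => by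
    have hsa : IsSelfAdjoint (star t * t) := .star_mul_self t
    have e1 : ‖(star t * t) ^ 2 ^ n‖ = (‖t‖ ^ 2) ^ 2 ^ n := by
      have := congrArg NNReal.toReal (hsa.nnnorm_pow_two_pow n)
      push_cast at this
      rw [← hsq]; exact_mod_cast this
    obtain ⟨m, hm⟩ : ∃ m, 2 ^ n = m + 1 := ⟨2 ^ n - 1, (Nat.sub_add_cancel Nat.one_le_two_pow).symm⟩
    have e2 : ‖(star t * t) ^ 2 ^ n‖ ≤ ‖t‖ * (√b * D * M ^ (2 * m)) := by
      rw [hm, pow_succ', mul_assoc]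
      refine (norm_mul_le _ _).trans ?_
      rw [norm_star]
      exact mul_le_mul_of_nonneg_left (key m) (norm_nonneg _)
    rw [e1] at e2
    rw [div_pow, div_le_div_iff₀ (by positivity) (by positivity)]
    calc (‖t‖ ^ 2) ^ 2 ^ n * M ^ 2 ≤ ‖t‖ * (√b * D * M ^ (2 * m)) * M ^ 2 :=
          mul_le_mul_of_nonneg_right e2 (by positivity)
      _ = _ := by rw [hm]; ring
  by_contra! hlt
  have hr1 : 1 < ‖t‖ ^ 2 / M ^ 2 := by
    rw [one_lt_div (by positivity)]
    exact pow_lt_pow_left₀ hlt hM.le two_ne_zero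
  have hlim : Filter.Tendsto (fun n : ℕ => (‖t‖ ^ 2 / M ^ 2) ^ 2 ^ n) Filter.atTop Filter.atTop :=
    (tendsto_pow_atTop_atTop_of_one_lt hr1).comp
      (tendsto_pow_atTop_atTop_of_one_lt (by norm_num : 1 < 2))
  obtain ⟨n, hn⟩ := (hlim.eventually_gt_atTop (‖t‖ * (√b * D) / M ^ 2)).exists
  exact absurd (key2 n) (not_le.2 hn)

end CotlarStein

/-! ### Plancherel's theorem for integrable square integrable functions -/

section Fourier

open scoped FourierTransform SchwartzMap

variable {E : Type*} [NormedAddCommGroup E] [InnerProductSpace ℝ E] [FiniteDimensional ℝ E]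
  [MeasurableSpace E] [BorelSpace E]

/-- The L² transform is characterized through tempered distributions and the integral transform
through the exchange formula `∫ 𝓕G · f = ∫ G · 𝓕f`. Both therefore have the same integrals against
test functions, which determines a locally integrable function almost everywhere. -/
lemma fourier_toLp_ae_eq {f : E → ℂ} (h1 : Integrable f) (h2 : MemLp f 2) :
    ((𝓕 (h2.toLp f) : Lp ℂ 2 (volume : Measure E)) : E → ℂ) =ᵐ[volume] 𝓕 f := by
  have hc : Continuous (𝓕 f) :=
    VectorFourier.fourierIntegral_continuous Real.continuous_fourierChar
      continuous_inner h1
  set F : Lp ℂ 2 (volume : Measure E) := 𝓕 (h2.toLp f)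
  have hl : LocallyIntegrable (fun x => F x - 𝓕 f x) :=
    ((Lp.memLp F).locallyIntegrable one_le_two).sub hc.locallyIntegrable
  have hz : ∀ᵐ x, F x - 𝓕 f x = 0 := by
    refine ae_eq_zero_of_integral_contDiff_smul_eq_zero hl fun g hg hgc => ?_
    have hg1 : HasCompactSupport (Complex.ofRealCLM ∘ g) := hgc.comp_left rfl
    have hg2 : ContDiff ℝ (⊤ : ℕ∞) (Complex.ofRealCLM ∘ g) := by fun_prop
    set G : 𝓢(E, ℂ) := hg1.toSchwartzMap hg2
    have hi1 : Integrable fun x => G x • F x := by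
      have := (Lp.memLp F).integrable_mul (G.memLp 2)
      simpa only [smul_eq_mul, mul_comm] using! this
    have hi2 : Integrable fun x => G x • 𝓕 f x := by
      exact (G.continuous.smul hc).integrable_of_hasCompactSupport hg1.smul_right
    have e1 : ∫ x, G x • F x = ∫ x, G x • 𝓕 f x := by
      have := congrArg (fun T => T G) (Lp.fourier_toTemperedDistribution_eq (h2.toLp f))
      simp only [TemperedDistribution.fourier_apply, Lp.toTemperedDistribution_apply] at this
      rw [← this]
      have h3 := VectorFourier.integral_fourierIntegral_smul_eq_flip (L := innerₗ E)
        (μ := volume) (ν := volume) Real.continuous_fourierChar continuous_inner G.integrable h1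
      rw [flip_innerₗ] at h3
      refine Eq.trans (integral_congr_ae ?_) h3
      filter_upwards [h2.coeFn_toLp] with x hx
      rw [hx]
      rfl
    calc ∫ x, g x • (F x - 𝓕 f x) = ∫ x, (G x • F x - G x • 𝓕 f x) := by
          simp [G, mul_sub]
      _ = 0 := by rw [integral_sub hi1 hi2, e1, sub_self]
  filter_upwards [hz] with x hx using sub_eq_zero.1 hx

lemma lintegral_enorm_fourier_sq {f : E → ℂ} (h1 : Integrable f) (h2 : MemLp f 2) :
    ∫⁻ x, ‖𝓕 f x‖ₑ ^ 2 = ∫⁻ x, ‖f x‖ₑ ^ 2 := by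
  have key : ∀ g : Lp ℂ 2 (volume : Measure E), ∫⁻ x, ‖g x‖ₑ ^ 2 = ‖g‖ₑ ^ 2 := fun g => by
    rw [Lp.enorm_def, eLpNorm_eq_lintegral_rpow_enorm_toReal (by simp) (by simp),
      ← ENNReal.rpow_natCast, ← ENNReal.rpow_mul]
    simp
  calc ∫⁻ x, ‖𝓕 f x‖ₑ ^ 2
      = ∫⁻ x, ‖(𝓕 (h2.toLp f) : Lp ℂ 2 (volume : Measure E)) x‖ₑ ^ 2 := by
        refine lintegral_congr_ae ?_
        filter_upwards [fourier_toLp_ae_eq h1 h2] with x hx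
        rw [hx]
    _ = ∫⁻ x, ‖h2.toLp f x‖ₑ ^ 2 := by
        rw [key, key, ← ofReal_norm, ← ofReal_norm, Lp.norm_fourier_eq]
    _ = _ := by
        refine lintegral_congr_ae ?_
        filter_upwards [h2.coeFn_toLp] with x hx
        rw [hx]

/-- Plancherel's theorem for the pairing given by a nondegenerate bilinear form. -/
lemma exists_lintegral_pairing_sq {V : Type*} [NormedAddCommGroup V] [NormedSpace ℝ V]
    [FiniteDimensional ℝ V] [MeasurableSpace V] [BorelSpace V] (μ : Measure V)
    [μ.IsAddHaarMeasure] (b : V →L[ℝ] V →L[ℝ] ℝ) (hb : ∀ w, (∀ v, b v w = 0) → w = 0) :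
    ∃ C : ENNReal, C ≠ 0 ∧ C ≠ ⊤ ∧ ∀ f : V → ℂ, Integrable f μ → MemLp f 2 μ →
      ∫⁻ w, ‖∫ v, Complex.exp (Complex.I * b v w) * f v ∂μ‖ₑ ^ 2 ∂μ = C * ∫⁻ v, ‖f v‖ₑ ^ 2 ∂μ := by
  let e : V ≃L[ℝ] EuclideanSpace ℝ (Fin (Module.finrank ℝ V)) := toEuclidean
  -- `N` represents `b` by the inner product, scaled so that `exp (i b v w)` becomes the character
  -- `exp (-2πi ⟨e v, N w⟩)` of the Fourier transform.
  let N : V →ₗ[ℝ] EuclideanSpace ℝ (Fin (Module.finrank ℝ V)) :=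
    { toFun := fun w => (-(2 * Real.pi)⁻¹) • (InnerProductSpace.toDual ℝ _).symm
        ((b.flip w).comp (e.symm : _ →L[ℝ] V))
      map_add' := fun u w => by
        rw [map_add, ContinuousLinearMap.add_comp, map_add, smul_add]
      map_smul' := fun r w => by
        rw [map_smul, ContinuousLinearMap.smul_comp, map_smulₛₗ, smul_comm]
        simp }
  have hN : ∀ v w, b v w = -(2 * Real.pi * inner ℝ (e v) (N w)) := fun v w => by
    simp only [N, LinearMap.coe_mk, AddHom.coe_mk, inner_smul_right]
    rw [real_inner_comm, InnerProductSpace.toDual_symm_apply]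
    simp
    field_simp
  have hinj : Function.Injective N := by
    rw [injective_iff_map_eq_zero]
    intro w hw
    refine hb w fun v => ?_
    rw [hN, hw]; simp
  let M : V ≃L[ℝ] EuclideanSpace ℝ (Fin (Module.finrank ℝ V)) :=
    (LinearEquiv.ofInjectiveOfFinrankEq N hinj (by simp)).toContinuousLinearEquiv
  have hM : ∀ w, M w = N w := fun w => rfl
  have haar : ∀ L : V ≃L[ℝ] EuclideanSpace ℝ (Fin (Module.finrank ℝ V)),
      ∃ r : NNReal, r ≠ 0 ∧ μ.map L = r • volume := fun L =>
    ⟨_, (Measure.addHaarScalarFactor_pos_of_isAddHaarMeasure (μ.map L) volume).ne',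
      Measure.isAddLeftInvariant_eq_smul (μ.map L) volume⟩
  obtain ⟨r, hr0, hr⟩ := haar e
  obtain ⟨s, hs0, hs⟩ := haar M
  -- The squared inner integral contributes `r²`, the outer change of variables contributes `s`, and
  -- the return from Euclidean space to `μ` absorbs one factor `r`.
  refine ⟨(r : ENNReal) * s, by simp [hr0, hs0], by finiteness, fun f hf1 hf2 => ?_⟩
  have hμ : μ = (r : ENNReal) • (volume : Measure (EuclideanSpace ℝ _)).map e.symm := by
    rw [← Measure.map_smul]
    have := congrArg (fun m => m.map e.symm) hr
    rw [Measure.map_map e.symm.continuous.measurable e.continuous.measurable] at this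
    simpa using this
  have hmp : MeasurableEmbedding (e.symm : _ → V) := e.symm.toHomeomorph.measurableEmbedding
  have hr0' : (r : ENNReal) ≠ 0 := by simpa using hr0
  have g1 : Integrable (f ∘ e.symm) := by
    rw [hμ, integrable_smul_measure hr0' (by simp), hmp.integrable_map_iff] at hf1
    exact hf1
  have g2 : MemLp (f ∘ e.symm) 2 := by
    have hμ' : (volume : Measure (EuclideanSpace ℝ _)).map e.symm = (r : ENNReal)⁻¹ • μ := by
      rw [hμ, smul_smul, ENNReal.inv_mul_cancel hr0' (by simp), one_smul]
    rw [← hmp.memLp_map_measure_iff, hμ']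
    exact hf2.smul_measure (by simpa using hr0)
  have e1 : ∀ w, ∫ v, Complex.exp (Complex.I * b v w) * f v ∂μ =
      (r : ℝ) • 𝓕 (f ∘ e.symm) (M w) := fun w => by
    rw [hμ, integral_smul_measure, hmp.integral_map, Real.fourier_eq']
    simp only [ENNReal.coe_toReal, hM]
    congr 1
    refine integral_congr_ae (.of_forall fun v => ?_)
    simp only [hN, smul_eq_mul, Function.comp_apply, ContinuousLinearEquiv.apply_symm_apply]
    congr 2
    push_cast
    ring
  have hGm : Measurable fun x => ‖𝓕 (f ∘ e.symm) x‖ₑ ^ 2 := by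
    have : Continuous (𝓕 (f ∘ e.symm)) := VectorFourier.fourierIntegral_continuous
      Real.continuous_fourierChar continuous_inner g1
    fun_prop
  calc ∫⁻ w, ‖∫ v, Complex.exp (Complex.I * b v w) * f v ∂μ‖ₑ ^ 2 ∂μ
      = (r : ENNReal) ^ 2 * ∫⁻ w, ‖𝓕 (f ∘ e.symm) (M w)‖ₑ ^ 2 ∂μ := by
        rw [← lintegral_const_mul' _ _ (by simp)]
        refine lintegral_congr fun w => ?_
        rw [e1, enorm_smul, mul_pow]
        congr 2
        rw [enorm_eq_nnnorm, ENNReal.coe_inj]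
        ext; simp
    _ = (r : ENNReal) ^ 2 * ∫⁻ x, ‖𝓕 (f ∘ e.symm) x‖ₑ ^ 2 ∂(μ.map M) := by
        rw [lintegral_map hGm M.continuous.measurable]
    _ = (r : ENNReal) ^ 2 * (s * ∫⁻ x, ‖(f ∘ e.symm) x‖ₑ ^ 2) := by
        rw [hs, ← lintegral_enorm_fourier_sq g1 g2]
        rw [ENNReal.smul_def, lintegral_smul_measure, smul_eq_mul]
    _ = (r : ENNReal) * s * ∫⁻ v, ‖f v‖ₑ ^ 2 ∂μ := by
        conv_rhs => rw [hμ, lintegral_smul_measure, hmp.lintegral_map]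
        simp only [Function.comp_apply, smul_eq_mul]
        ring

end Fourier

/-! ### Elementary facts on the group -/

section GroupFacts

variable {V : Type*} [NormedAddCommGroup V] [NormedSpace ℝ V]

lemma continuous_mul (S : AdaptedSymplectic V) :
    Continuous fun p : (V × ℝ) × (V × ℝ) => mul S p.1 p.2 := by
  unfold mul; fun_prop

lemma Continuous.mulG {X : Type*} [TopologicalSpace X] (S : AdaptedSymplectic V)
    {f g : X → V × ℝ} (hf : Continuous f) (hg : Continuous g) :
    Continuous fun x => mul S (f x) (g x) :=
  (continuous_mul S).comp (hf.prodMk hg)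

lemma inv_eq_neg (g : V × ℝ) : inv g = -g := rfl

lemma continuous_inv : Continuous (inv : V × ℝ → V × ℝ) := by unfold inv; fun_prop

lemma inv_inv' (g : V × ℝ) : inv (inv g) = g := by simp [inv]

lemma norm_inv (g : V × ℝ) : ‖inv g‖ = ‖g‖ := by rw [inv_eq_neg, norm_neg]

lemma zero_mul' (S : AdaptedSymplectic V) (g : V × ℝ) : mul S 0 g = g := by
  ext <;> simp [mul]

lemma mul_zero' (S : AdaptedSymplectic V) (g : V × ℝ) : mul S g 0 = g := by
  ext <;> simp [mul]

lemma inv_mul_cancel_left' (S : AdaptedSymplectic V) (g h : V × ℝ) :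
    mul S (inv g) (mul S g h) = h := by
  rw [← mul_assoc', inv_mul_cancel', zero_mul']

lemma mul_inv_cancel_left' (S : AdaptedSymplectic V) (g h : V × ℝ) :
    mul S g (mul S (inv g) h) = h := by
  rw [← mul_assoc', mul_inv_cancel', zero_mul']

lemma inv_mul (S : AdaptedSymplectic V) (g h : V × ℝ) :
    inv (mul S g h) = mul S (inv h) (inv g) := by
  ext
  · simp [mul, inv, add_comm]
  · simp [mul, inv, S.ω_swap h.1 g.1]; ring

lemma dilation_mul (S : AdaptedSymplectic V) (s : ℝ) (hs : 0 < s) (g h : V × ℝ) :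
    dilation s hs (mul S g h) = mul S (dilation s hs g) (dilation s hs h) := by
  ext
  · simp [mul, dilation]
  · simp [mul, dilation]; ring

lemma dilation_apply (s : ℝ) (hs : 0 < s) (g : V × ℝ) :
    dilation s hs g = (s • g.1, s ^ 2 * g.2) := rfl

lemma dilation_dilation (r s : ℝ) (hr : 0 < r) (hs : 0 < s) (g : V × ℝ) :
    dilation r hr (dilation s hs g) = dilation (r * s) (mul_pos hr hs) g := by
  ext
  · simp [dilation_apply, mul_smul]
  · simp [dilation_apply]; ring

lemma dilation_inv (s : ℝ) (hs : 0 < s) (g : V × ℝ) :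
    dilation s hs (inv g) = inv (dilation s hs g) := by
  rw [inv_eq_neg, map_neg, inv_eq_neg]

lemma norm_dilation_le (s : ℝ) (hs : 0 < s) (hs1 : s ≤ 1) (g : V × ℝ) :
    ‖dilation s hs g‖ ≤ s * ‖g‖ := by
  rw [dilation_apply, Prod.norm_def]
  refine max_le ?_ ?_
  · simp only [norm_smul, Real.norm_of_nonneg hs.le]
    exact mul_le_mul_of_nonneg_left (norm_fst_le g) hs.le
  · simp only [norm_mul, norm_pow, Real.norm_of_nonneg hs.le]
    have := norm_snd_le g
    have : s ^ 2 ≤ s := by nlinarith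
    gcongr

lemma norm_mul_sub_le (S : AdaptedSymplectic V) (g h : V × ℝ) :
    ‖mul S g h - h‖ ≤ ‖g‖ * (1 + ‖S.ω‖ * ‖h‖) := by
  have h0 : 0 ≤ ‖g‖ * (‖S.ω‖ * ‖h‖) := by positivity
  have h1 := norm_fst_le g
  have h2 := norm_snd_le g
  have h3 : ‖S.ω g.1 h.1‖ ≤ ‖g‖ * (‖S.ω‖ * ‖h‖) := by
    refine (S.ω.le_opNorm₂ g.1 h.1).trans ?_
    calc ‖S.ω‖ * ‖g.1‖ * ‖h.1‖ ≤ ‖S.ω‖ * ‖g‖ * ‖h‖ := by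
          gcongr
          exact norm_fst_le h
      _ = _ := by ring
  rw [Prod.norm_def]
  refine max_le ?_ ?_
  · simp only [mul, Prod.fst_sub, add_sub_cancel_right]
    linarith
  · have e : (mul S g h - h).2 = g.2 + S.ω g.1 h.1 / 2 := by simp [mul]; ring
    rw [e]
    refine (norm_add_le _ _).trans ?_
    rw [norm_div, Real.norm_ofNat]
    linarith

/-- Left translation as a homeomorphism. -/
noncomputable def leftMul (S : AdaptedSymplectic V) (g : V × ℝ) : (V × ℝ) ≃ₜ (V × ℝ) where
  toFun h := mul S g h
  invFun h := mul S (inv g) h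
  left_inv h := inv_mul_cancel_left' S g h
  right_inv h := mul_inv_cancel_left' S g h
  continuous_toFun := Continuous.mulG S continuous_const continuous_id
  continuous_invFun := Continuous.mulG S continuous_const continuous_id

/-- Inversion as a homeomorphism. -/
def invHomeo : (V × ℝ) ≃ₜ (V × ℝ) where
  toFun := inv
  invFun := inv
  left_inv := inv_inv'
  right_inv := inv_inv'
  continuous_toFun := continuous_inv
  continuous_invFun := continuous_inv

/-- The automorphism `(v, t) ↦ (-v, t)`. -/
def sigma : (V × ℝ) ≃ₜ (V × ℝ) where
  toFun g := (-g.1, g.2)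
  invFun g := (-g.1, g.2)
  left_inv g := by simp
  right_inv g := by simp
  continuous_toFun := by fun_prop
  continuous_invFun := by fun_prop

lemma sigma_apply (g : V × ℝ) : sigma g = (-g.1, g.2) := rfl

lemma sigma_sigma (g : V × ℝ) : sigma (sigma g) = g := by simp [sigma_apply]

lemma sigma_mul (S : AdaptedSymplectic V) (g h : V × ℝ) :
    sigma (mul S g h) = mul S (sigma g) (sigma h) := by
  ext
  · simp [mul, sigma_apply, add_comm]
  · simp [mul, sigma_apply]

lemma sigma_inv (g : V × ℝ) : sigma (inv g) = inv (sigma g) := rfl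

lemma sigma_dilation (s : ℝ) (hs : 0 < s) (g : V × ℝ) :
    sigma (dilation s hs g) = dilation s hs (sigma g) := by
  ext <;> simp [sigma_apply, dilation_apply]

lemma opMap_apply (g : V × ℝ) : opMap g = (g.1, -g.2) := rfl

lemma opMap_dilation (s : ℝ) (hs : 0 < s) (g : V × ℝ) :
    opMap (dilation s hs g) = dilation s hs (opMap g) := by
  ext <;> simp [opMap_apply, dilation_apply]

/-- Two anti-automorphisms compose to an automorphism. This identity is what relates the kernel
`k^op` to `k♯` by an adjoint. -/
lemma opMap_inv (g : V × ℝ) : opMap (inv g) = sigma g := by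
  ext <;> simp [opMap_apply, sigma_apply, inv]

/-- The complex conjugate of a test function. -/
noncomputable def Test.conj (φ : Test V) : Test V where
  toFun g := star (φ g)
  contDiff' := (starL' ℝ : ℂ ≃L[ℝ] ℂ).contDiff.comp φ.contDiff
  hasCompactSupport' := φ.hasCompactSupport.comp_left (g := star) (star_zero ℂ)
  tsupport_subset' := by simp

/-- `φ* (g) = conj (φ (g⁻¹))`. -/
noncomputable def Test.invol (φ : Test V) : Test V :=
  (φ.comp invHomeo (by change ContDiff ℝ _ fun g : V × ℝ => -g; fun_prop)).conj

/-- `φ♯ (v, t) = conj (φ (-v, t))`. -/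
noncomputable def Test.sharp (φ : Test V) : Test V :=
  (φ.comp sigma (by change ContDiff ℝ _ fun g : V × ℝ => (-g.1, g.2); fun_prop)).conj

lemma Test.invol_apply (φ : Test V) (g : V × ℝ) : φ.invol g = star (φ (inv g)) := rfl

lemma Test.sharp_apply (φ : Test V) (g : V × ℝ) : φ.sharp g = star (φ (sigma g)) := rfl

lemma Test.op_apply (φ : Test V) (g : V × ℝ) : φ.op g = φ (opMap g) := rfl

lemma Test.dilate_apply (φ : Test V) (s : ℝ) (hs : 0 < s) (g : V × ℝ) :
    φ.dilate s hs g = φ (dilation s hs g) := rfl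

/-- The left translate `h ↦ φ (g⁻¹ h)`. -/
noncomputable def Test.translate (S : AdaptedSymplectic V) (g : V × ℝ) (φ : Test V) : Test V :=
  φ.comp (leftMul S (inv g)) (by
    change ContDiff ℝ _ fun h : V × ℝ => mul S (inv g) h
    unfold mul; fun_prop)

lemma Test.translate_apply (S : AdaptedSymplectic V) (g h : V × ℝ) (φ : Test V) :
    φ.translate S g h = φ (mul S (inv g) h) := rfl

end GroupFacts

/-! ### Haar measure: invariance, scaling and moduli of continuity. -/

section MeasureFacts

variable {V : Type*} [NormedAddCommGroup V] [NormedSpace ℝ V] [FiniteDimensional ℝ V]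
  [MeasureSpace V] [BorelSpace V] [(volume : Measure V).IsAddHaarMeasure]

lemma Test.integrable' (φ : Test V) : Integrable φ (volume : Measure (V × ℝ)) :=
  φ.continuous.integrable_of_hasCompactSupport φ.hasCompactSupport

lemma measurePreserving_mul_left (S : AdaptedSymplectic V) (g : V × ℝ) :
    MeasurePreserving (mul S g) (volume : Measure (V × ℝ)) volume := by
  have h : MeasurePreserving (fun p : V × ℝ => (g.1 + p.1, (g.2 + S.ω g.1 p.1 / 2) + p.2))
      (volume.prod volume) (volume.prod volume) :=
    (measurePreserving_add_left volume g.1).skew_product (by fun_prop)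
      (.of_forall fun v => (measurePreserving_add_left volume (g.2 + S.ω g.1 v / 2)).map_eq)
  refine (congrArg (fun F => MeasurePreserving F volume volume) (funext fun p => ?_)).mpr h
  ext
  · rfl
  · simp only [mul]; ring

lemma measurePreserving_inv :
    MeasurePreserving (inv : V × ℝ → V × ℝ) (volume : Measure (V × ℝ)) volume :=
  (Measure.measurePreserving_neg (volume : Measure V)).prod
    (Measure.measurePreserving_neg (volume : Measure ℝ))

lemma measurePreserving_sigma :
    MeasurePreserving (sigma : V × ℝ → V × ℝ) (volume : Measure (V × ℝ)) volume :=
  (Measure.measurePreserving_neg (volume : Measure V)).prod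
    (MeasurePreserving.id (volume : Measure ℝ))

lemma measurePreserving_opMap :
    MeasurePreserving (opMap : V × ℝ → V × ℝ) (volume : Measure (V × ℝ)) volume :=
  (MeasurePreserving.id (volume : Measure V)).prod
    (Measure.measurePreserving_neg (volume : Measure ℝ))

section Integrals

variable {E : Type*} [NormedAddCommGroup E] [NormedSpace ℝ E]

lemma integral_mul_left (S : AdaptedSymplectic V) (g : V × ℝ) (f : V × ℝ → E) :
    ∫ h, f (mul S g h) = ∫ h, f h :=
  (measurePreserving_mul_left S g).integral_comp (leftMul S g).measurableEmbedding f

lemma integral_inv (f : V × ℝ → E) : ∫ h, f (inv h) = ∫ h, f h :=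
  measurePreserving_inv.integral_comp invHomeo.measurableEmbedding f

lemma integral_sigma (f : V × ℝ → E) : ∫ h, f (sigma h) = ∫ h, f h :=
  measurePreserving_sigma.integral_comp sigma.measurableEmbedding f

lemma integral_opMap (f : V × ℝ → E) : ∫ h, f (opMap h) = ∫ h, f h :=
  measurePreserving_opMap.integral_comp opMap.toHomeomorph.measurableEmbedding f

lemma integral_dilation (s : ℝ) (hs : 0 < s) (f : V × ℝ → E) :
    ∫ h, f (dilation s hs h) = (s ^ homDim V)⁻¹ • ∫ h, f h := by
  have h1 : (volume : Measure (V × ℝ)).map (dilation s hs) =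
      ENNReal.ofReal ((s ^ homDim V)⁻¹) • volume := by
    have e : (dilation s hs : V × ℝ → V × ℝ) = Prod.map (fun v => s • v) (fun t => s ^ 2 • t) := by
      ext g <;> simp [dilation_apply]
    have h2 : Measure.map (fun v : V => s • v) volume =
        ENNReal.ofReal |(s ^ Module.finrank ℝ V)⁻¹| • volume :=
      Measure.map_addHaar_smul volume hs.ne'
    have h3 : Measure.map (fun t : ℝ => s ^ 2 • t) volume =
        ENNReal.ofReal |((s ^ 2) ^ Module.finrank ℝ ℝ)⁻¹| • volume :=
      Measure.map_addHaar_smul volume (pow_pos hs 2).ne'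
    rw [e, Measure.volume_eq_prod, ← Measure.map_prod_map _ _ (by fun_prop) (by fun_prop), h2, h3,
      Measure.prod_smul_left, Measure.prod_smul_right, smul_smul,
      ← ENNReal.ofReal_mul (abs_nonneg _)]
    congr 2
    rw [abs_of_nonneg (by positivity), abs_of_nonneg (by positivity), homDim, pow_add]
    simp [mul_comm]
  have := (dilation (V := V) s hs).toHomeomorph.measurableEmbedding.integral_map
    (μ := volume) f
  change ∫ y, f y ∂(volume.map (dilation s hs)) = ∫ x, f (dilation s hs x) at this
  rw [← this, h1, integral_smul_measure, ENNReal.toReal_ofReal (by positivity)]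

end Integrals

lemma _root_.MeasureTheory.Integrable.comp_mulG (S : AdaptedSymplectic V) (g : V × ℝ)
    {E : Type*} [NormedAddCommGroup E] {f : V × ℝ → E} (hf : Integrable f) :
    Integrable fun h => f (mul S g h) :=
  (measurePreserving_mul_left S g).integrable_comp_of_integrable hf

/-- Left translation is Lipschitz in the `L¹`-norm on test functions. -/
lemma Test.exists_modulus (S : AdaptedSymplectic V) (φ : Test V) :
    ∃ C, 0 ≤ C ∧ ∀ g, ∫ x, ‖φ (mul S (inv g) x) - φ x‖ ≤ C * ‖g‖ := by
  obtain ⟨L, hL⟩ := ContDiff.lipschitzWith_of_hasCompactSupport φ.hasCompactSupport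
    φ.contDiff (by simp)
  obtain ⟨R, hR⟩ := φ.hasCompactSupport.isCompact.isBounded.subset_closedBall (0 : V × ℝ)
  have hφR : ∀ x, φ x ≠ 0 → ‖x‖ ≤ R := fun x hx => by
    simpa using hR (subset_tsupport _ hx)
  -- If `‖g‖ ≤ 1` and `g⁻¹ x` has norm at most `|R|`, then `x` differs from it by at most `1 + ‖ω‖
  -- |R|`. So the ball of radius `R'` contains the supports of `φ` and of all translates by such
  -- `g`, and there the Lipschitz bound can be integrated.
  set R' := |R| + (1 + ‖S.ω‖ * |R|) with hR'
  set B := Metric.closedBall (0 : V × ℝ) R'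
  set D := L * (1 + ‖S.ω‖ * R') * volume.real B
  have hR0 : 0 ≤ R' := by positivity
  have hD : 0 ≤ D := by positivity
  refine ⟨D + 2 * ∫ x, ‖φ x‖, by positivity, fun g => ?_⟩
  have hi : Integrable fun x => φ (mul S (inv g) x) - φ x :=
    (φ.integrable'.comp_mulG S (inv g)).sub φ.integrable'
  have hI : 0 ≤ 2 * ∫ x, ‖φ x‖ := by positivity
  rw [add_mul]
  rcases le_total ‖g‖ 1 with hg | hg
  · have hb : ∀ x, ‖φ (mul S (inv g) x) - φ x‖ ≤
        B.indicator (fun _ => L * (1 + ‖S.ω‖ * R') * ‖g‖) x := fun x => by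
      by_cases hx : x ∈ B
      · rw [Set.indicator_of_mem hx]
        refine (hL.norm_sub_le _ _).trans ?_
        have h1 := norm_mul_sub_le S (inv g) x
        rw [norm_inv] at h1
        have h2 : ‖x‖ ≤ R' := by simpa [B] using hx
        calc (L : ℝ) * ‖mul S (inv g) x - x‖ ≤ L * (‖g‖ * (1 + ‖S.ω‖ * R')) := by
              gcongr
              refine h1.trans ?_
              gcongr
          _ = _ := by ring
      · have h2 : R' < ‖x‖ := by simpa [B] using hx
        have h3 : φ x = 0 := by
          by_contra h
          have := hφR x h
          have h4 := le_abs_self R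
          have : 0 ≤ 1 + ‖S.ω‖ * |R| := by positivity
          linarith
        have h4 : φ (mul S (inv g) x) = 0 := by
          by_contra h
          have h5 := hφR _ h
          have h6 := norm_mul_sub_le S g (mul S (inv g) x)
          rw [mul_inv_cancel_left'] at h6
          have h7 : ‖g‖ * (1 + ‖S.ω‖ * ‖mul S (inv g) x‖) ≤ 1 * (1 + ‖S.ω‖ * |R|) := by
            gcongr
            exact h5.trans (le_abs_self R)
          have h8 := norm_le_norm_add_norm_sub' x (mul S (inv g) x)
          have := le_abs_self R
          linarith
        rw [h3, h4, Set.indicator_of_notMem hx]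
        simp
    calc ∫ x, ‖φ (mul S (inv g) x) - φ x‖
        ≤ ∫ x, B.indicator (fun _ => L * (1 + ‖S.ω‖ * R') * ‖g‖) x :=
          integral_mono hi.norm ((integrable_indicator_iff Metric.isClosed_closedBall.measurableSet).2
            (integrableOn_const (isCompact_closedBall _ _).measure_ne_top)) hb
      _ = D * ‖g‖ := by
          rw [integral_indicator_const _ Metric.isClosed_closedBall.measurableSet, smul_eq_mul]
          ring
      _ ≤ _ := le_add_of_nonneg_right (by positivity)
  -- For `‖g‖ ≥ 1` the trivial bound `2 ‖φ‖₁` is already linear in `‖g‖`.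
  · calc ∫ x, ‖φ (mul S (inv g) x) - φ x‖ ≤ ∫ x, (‖φ (mul S (inv g) x)‖ + ‖φ x‖) :=
          integral_mono hi.norm ((φ.integrable'.comp_mulG S (inv g)).norm.add
            φ.integrable'.norm) fun x => norm_sub_le _ _
      _ = 2 * ∫ x, ‖φ x‖ := by
          rw [integral_add (φ.integrable'.comp_mulG S (inv g)).norm φ.integrable'.norm,
            integral_mul_left S (inv g) (fun x => ‖φ x‖)]
          ring
      _ ≤ (2 * ∫ x, ‖φ x‖) * ‖g‖ := le_mul_of_one_le_right hI hg
      _ ≤ _ := le_add_of_nonneg_left (by positivity)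

end MeasureFacts

/-! ### Unitary representations -/

section Unitary

variable {V : Type*} [NormedAddCommGroup V] [NormedSpace ℝ V] [FiniteDimensional ℝ V]
  [MeasureSpace V] [BorelSpace V] [(volume : Measure V).IsAddHaarMeasure]

/-- A strongly continuous unitary representation of the Heisenberg group. -/
structure UnitaryRep (S : AdaptedSymplectic V) (H : Type*) [NormedAddCommGroup H]
    [InnerProductSpace ℂ H] where
  op : V × ℝ → H →ₗᵢ[ℂ] H
  op_zero : op 0 = LinearIsometry.id
  op_mul : ∀ g h, op (mul S g h) = (op g).comp (op h)
  cont : ∀ F, Continuous fun g => op g F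

namespace UnitaryRep

variable {S : AdaptedSymplectic V} {H : Type*} [NormedAddCommGroup H] [InnerProductSpace ℂ H]
  (ρ : UnitaryRep S H)

lemma op_mul_apply (g h : V × ℝ) (F : H) : ρ.op (mul S g h) F = ρ.op g (ρ.op h F) := by
  rw [ρ.op_mul]; rfl

lemma op_inv_op (g : V × ℝ) (F : H) : ρ.op (inv g) (ρ.op g F) = F := by
  rw [← op_mul_apply, inv_mul_cancel', op_zero]; rfl

lemma inner_op_left (g : V × ℝ) (F G : H) :
    inner ℂ (ρ.op g F) G = inner ℂ F (ρ.op (inv g) G) := by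
  rw [← (ρ.op (inv g)).inner_map_map, op_inv_op]

/-- The representation `g ↦ ρ (δ_s g)`. -/
noncomputable def scale (s : ℝ) (hs : 0 < s) : UnitaryRep S H where
  op g := ρ.op (dilation s hs g)
  op_zero := by rw [map_zero, op_zero]
  op_mul g h := by rw [dilation_mul, op_mul]
  cont F := (ρ.cont F).comp (dilation s hs).continuous

lemma scale_op (s : ℝ) (hs : 0 < s) (g : V × ℝ) : (ρ.scale s hs).op g = ρ.op (dilation s hs g) :=
  rfl

lemma scale_scale (r s : ℝ) (hr : 0 < r) (hs : 0 < s) :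
    (ρ.scale r hr).scale s hs = ρ.scale (r * s) (mul_pos hr hs) := by
  have : ((ρ.scale r hr).scale s hs).op = (ρ.scale (r * s) (mul_pos hr hs)).op := by
    funext g
    simp only [scale_op, dilation_dilation]
  cases h1 : (ρ.scale r hr).scale s hs
  cases h2 : ρ.scale (r * s) (mul_pos hr hs)
  simp only [h1, h2] at this
  subst this
  rfl

lemma integrable_smul {f : V × ℝ → ℂ} (hf : Integrable f) (F : H) :
    Integrable fun g => f g • ρ.op g F := by
  refine (hf.norm.mul_const ‖F‖).mono'
    (hf.aestronglyMeasurable.smul (ρ.cont F).aestronglyMeasurable) (.of_forall fun g => ?_)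
  rw [norm_smul, LinearIsometry.norm_map]

variable [CompleteSpace H]

open scoped Classical in
/-- The operator `ρ(f) = ∫ f(g) ρ(g) dg` for integrable `f`. -/
noncomputable def integ (f : V × ℝ → ℂ) : H →L[ℂ] H :=
  if hf : Integrable f then
    LinearMap.mkContinuous
      { toFun := fun F => ∫ g, f g • ρ.op g F
        map_add' := fun F G => by
          rw [← integral_add (ρ.integrable_smul hf F) (ρ.integrable_smul hf G)]
          simp only [map_add, smul_add]
        map_smul' := fun c F => by
          rw [RingHom.id_apply, ← integral_smul]
          simp only [map_smul, smul_comm c] }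
      (∫ g, ‖f g‖) fun F => by
        refine (norm_integral_le_integral_norm _).trans_eq ?_
        simp only [norm_smul, LinearIsometry.norm_map, integral_mul_const]
  else 0

lemma integ_apply {f : V × ℝ → ℂ} (hf : Integrable f) (F : H) :
    ρ.integ f F = ∫ g, f g • ρ.op g F := by
  rw [integ, dif_pos hf]; rfl

lemma norm_integ_le {f : V × ℝ → ℂ} (hf : Integrable f) : ‖ρ.integ f‖ ≤ ∫ g, ‖f g‖ := by
  rw [integ, dif_pos hf]
  exact LinearMap.mkContinuous_norm_le _ (integral_nonneg fun _ => norm_nonneg _) _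

lemma integ_sub {f h : V × ℝ → ℂ} (hf : Integrable f) (hh : Integrable h) :
    ρ.integ (fun g => f g - h g) = ρ.integ f - ρ.integ h := by
  have hfh : Integrable fun g => f g - h g := hf.sub hh
  ext F
  rw [_root_.sub_apply, integ_apply _ hf, integ_apply _ hh, integ_apply _ hfh,
    ← integral_sub (ρ.integrable_smul hf F) (ρ.integrable_smul hh F)]
  simp only [sub_smul]

lemma op_integ {f : V × ℝ → ℂ} (hf : Integrable f) (h : V × ℝ) (F : H) :
    ρ.op h (ρ.integ f F) = ρ.integ (fun g => f (mul S (inv h) g)) F := by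
  rw [integ_apply _ hf, integ_apply _ (hf.comp_mulG S (inv h)),
    ← integral_mul_left S h (fun g => f (mul S (inv h) g) • ρ.op g F)]
  simp only [inv_mul_cancel_left', op_mul_apply]
  rw [← LinearIsometry.coe_toContinuousLinearMap,
    ← ContinuousLinearMap.integral_comp_comm _ (ρ.integrable_smul hf F)]
  simp

lemma star_integ (φ : Test V) : star (ρ.integ φ) = ρ.integ φ.invol := by
  rw [ContinuousLinearMap.star_eq_adjoint]
  symm
  rw [ContinuousLinearMap.eq_adjoint_iff]
  intro F G
  rw [integ_apply _ φ.integrable', integ_apply _ φ.invol.integrable',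
    ← integral_inner (ρ.integrable_smul φ.integrable' G), ← inner_conj_symm,
    ← integral_inner (ρ.integrable_smul φ.invol.integrable' F), ← integral_conj, ← integral_inv]
  refine integral_congr_ae (.of_forall fun g => ?_)
  simp only [inner_smul_right, Test.invol_apply, inv_inv', map_mul, inner_conj_symm, inner_op_left]
  simp

/-- Almost orthogonality: a mean zero function at a small scale against another function. -/
lemma norm_scale_integ_mul_integ_le (f h : Test V) (hf : ∫ g, f g = 0) {C : ℝ}
    (hC : ∀ g, ∫ x, ‖h (mul S (inv g) x) - h x‖ ≤ C * ‖g‖) (hC0 : 0 ≤ C)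
    (ε : ℝ) (hε : 0 < ε) (hε1 : ε ≤ 1) :
    ‖(ρ.scale ε hε).integ f * ρ.integ h‖ ≤ ε * (C * ∫ g, ‖f g‖ * ‖g‖) := by
  have hI : 0 ≤ ∫ g, ‖f g‖ * ‖g‖ := by positivity
  refine ContinuousLinearMap.opNorm_le_bound _ (by positivity) fun F => ?_
  have hi : Integrable fun g => ‖f g‖ * ‖g‖ :=
    (f.continuous.norm.mul continuous_norm).integrable_of_hasCompactSupport
      f.hasCompactSupport.norm.mul_right
  -- The mean of `f` vanishes, so the constant vector `ρ(h) F` may be subtracted under the integral.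
  -- What remains is a translation increment of `h` by `δ_ε g`, which is `O(ε ‖g‖)`.
  have e : (ρ.scale ε hε).integ f (ρ.integ h F) =
      ∫ g, f g • (ρ.op (dilation ε hε g) (ρ.integ h F) - ρ.integ h F) := by
    simp only [smul_sub, ← ρ.scale_op]
    rw [integral_sub ((ρ.scale ε hε).integrable_smul f.integrable' _)
      (f.integrable'.smul_const _), integral_smul_const, hf, zero_smul, sub_zero,
      integ_apply _ f.integrable']
  rw [mul_apply_eq_comp, e]
  have hb : ∀ g, ‖f g • (ρ.op (dilation ε hε g) (ρ.integ h F) - ρ.integ h F)‖ ≤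
      ε * (C * (‖f g‖ * ‖g‖)) * ‖F‖ := fun g => by
    rw [norm_smul, op_integ _ h.integrable', ← _root_.sub_apply,
      ← integ_sub _ (h.integrable'.comp_mulG S _) h.integrable']
    calc _ ≤ ‖f g‖ * ((C * ‖dilation ε hε g‖) * ‖F‖) := by
          gcongr
          refine (ContinuousLinearMap.le_opNorm _ _).trans ?_
          gcongr
          exact (norm_integ_le _ ((h.integrable'.comp_mulG S _).sub h.integrable')).trans (hC _)
      _ ≤ ‖f g‖ * ((C * (ε * ‖g‖)) * ‖F‖) := by
          gcongr
          exact norm_dilation_le ε hε hε1 g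
      _ = _ := by ring
  refine (norm_integral_le_of_norm_le ((hi.const_mul C).const_mul ε |>.mul_const ‖F‖)
    (.of_forall hb)).trans_eq ?_
  rw [integral_mul_const, integral_const_mul, integral_const_mul]

end UnitaryRep

/-! ### Multipliers -/

variable (V) in
/-- The data of a kernel of type zero: `a δ₀` plus the sum of the dyadic dilates of the mean zero
function `f`. -/
structure Kernel where
  a : ℂ
  f : Test V
  mean : ∫ g, f g = 0

lemma Test.integral_invol (φ : Test V) : ∫ g, φ.invol g = star (∫ g, φ g) := by
  rw [← integral_inv φ]
  exact integral_conj

/-- The adjoint kernel. -/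
noncomputable def Kernel.invol (κ : Kernel V) : Kernel V where
  a := star κ.a
  f := κ.f.invol
  mean := by rw [Test.integral_invol, κ.mean, star_zero]

/-- The dyadic scale `2^(-j)`. -/
noncomputable def dyadic (j : ℤ) : ℝ := (2 : ℝ) ^ (-j)

lemma dyadic_pos (j : ℤ) : 0 < dyadic j := by unfold dyadic; positivity

lemma dyadic_add (i j : ℤ) : dyadic (i + j) = dyadic i * dyadic j := by
  unfold dyadic
  rw [neg_add, zpow_add₀ two_ne_zero]

lemma dyadic_natCast (n : ℕ) : dyadic n = (1 / 2) ^ n := by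
  unfold dyadic
  rw [zpow_neg, zpow_natCast, one_div, inv_pow]

lemma dyadic_neg_natCast (n : ℕ) : dyadic (-n) = 2 ^ n := by
  unfold dyadic
  rw [neg_neg, zpow_natCast]

lemma summable_pow_natAbs {r : ℝ} (h0 : 0 ≤ r) (h1 : r < 1) :
    Summable fun j : ℤ => r ^ j.natAbs := by
  refine Summable.of_nat_of_neg ?_ ?_
  · simpa using summable_geometric_of_lt_one h0 h1
  · simpa using summable_geometric_of_lt_one h0 h1

/-! ### Almost orthogonality of the dyadic pieces and the operator `ρ(k)`. -/

namespace UnitaryRep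

variable {S : AdaptedSymplectic V} {H : Type*} [NormedAddCommGroup H] [InnerProductSpace ℂ H]
  [CompleteSpace H] (ρ : UnitaryRep S H) (κ : Kernel V)

/-- The operator of the dyadic piece of a kernel. -/
noncomputable def piece (j : ℤ) : H →L[ℂ] H := (ρ.scale (dyadic j) (dyadic_pos j)).integ κ.f

lemma star_piece (j : ℤ) : star (ρ.piece κ j) = ρ.piece κ.invol j := star_integ _ _

/-- If the left factor has the finer scale, rescaling `ρ` by the coarser scale reduces to
`norm_scale_integ_mul_integ_le` with `ε = 2^(-n)`. The constant is uniform in the scales because the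
modulus of continuity used there depends only on the function and not on the representation. -/
lemma exists_norm_piece_mul_piece_le (κ κ' : Kernel V) :
    ∃ C, 0 ≤ C ∧ ∀ i j, ‖ρ.piece κ i * ρ.piece κ' j‖ ≤ C * (1 / 2) ^ (i - j).natAbs := by
  have main : ∀ κ κ' : Kernel V, ∃ C, 0 ≤ C ∧ ∀ j, ∀ n : ℕ,
      ‖ρ.piece κ (j + n) * ρ.piece κ' j‖ ≤ C * (1 / 2) ^ n := fun κ κ' => by
    obtain ⟨C, hC0, hC⟩ := κ'.f.exists_modulus S
    have hI : 0 ≤ ∫ g, ‖κ.f g‖ * ‖g‖ := by positivity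
    refine ⟨C * ∫ g, ‖κ.f g‖ * ‖g‖, by positivity, fun j n => ?_⟩
    have h1 := (ρ.scale (dyadic j) (dyadic_pos j)).norm_scale_integ_mul_integ_le κ.f κ'.f κ.mean
      hC hC0 (dyadic n) (dyadic_pos n) (by
        rw [dyadic_natCast]; exact pow_le_one₀ (by norm_num) (by norm_num))
    rw [mul_comm, ← dyadic_natCast]
    convert h1 using 3
    rw [piece, scale_scale]
    · congr 2
      exact dyadic_add j n
    · rfl
  obtain ⟨C, hC0, hC⟩ := main κ κ'
  obtain ⟨D, hD0, hD⟩ := main κ'.invol κ.invol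
  refine ⟨max C D, le_max_of_le_left hC0, fun i j => ?_⟩
  rcases le_total j i with h | h
  · obtain ⟨n, hn⟩ := Int.eq_ofNat_of_zero_le (sub_nonneg.2 h)
    obtain rfl : i = j + n := by omega
    refine (hC j n).trans ?_
    simp only [add_sub_cancel_left, Int.natAbs_natCast]
    gcongr
    exact le_max_left _ _
  · obtain ⟨n, hn⟩ := Int.eq_ofNat_of_zero_le (sub_nonneg.2 h)
    obtain rfl : j = i + n := by omega
    -- When the right factor is the finer one, the adjoint reverses the order and replaces each
    -- kernel by its adjoint kernel, which again has mean zero.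
    rw [← norm_star, star_mul, star_piece, star_piece]
    refine (hD i n).trans ?_
    simp only [sub_add_cancel_left, Int.natAbs_neg, Int.natAbs_natCast]
    gcongr
    exact le_max_right _ _

/-- Cotlar–Stein with the summable matrix `a i j = √E · 2^(-|i-j|/2)`: the square root of the almost
orthogonality bound still has row sums bounded independently of the finite set. -/
lemma exists_norm_sum_piece_le : ∃ M, 0 < M ∧ ∀ s : Finset ℤ, ‖∑ j ∈ s, ρ.piece κ j‖ ≤ M := by
  obtain ⟨C, hC0, hC⟩ := ρ.exists_norm_piece_mul_piece_le κ.invol κ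
  obtain ⟨D, hD0, hD⟩ := ρ.exists_norm_piece_mul_piece_le κ κ.invol
  set r : ℝ := √(1 / 2)
  have hr2 : r ^ 2 = 1 / 2 := Real.sq_sqrt (by norm_num)
  have hr0 : 0 ≤ r := Real.sqrt_nonneg _
  have hr1 : r < 1 := by nlinarith
  have hs := summable_pow_natAbs hr0 hr1
  set E := max C D
  have hE : 0 ≤ E := le_max_of_le_left hC0
  set M := √E * ∑' j : ℤ, r ^ j.natAbs with hM
  have ht : 0 ≤ ∑' j : ℤ, r ^ j.natAbs := tsum_nonneg fun j => by positivity
  have hsq : ∀ n : ℕ, (√E * r ^ n) ^ 2 = E * (1 / 2) ^ n := fun n => by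
    rw [mul_pow, Real.sq_sqrt hE, ← pow_mul, mul_comm n, pow_mul, hr2]
  -- The summand `1` keeps the bound positive even if `E = 0`.
  refine ⟨M + 1, by positivity, fun s => ?_⟩
  rw [← Finset.sum_coe_sort]
  refine norm_sum_le_of_almost_orthogonal (fun j : s => ρ.piece κ j)
    (fun i j => √E * r ^ ((i : ℤ) - j).natAbs) (fun i j => by positivity) (M + 1) (by positivity)
    (fun i j => ?_) (fun i j => ?_) fun i => ?_
  · rw [hsq, star_piece]
    refine (hC _ _).trans ?_
    gcongr
    exact le_max_left _ _
  · rw [hsq, star_piece]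
    refine (hD _ _).trans ?_
    gcongr
    exact le_max_right _ _
  · rw [← Finset.mul_sum, Finset.sum_coe_sort s (fun j => r ^ ((i : ℤ) - j).natAbs)]
    refine le_trans ?_ (le_add_of_nonneg_right zero_le_one)
    rw [hM, ← (Equiv.subLeft (i : ℤ)).tsum_eq]
    refine mul_le_mul_of_nonneg_left ?_ (Real.sqrt_nonneg _)
    exact ((Equiv.subLeft (i : ℤ)).summable_iff.2 hs).sum_le_tsum s fun j _ => by positivity

/-- The vectors with convergent series form a subspace `D`, closed by the uniform bound on finite
sums. By almost orthogonality it contains the ranges of all adjoints of the pieces, and this forces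
it to be everything. -/
lemma summable_piece (F : H) : Summable fun j => ρ.piece κ j F := by
  obtain ⟨M, hM0, hM⟩ := ρ.exists_norm_sum_piece_le κ
  let D : Submodule ℂ H :=
    { carrier := {F | Summable fun j => ρ.piece κ j F}
      add_mem' := fun {F G} hF hG => by
        simp only [Set.mem_ofPred_eq, map_add] at *
        exact hF.add hG
      zero_mem' := by simp [summable_zero]
      smul_mem' := fun c F hF => by
        simp only [Set.mem_ofPred_eq, map_smul] at *
        exact hF.const_smul c }
  have hcl : IsClosed (D : Set H) := by
    refine isClosed_of_closure_subset fun F hF => ?_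
    change Summable fun j => ρ.piece κ j F
    rw [summable_iff_vanishing_norm]
    intro ε hε
    obtain ⟨G, hG, hFG⟩ := Metric.mem_closure_iff.1 hF (ε / (2 * M)) (by positivity)
    obtain ⟨s, hs⟩ := summable_iff_vanishing_norm.1 (show Summable fun j => ρ.piece κ j G from hG)
      (ε / 2) (by positivity)
    refine ⟨s, fun t ht => ?_⟩
    have e : ∑ j ∈ t, ρ.piece κ j F =
        (∑ j ∈ t, ρ.piece κ j) (F - G) + ∑ j ∈ t, ρ.piece κ j G := by
      simp
    rw [e]
    refine (norm_add_le _ _).trans_lt ?_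
    have h1 : ‖(∑ j ∈ t, ρ.piece κ j) (F - G)‖ ≤ M * ‖F - G‖ :=
      (ContinuousLinearMap.le_opNorm _ _).trans (by gcongr; exact hM t)
    have h2 : M * ‖F - G‖ ≤ M * (ε / (2 * M)) := by
      rw [← dist_eq_norm]; gcongr
    have h3 : M * (ε / (2 * M)) = ε / 2 := by field_simp
    linarith [hs t ht]
  have hT : ∀ i G, ρ.piece κ.invol i G ∈ D := fun i G => by
    change Summable fun j => ρ.piece κ j (ρ.piece κ.invol i G)
    obtain ⟨C, hC0, hC⟩ := ρ.exists_norm_piece_mul_piece_le κ κ.invol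
    have hs := (Equiv.subRight (i : ℤ)).summable_iff.2
      (summable_pow_natAbs (r := 1 / 2) (by norm_num) (by norm_num))
    refine Summable.of_norm_bounded ((hs.mul_left C).mul_right ‖G‖) fun j => ?_
    exact (ContinuousLinearMap.le_opNorm (ρ.piece κ j * ρ.piece κ.invol i) G).trans
      (by gcongr; exact hC j i)
  -- A vector orthogonal to the ranges of all adjoint pieces is annihilated by every piece. Its
  -- series is then zero, so it lies in `D` as well as in `Dᗮ`.
  have hperp : Dᗮ = ⊥ := by
    rw [eq_bot_iff]
    intro F hF
    have h0 : ∀ i, ρ.piece κ i F = 0 := fun i => by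
      refine ext_inner_left ℂ fun G => ?_
      rw [inner_zero_right, ← ContinuousLinearMap.adjoint_inner_left,
        ← ContinuousLinearMap.star_eq_adjoint, star_piece]
      exact hF _ (hT i G)
    have hD : F ∈ D := by
      change Summable fun j => ρ.piece κ j F
      simp [h0, summable_zero]
    have := hF F hD
    simpa using this
  have htop : D = ⊤ := by
    rw [← hcl.submodule_topologicalClosure_eq, Submodule.topologicalClosure_eq_top_iff, hperp]
  have : F ∈ D := htop ▸ Submodule.mem_top
  exact this

/-- The multiplier `ρ(k) = a + ∑ ρ(k_j)`. -/
noncomputable def mult : H →L[ℂ] H :=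
  κ.a • ContinuousLinearMap.id ℂ H + LinearMap.mkContinuous
    { toFun := fun F => ∑' j, ρ.piece κ j F
      map_add' := fun F G => by
        simp only [map_add]
        exact (ρ.summable_piece κ F).tsum_add (ρ.summable_piece κ G)
      map_smul' := fun c F => by
        simp only [map_smul, RingHom.id_apply]
        exact (ρ.summable_piece κ F).tsum_const_smul c }
    (ρ.exists_norm_sum_piece_le κ).choose fun F => by
      refine le_of_tendsto (ρ.summable_piece κ F).hasSum.norm (.of_forall fun s => ?_)
      rw [← sum_apply]
      exact (ContinuousLinearMap.le_opNorm _ _).trans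
        (by gcongr; exact (ρ.exists_norm_sum_piece_le κ).choose_spec.2 s)

lemma hasSum_piece (F : H) :
    HasSum (fun j => ρ.piece κ j F) (ρ.mult κ F - κ.a • F) := by
  have : ρ.mult κ F - κ.a • F = ∑' j, ρ.piece κ j F := by
    simp [mult]
  rw [this]
  exact (ρ.summable_piece κ F).hasSum

lemma star_mult : star (ρ.mult κ) = ρ.mult κ.invol := by
  rw [ContinuousLinearMap.star_eq_adjoint]
  symm
  rw [ContinuousLinearMap.eq_adjoint_iff]
  intro F G
  have h1 := (ContinuousLinearMap.hasSum (innerSL ℂ F) (ρ.hasSum_piece κ G))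
  have h2 := (ContinuousLinearMap.hasSum (innerSL ℂ G) (ρ.hasSum_piece κ.invol F))
  have h3 := (ContinuousLinearMap.hasSum (starL' ℝ : ℂ ≃L[ℝ] ℂ).toContinuousLinearMap h2)
  have h4 := h1.unique (h3.congr_fun fun j => ?_)
  · have e : κ.invol.a = star κ.a := rfl
    simp only [coe_innerSL_apply, inner_sub_right, inner_smul_right, e] at h4
    simp [mul_comm] at h4
    exact h4.symm
  · simp [← star_piece, ContinuousLinearMap.star_eq_adjoint,
      ContinuousLinearMap.adjoint_inner_right]

end UnitaryRep
end Unitary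

/-! ### Convolutions with the dyadic pieces -/

section Convolution

open Filter Topology

variable {V : Type*} [NormedAddCommGroup V] [NormedSpace ℝ V] [FiniteDimensional ℝ V]
  [MeasureSpace V] [BorelSpace V] [(volume : Measure V).IsAddHaarMeasure]

/-- The convolution of a dilate of `f` with `φ`. -/
noncomputable def dconv (S : AdaptedSymplectic V) (f : V × ℝ → ℂ) (ε : ℝ) (hε : 0 < ε)
    (φ : V × ℝ → ℂ) (x : V × ℝ) : ℂ :=
  ∫ g, f g * φ (mul S (inv (dilation ε hε g)) x)

variable (S : AdaptedSymplectic V)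

lemma measurePreserving_shear (ε : ℝ) (hε : 0 < ε) :
    MeasurePreserving (fun p : (V × ℝ) × (V × ℝ) => (p.1, mul S (inv (dilation ε hε p.1)) p.2))
      (volume.prod volume) (volume.prod volume) :=
  (MeasurePreserving.id volume).skew_product
    (g := fun h x => mul S (inv (dilation ε hε h)) x)
    (Continuous.mulG S (continuous_inv.comp ((dilation ε hε).continuous.comp continuous_fst))
      continuous_snd).measurable
    (.of_forall fun _ => (measurePreserving_mul_left S _).map_eq)

variable {f φ : V × ℝ → ℂ}

lemma integrable_prod_dconv (hf : Integrable f) (hφ : Integrable φ) (ε : ℝ) (hε : 0 < ε) :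
    Integrable (fun p : (V × ℝ) × (V × ℝ) => f p.1 * φ (mul S (inv (dilation ε hε p.1)) p.2))
      (volume.prod volume) :=
  (measurePreserving_shear S ε hε).integrable_comp_of_integrable (hf.mul_prod hφ)

lemma integrable_dconv (hf : Integrable f) (hφ : Integrable φ) (ε : ℝ) (hε : 0 < ε) :
    Integrable (dconv S f ε hε φ) :=
  (integrable_prod_dconv S hf hφ ε hε).integral_prod_right

lemma UnitaryRep.integ_dconv {S : AdaptedSymplectic V} {H : Type*} [NormedAddCommGroup H]
    [InnerProductSpace ℂ H] [CompleteSpace H] (ρ : UnitaryRep S H) (hf : Integrable f)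
    (hφ : Integrable φ) (ε : ℝ) (hε : 0 < ε) :
    ρ.integ (dconv S f ε hε φ) = (ρ.scale ε hε).integ f * ρ.integ φ := by
  ext F
  have hi : Integrable (fun p : (V × ℝ) × (V × ℝ) =>
      (f p.1 * φ (mul S (inv (dilation ε hε p.1)) p.2)) • ρ.op p.2 F) (volume.prod volume) := by
    refine ((integrable_prod_dconv S hf hφ ε hε).norm.mul_const ‖F‖).mono'
      ((integrable_prod_dconv S hf hφ ε hε).aestronglyMeasurable.smul
        ((ρ.cont F).comp continuous_snd).aestronglyMeasurable) (.of_forall fun p => ?_)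
    rw [norm_smul, LinearIsometry.norm_map]
  rw [integ_apply _ (integrable_dconv S hf hφ ε hε), mul_apply_eq_comp, integ_apply _ hf]
  simp only [dconv, ← integral_smul_const]
  rw [← integral_integral_swap hi]
  refine integral_congr_ae (.of_forall fun g => ?_)
  simp only [mul_smul, integral_smul]
  rw [scale_op, op_integ _ hφ, integ_apply _ (hφ.comp_mulG S _)]

/-- The L¹ counterpart of the almost orthogonality estimate: subtract `f g * φ x`, which integrates
to zero in `g`, and use the translation modulus of `φ`. It is effective at small scales. -/
lemma integral_norm_dconv_le (f φ : Test V) (hf : ∫ g, f g = 0) {C : ℝ}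
    (hC : ∀ g, ∫ x, ‖φ (mul S (inv g) x) - φ x‖ ≤ C * ‖g‖) (hC0 : 0 ≤ C) (ε : ℝ) (hε : 0 < ε)
    (hε1 : ε ≤ 1) : ∫ x, ‖dconv S f ε hε φ x‖ ≤ ε * (C * ∫ g, ‖f g‖ * ‖g‖) := by
  have hi : Integrable fun g => ‖f g‖ * ‖g‖ :=
    (f.continuous.norm.mul continuous_norm).integrable_of_hasCompactSupport
      f.hasCompactSupport.norm.mul_right
  have h1 : Integrable (fun p : (V × ℝ) × (V × ℝ) =>
      f p.1 * φ (mul S (inv (dilation ε hε p.1)) p.2) - f p.1 * φ p.2) (volume.prod volume) :=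
    (integrable_prod_dconv S f.integrable' φ.integrable' ε hε).sub
      (f.integrable'.mul_prod φ.integrable')
  have e : ∀ᵐ x, ‖dconv S f ε hε φ x‖ ≤
      ∫ g, ‖f g * φ (mul S (inv (dilation ε hε g)) x) - f g * φ x‖ := by
    filter_upwards [(integrable_prod_dconv S f.integrable' φ.integrable' ε hε).prod_left_ae]
      with x hx
    refine le_trans (le_of_eq ?_) (norm_integral_le_integral_norm _)
    rw [integral_sub hx (f.integrable'.mul_const _), integral_mul_const, hf, zero_mul, sub_zero]
    rfl
  calc ∫ x, ‖dconv S f ε hε φ x‖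
      ≤ ∫ x, ∫ g, ‖f g * φ (mul S (inv (dilation ε hε g)) x) - f g * φ x‖ :=
        integral_mono_ae (integrable_dconv S f.integrable' φ.integrable' ε hε).norm
          h1.norm.integral_prod_right e
    _ = ∫ g, ∫ x, ‖f g * φ (mul S (inv (dilation ε hε g)) x) - f g * φ x‖ :=
        (integral_integral_swap h1.norm).symm
    _ ≤ ∫ g, ε * (C * (‖f g‖ * ‖g‖)) := by
        refine integral_mono h1.norm.integral_prod_left ((hi.const_mul C).const_mul ε) fun g => ?_
        simp only [← mul_sub, norm_mul, integral_const_mul]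
        calc _ ≤ ‖f g‖ * (C * (ε * ‖g‖)) := by
              gcongr
              refine (hC _).trans ?_
              gcongr
              exact norm_dilation_le ε hε hε1 g
          _ = _ := by ring
    _ = _ := by rw [integral_const_mul, integral_const_mul]

/-- `φ (g⁻¹)`. -/
noncomputable def Test.refl (φ : Test V) : Test V :=
  φ.comp invHomeo (by change ContDiff ℝ _ fun g : V × ℝ => -g; fun_prop)

/-- Inversion reverses a convolution, and dilation by `R` moves the scale from one factor to the
other. Up to the Jacobian, convolution by `f` at scale `R` is thus convolution of `f (g⁻¹)` by `φ
(g⁻¹)` at scale `R⁻¹`, so large scales reduce to small ones with `f` and `φ` interchanged. -/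
lemma dconv_dilation_inv (f φ : V × ℝ → ℂ) (R : ℝ) (hR : 0 < R) (x : V × ℝ) :
    dconv S f R hR φ (dilation R hR (inv x)) = ((R⁻¹ ^ homDim V : ℝ) : ℂ) *
      dconv S (fun g => φ (inv g)) R⁻¹ (inv_pos.2 hR) (fun g => f (inv g)) x := by
  have h1 : dconv S f R hR φ (dilation R hR (inv x)) =
      ∫ h, φ (inv (dilation R hR h)) * f (inv (mul S (inv h) x)) := by
    rw [dconv, ← integral_mul_left S (inv x)]
    refine integral_congr_ae (.of_forall fun h => ?_)
    simp only [inv_mul, inv_inv', ← dilation_inv, ← dilation_mul]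
    rw [mul_comm, mul_assoc', mul_inv_cancel', mul_zero']
  have h2 := integral_dilation (V := V) R hR fun h => φ (inv h) *
    f (inv (mul S (inv (dilation R⁻¹ (inv_pos.2 hR) h)) x))
  have h3 : ∀ h : V × ℝ, dilation R⁻¹ (inv_pos.2 hR) (dilation R hR h) = h := fun h => by
    rw [dilation_dilation]; ext <;> simp [dilation_apply, hR.ne']
  simp only [h3] at h2
  rw [h1, h2, dconv, inv_pow, Complex.real_smul]

lemma integral_norm_dconv_large (f φ : V × ℝ → ℂ) (R : ℝ) (hR : 0 < R) :
    ∫ x, ‖dconv S f R hR φ x‖ = ∫ x, ‖dconv S (fun g => φ (inv g)) R⁻¹ (inv_pos.2 hR)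
      (fun g => f (inv g)) x‖ := by
  have h1 : ∀ x, ‖dconv S (fun g => φ (inv g)) R⁻¹ (inv_pos.2 hR) (fun g => f (inv g)) x‖ =
      R ^ homDim V * ‖dconv S f R hR φ (dilation R hR (inv x))‖ := fun x => by
    rw [dconv_dilation_inv, norm_mul, Complex.norm_real, Real.norm_of_nonneg (by positivity),
      ← mul_assoc, ← mul_pow, mul_inv_cancel₀ hR.ne', one_pow, one_mul]
  simp only [h1]
  rw [integral_const_mul, integral_inv fun x => ‖dconv S f R hR φ (dilation R hR x)‖,
    integral_dilation R hR fun x => ‖dconv S f R hR φ x‖, smul_eq_mul, ← mul_assoc,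
    mul_inv_cancel₀ (by positivity), one_mul]

/-- `ψ = k ∗ φ` for the kernel `k` with data `κ`. -/
def IsConv (κ : Kernel V) (φ ψ : V × ℝ → ℂ) : Prop :=
  ∀ x, Tendsto (fun N : ℕ => ∑ j ∈ Finset.Ico (-N : ℤ) N,
    dconv S κ.f (dyadic j) (dyadic_pos j) φ x) atTop (𝓝 (ψ x - κ.a * φ x))

lemma tendsto_Ico : Tendsto (fun N : ℕ => Finset.Ico (-N : ℤ) N) atTop atTop := by
  refine tendsto_atTop_finset_of_monotone (fun M N h => Finset.Ico_subset_Ico (by omega) (by omega))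
    fun j => ⟨j.natAbs + 1, ?_⟩
  rw [Finset.mem_Ico]; omega

/-- At the small scales `j ≥ 0` the mean zero of `κ.f` gives geometric decay. At the large scales
the roles are exchanged, and it is the mean zero of `φ` that gives it. -/
lemma summable_integral_norm_dconv (κ : Kernel V) (φ : Test V) (hφ : ∫ g, φ g = 0) :
    Summable fun j => ∫ x, ‖dconv S κ.f (dyadic j) (dyadic_pos j) φ x‖ := by
  obtain ⟨C, hC0, hC⟩ := φ.exists_modulus S
  obtain ⟨D, hD0, hD⟩ := κ.f.refl.exists_modulus S
  have hφ' : ∫ g, φ.refl g = 0 := by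
    rw [← hφ]; exact integral_inv φ
  have hg : Summable fun n : ℕ => (1 / 2 : ℝ) ^ n :=
    summable_geometric_of_lt_one (by norm_num) (by norm_num)
  have h1 : ∀ n : ℕ, (1 / 2 : ℝ) ^ n ≤ 1 := fun n => pow_le_one₀ (by norm_num) (by norm_num)
  refine Summable.of_nat_of_neg ?_ ?_
  · refine Summable.of_nonneg_of_le (fun n => by positivity) (fun n => ?_)
      (hg.mul_right (C * ∫ g, ‖κ.f g‖ * ‖g‖))
    have := integral_norm_dconv_le S κ.f φ κ.mean hC hC0 (dyadic n) (dyadic_pos n)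
      (by rw [dyadic_natCast]; exact h1 n)
    exact this.trans_eq (by rw [dyadic_natCast])
  · refine Summable.of_nonneg_of_le (fun n => by positivity) (fun n => ?_)
      (hg.mul_right (D * ∫ g, ‖φ.refl g‖ * ‖g‖))
    have e : (dyadic (-n))⁻¹ = (1 / 2) ^ n := by
      rw [dyadic_neg_natCast, one_div, inv_pow]
    rw [integral_norm_dconv_large]
    have := integral_norm_dconv_le S φ.refl κ.f.refl hφ' hD hD0 (dyadic (-n))⁻¹
      (inv_pos.2 (dyadic_pos _)) (by rw [e]; exact h1 n)
    exact this.trans_eq (by rw [e])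

/-- The dominating function is `∑ ‖D j x‖`, whose integral is the sum of the L¹-norms of the pieces.
It serves the dominated convergence arguments for all partial sums at once. -/
lemma exists_dconv_bound (κ : Kernel V) (φ : Test V) (hφ : ∫ g, φ g = 0) :
    ∃ G : V × ℝ → ℝ, Integrable G ∧ ∀ᵐ x, ∀ s : Finset ℤ,
      ‖∑ j ∈ s, dconv S κ.f (dyadic j) (dyadic_pos j) φ x‖ ≤ G x := by
  have hs := summable_integral_norm_dconv S κ φ hφ
  have hi := fun j : ℤ => integrable_dconv S κ.f.integrable' φ.integrable' (dyadic j)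
    (dyadic_pos j)
  set D := fun j : ℤ => dconv S κ.f (dyadic j) (dyadic_pos j) φ
  have hm : ∀ j, AEMeasurable (fun x => ‖D j x‖ₑ) := fun j => (hi j).aestronglyMeasurable.enorm
  have hfin : ∫⁻ x, ∑' j, ‖D j x‖ₑ ≠ ⊤ := by
    rw [lintegral_tsum hm]
    have e : ∀ j, ∫⁻ x, ‖D j x‖ₑ = ENNReal.ofReal (∫ x, ‖D j x‖) := fun j =>
      (ofReal_integral_norm_eq_lintegral_enorm (hi j)).symm
    simp only [e]
    exact hs.tsum_ofReal_ne_top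
  refine ⟨fun x => (∑' j, ‖D j x‖ₑ).toReal,
    integrable_toReal_of_lintegral_ne_top (AEMeasurable.tsum hm) hfin, ?_⟩
  filter_upwards [ae_lt_top' (AEMeasurable.tsum hm) hfin] with x hx s
  rw [← ENNReal.ofReal_le_iff_le_toReal hx.ne, ofReal_norm]
  exact (enorm_sum_le _ _).trans (ENNReal.sum_le_tsum s)

/-- The convolution of the kernel with a mean zero test function is integrable. -/
lemma IsConv.integrable {κ : Kernel V} {φ : Test V} {ψ : V × ℝ → ℂ} (h : IsConv S κ φ ψ)
    (hφ : ∫ g, φ g = 0) : Integrable ψ := by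
  obtain ⟨G, hG, hb⟩ := exists_dconv_bound S κ φ hφ
  have h1 : Integrable fun x => ψ x - κ.a * φ x := by
    refine hG.mono' (aestronglyMeasurable_of_tendsto_ae atTop (fun N : ℕ =>
      (integrable_finsetSum (Finset.Ico (-N : ℤ) N) fun j _ => integrable_dconv S κ.f.integrable'
        φ.integrable' (dyadic j) (dyadic_pos j)).aestronglyMeasurable)
      (.of_forall fun x => h x)) ?_
    filter_upwards [hb] with x hx
    exact le_of_tendsto (h x).norm (.of_forall fun N => hx _)
  have h2 := h1.add (φ.integrable'.const_mul κ.a)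
  refine h2.congr (.of_forall fun x => ?_)
  simp

/-- The relation `ρ(k) ρ(φ) = ρ(k ∗ φ)`. It holds for each dyadic piece by Fubini, and passes to the
limit because the partial sums converge pointwise under an integrable bound. -/
lemma UnitaryRep.mult_integ {S : AdaptedSymplectic V} {H : Type*} [NormedAddCommGroup H]
    [InnerProductSpace ℂ H] [CompleteSpace H] (ρ : UnitaryRep S H) {κ : Kernel V} {φ : Test V}
    {ψ : V × ℝ → ℂ} (h : IsConv S κ φ ψ) (hφ : ∫ g, φ g = 0) (F : H) :
    ρ.mult κ (ρ.integ φ F) = ρ.integ ψ F := by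
  obtain ⟨G, hG, hb⟩ := exists_dconv_bound S κ φ hφ
  have hψ := h.integrable S hφ
  have hi := fun j : ℤ => integrable_dconv S κ.f.integrable' φ.integrable' (dyadic j)
    (dyadic_pos j)
  have hsum := fun N : ℕ => integrable_finsetSum (Finset.Ico (-N : ℤ) N) fun j _ => hi j
  have h1 : Tendsto (fun N : ℕ => ∑ j ∈ Finset.Ico (-N : ℤ) N, ρ.piece κ j (ρ.integ φ F)) atTop
      (𝓝 (∫ x, (ψ x - κ.a * φ x) • ρ.op x F)) := by
    have e : ∀ N : ℕ, ∑ j ∈ Finset.Ico (-N : ℤ) N, ρ.piece κ j (ρ.integ φ F) =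
        ∫ x, (∑ j ∈ Finset.Ico (-N : ℤ) N, dconv S κ.f (dyadic j) (dyadic_pos j) φ x) •
          ρ.op x F := fun N => by
      simp only [Finset.sum_smul]
      rw [integral_finsetSum _ fun j _ => ρ.integrable_smul (hi j) F]
      refine Finset.sum_congr rfl fun j _ => ?_
      rw [← integ_apply _ (hi j), integ_dconv _ κ.f.integrable' φ.integrable']
      rfl
    simp only [e]
    refine tendsto_integral_of_dominated_convergence (fun x => G x * ‖F‖)
      (fun N => (ρ.integrable_smul (hsum N) F).aestronglyMeasurable) (hG.mul_const _)
      (fun N => ?_) (.of_forall fun x => (h x).smul_const _)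
    filter_upwards [hb] with x hx
    rw [norm_smul, LinearIsometry.norm_map]
    exact mul_le_mul_of_nonneg_right (hx _) (norm_nonneg _)
  have h2 := tendsto_nhds_unique ((ρ.hasSum_piece κ (ρ.integ φ F)).comp tendsto_Ico) h1
  have h3 : ∫ x, (ψ x - κ.a * φ x) • ρ.op x F = ρ.integ ψ F - κ.a • ρ.integ φ F := by
    simp only [sub_smul, mul_smul]
    have h4 : Integrable fun x => κ.a • φ x • ρ.op x F :=
      (ρ.integrable_smul φ.integrable' F).smul κ.a
    rw [integral_sub (ρ.integrable_smul hψ F) h4, integral_smul, integ_apply _ hψ, integ_apply _ φ.integrable']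
  rw [h3] at h2
  exact sub_left_injective h2

/-- The kernel `k♯`. -/
noncomputable def Kernel.sharp (κ : Kernel V) : Kernel V where
  a := star κ.a
  f := κ.f.sharp
  mean := by
    have : ∫ g, κ.f.sharp g = star (∫ g, κ.f g) := by
      rw [← integral_sigma κ.f]; exact integral_conj
    rw [this, κ.mean, star_zero]

/-- The kernel `k^op`. -/
noncomputable def Kernel.op (κ : Kernel V) : Kernel V where
  a := κ.a
  f := κ.f.op
  mean := by rw [← κ.mean]; exact integral_opMap κ.f

/-- Combined with `UnitaryRep.star_mult`, this says that `ρ(k♯)` is the adjoint of `ρ(k^op)`, so the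
two have the same norm. -/
lemma Kernel.invol_op (κ : Kernel V) : κ.op.invol = κ.sharp := by
  have : κ.op.invol.f = κ.sharp.f := TestFunction.ext fun g => by
    change star (κ.f (opMap (inv g))) = star (κ.f (sigma g))
    rw [opMap_inv]
  unfold Kernel.invol Kernel.sharp at *
  simp only at this
  simp only [this]
  rfl

/-- `sigma` is a measure preserving automorphism of the group that commutes with dilations, so
conjugation together with composition by `sigma` respects convolutions. -/
lemma IsConv.sharp {κ : Kernel V} {φ ψ : V × ℝ → ℂ} (h : IsConv S κ φ ψ) :
    IsConv S κ.sharp (fun g => star (φ (sigma g))) (fun g => star (ψ (sigma g))) := by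
  intro x
  have h1 := (continuous_star.tendsto _).comp (h (sigma x))
  have e : ∀ j, dconv S κ.sharp.f (dyadic j) (dyadic_pos j) (fun g => star (φ (sigma g))) x =
      star (dconv S κ.f (dyadic j) (dyadic_pos j) φ (sigma x)) := fun j => by
    rw [dconv, dconv, ← integral_sigma]
    refine Eq.trans (integral_congr_ae (.of_forall fun g => ?_)) integral_conj
    change star (κ.f (sigma (sigma g))) * star _ = _
    rw [sigma_sigma, sigma_mul, sigma_inv, sigma_dilation, sigma_sigma]
    simp
  simp only [e]
  refine (h1.congr fun N => ?_).trans_eq ?_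
  · simp
  · simp [Kernel.sharp]

end Convolution

/-! ### Regular homogeneous distributions -/

section Distribution

open Filter Topology

variable {V : Type*} [NormedAddCommGroup V] [NormedSpace ℝ V]

/-- The product of test functions. -/
noncomputable def Test.mul (χ φ : Test V) : Test V where
  toFun g := χ g * φ g
  contDiff' := χ.contDiff.mul φ.contDiff
  hasCompactSupport' := χ.hasCompactSupport.mul_right
  tsupport_subset' := by simp

lemma Test.mul_apply (χ φ : Test V) (g : V × ℝ) : χ.mul φ g = χ g * φ g := rfl

lemma norm_dilation_clm_le (s : ℝ) (hs : 0 < s) (hs1 : s ≤ 1) :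
    ‖(dilation (V := V) s hs : V × ℝ →L[ℝ] V × ℝ)‖ ≤ s :=
  ContinuousLinearMap.opNorm_le_bound _ hs.le (norm_dilation_le s hs hs1)

/-- In order zero this is the Lipschitz bound at the origin. In order `i ≥ 1` the constant drops out
and the chain rule produces `‖δ_s‖ ^ i ≤ s ^ i ≤ s`. -/
lemma Test.exists_iteratedFDeriv_dilate_sub_le (φ : Test V) (R : ℝ) (i : ℕ) :
    ∃ C, 0 ≤ C ∧ ∀ s hs, s ≤ 1 → ∀ x : V × ℝ, ‖x‖ ≤ R →
      ‖iteratedFDeriv ℝ i (fun y => φ.dilate s hs y - φ 0) x‖ ≤ s * C := by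
  rcases Nat.eq_zero_or_pos i with rfl | hi
  · obtain ⟨L, hL⟩ := ContDiff.lipschitzWith_of_hasCompactSupport φ.hasCompactSupport
      φ.contDiff (by simp)
    refine ⟨L * |R|, by positivity, fun s hs hs1 x hx => ?_⟩
    rw [norm_iteratedFDeriv_zero, Test.dilate_apply]
    refine (hL.norm_sub_le _ _).trans ?_
    rw [sub_zero]
    calc L * ‖dilation s hs x‖ ≤ L * (s * |R|) := by
          gcongr
          refine (norm_dilation_le s hs hs1 x).trans ?_
          gcongr
          exact hx.trans (le_abs_self R)
      _ = _ := by ring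
  · obtain ⟨C, hC⟩ := (φ.hasCompactSupport.iteratedFDeriv (𝕜 := ℝ) i).exists_bound_of_continuous
      (φ.contDiff.continuous_iteratedFDeriv (by exact_mod_cast le_top))
    refine ⟨|C|, abs_nonneg C, fun s hs hs1 x _ => ?_⟩
    have e : iteratedFDeriv ℝ i (fun y => φ.dilate s hs y - φ 0) x =
        (iteratedFDeriv ℝ i φ (dilation s hs x)).compContinuousLinearMap
          fun _ => (dilation (V := V) s hs : V × ℝ →L[ℝ] V × ℝ) := by
      refine (iteratedFDeriv_sub_apply (g := fun _ => φ 0)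
        ((φ.dilate s hs).contDiff.of_le (by exact_mod_cast le_top)).contDiffAt
        contDiffAt_const).trans ?_
      rw [iteratedFDeriv_const_of_ne hi.ne', Pi.zero_apply, sub_zero]
      exact (dilation (V := V) s hs : V × ℝ →L[ℝ] V × ℝ).iteratedFDeriv_comp_right φ.contDiff x
        (by exact_mod_cast le_top)
    rw [e]
    refine (ContinuousMultilinearMap.norm_compContinuousLinearMap_le _ _).trans ?_
    rw [Finset.prod_const, Finset.card_univ, Fintype.card_fin, mul_comm]
    refine mul_le_mul ?_ ((hC _).trans (le_abs_self C)) (norm_nonneg _) hs.le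
    calc _ ≤ s ^ i := pow_le_pow_left₀ (norm_nonneg _) (norm_dilation_clm_le s hs hs1) i
      _ ≤ s ^ 1 := pow_le_pow_of_le_one hs.le hs1 hi
      _ = s := pow_one s

lemma tendsto_dyadic : Tendsto (fun N : ℕ => dyadic N) atTop (𝓝 0) := by
  simp only [dyadic_natCast]
  exact tendsto_pow_atTop_nhds_zero_of_lt_one (by norm_num) (by norm_num)

lemma dyadic_natCast_le_one (N : ℕ) : dyadic N ≤ 1 := by
  rw [dyadic_natCast]; exact pow_le_one₀ (by norm_num) (by norm_num)

/-- `χ · φ_ε → φ(0) χ` for a distribution, as `ε → 0`. -/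
lemma Distr.tendsto_mul_dilate (k : Distr V) (χ φ : Test V) :
    Tendsto (fun N : ℕ => k (χ.mul (φ.dilate (dyadic N) (dyadic_pos N)))) atTop
      (𝓝 (φ 0 * k χ)) := by
  let K : Compacts (V × ℝ) := ⟨tsupport χ, χ.hasCompactSupport⟩
  let u : ℕ → V × ℝ → ℂ := fun N y => φ.dilate (dyadic N) (dyadic_pos N) y - φ 0
  have hu : ∀ N, ContDiff ℝ (⊤ : ℕ∞) (u N) := fun N =>
    (φ.dilate (dyadic N) (dyadic_pos N)).contDiff.sub contDiff_const
  let w : ℕ → ContDiffMapSupportedIn (V × ℝ) ℂ ⊤ K := fun N =>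
    ContDiffMapSupportedIn.of_support_subset (f := fun y => χ y * u N y)
      (χ.contDiff.mul (hu N)) (fun x hx => subset_tsupport _ (left_ne_zero_of_mul hx))
  obtain ⟨R, hR⟩ := χ.hasCompactSupport.isCompact.isBounded.subset_closedBall (0 : V × ℝ)
  have hw : Tendsto w atTop (𝓝 0) := by
    -- All the functions `w N` are supported in `tsupport χ`, so it suffices to bound each seminorm.
    -- The Leibniz rule bounds it by a constant times `dyadic N`.
    rw [(ContDiffMapSupportedIn.withSeminorms ℂ (V × ℝ) ℂ ⊤ K).tendsto_nhds]
    intro i ε hε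
    have hχ : ∀ j, ∃ C, ∀ x, ‖iteratedFDeriv ℝ j χ x‖ ≤ C := fun j =>
      (χ.hasCompactSupport.iteratedFDeriv (𝕜 := ℝ) j).exists_bound_of_continuous
        (χ.contDiff.continuous_iteratedFDeriv (by exact_mod_cast le_top))
    choose A hA using hχ
    choose B hB0 hB using fun j => φ.exists_iteratedFDeriv_dilate_sub_le R j
    set D := ∑ j ∈ Finset.range (i + 1), (i.choose j : ℝ) * |A j| * B (i - j)
    have hD : 0 ≤ D := Finset.sum_nonneg fun j _ => by have := hB0 (i - j); positivity
    have hlim : Tendsto (fun N : ℕ => dyadic N * D) atTop (𝓝 0) := by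
      simpa using tendsto_dyadic.mul_const D
    filter_upwards [hlim.eventually_lt_const hε] with N hN
    refine lt_of_le_of_lt ?_ hN
    rw [sub_zero, ContDiffMapSupportedIn.seminorm_top_le_iff ℂ
      (mul_nonneg (dyadic_pos N).le hD)]
    intro x hx
    have hxR : ‖x‖ ≤ R := by simpa using hR hx
    refine (norm_iteratedFDeriv_mul_le χ.contDiff (hu N) x (by exact_mod_cast le_top)).trans ?_
    rw [Finset.mul_sum]
    refine Finset.sum_le_sum fun j _ => ?_
    calc _ ≤ (i.choose j : ℝ) * |A j| * (dyadic N * B (i - j)) := by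
          gcongr
          · exact (hA j x).trans (le_abs_self _)
          · exact hB (i - j) _ _ (dyadic_natCast_le_one N) x hxR
      _ = _ := by ring
  have hk : Continuous fun f : ContDiffMapSupportedIn (V × ℝ) ℂ ⊤ K =>
      k (TestFunction.ofSupportedIn (Set.subset_univ _) f) :=
    k.continuous.comp (TestFunction.continuous_ofSupportedIn (Set.subset_univ _))
  have h1 := (hk.tendsto 0).comp hw
  have h0 : (TestFunction.ofSupportedIn (Set.subset_univ _)
      (0 : ContDiffMapSupportedIn (V × ℝ) ℂ ⊤ K) : Test V) = 0 := TestFunction.ext fun _ => rfl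
  rw [h0, map_zero] at h1
  have h2 : ∀ N : ℕ, k (χ.mul (φ.dilate (dyadic N) (dyadic_pos N))) =
      k (TestFunction.ofSupportedIn (Set.subset_univ _) (w N)) + φ 0 * k χ := fun N => by
    rw [← smul_eq_mul, ← map_smul, ← map_add]
    refine congrArg k (TestFunction.ext fun x => ?_)
    change χ x * φ.dilate (dyadic N) (dyadic_pos N) x =
      χ x * (φ.dilate (dyadic N) (dyadic_pos N) x - φ 0) + φ 0 * χ x
    ring
  simp only [h2]
  simpa using h1.add_const (φ 0 * k χ)

lemma sum_Ico_neg_sub (a : ℤ → ℂ) (N : ℕ) :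
    ∑ j ∈ Finset.Ico (-N : ℤ) N, (a j - a (j + 1)) = a (-N) - a N := by
  induction N with
  | zero => simp
  | succ N ih =>
    have e : Finset.Ico (-(N + 1 : ℕ) : ℤ) (N + 1 : ℕ) =
        insert (-(N + 1 : ℤ)) (insert (N : ℤ) (Finset.Ico (-N : ℤ) N)) := by
      ext j
      simp only [Finset.mem_Ico, Finset.mem_insert]
      push_cast
      omega
    rw [e, Finset.sum_insert (by simp only [Finset.mem_Ico, Finset.mem_insert]; omega),
      Finset.sum_insert (by simp), ih]
    push_cast
    rw [show (-(N + 1 : ℤ)) + 1 = -N by ring]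
    ring_nf

lemma norm_dilation_two_le (g : V × ℝ) : ‖dilation 2 two_pos g‖ ≤ 4 * ‖g‖ := by
  rw [dilation_apply, Prod.norm_def]
  have h1 := norm_fst_le g
  have h2 := norm_snd_le g
  have h0 := norm_nonneg g
  refine max_le ?_ ?_
  · rw [norm_smul, Real.norm_ofNat]; linarith
  · rw [norm_mul, norm_pow, Real.norm_ofNat]; linarith

variable [FiniteDimensional ℝ V] [MeasureSpace V] [BorelSpace V]
  [(volume : Measure V).IsAddHaarMeasure]

/-- `κ` is the data of the distribution `k`. -/
def Distr.HasKernel (k : Distr V) (κ : Kernel V) : Prop :=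
  ∀ φ : Test V, Tendsto (fun N : ℕ => ∑ j ∈ Finset.Ico (-N : ℤ) N,
    ∫ g, κ.f g * φ (dilation (dyadic j) (dyadic_pos j) g)) atTop (𝓝 (k φ - κ.a * φ 0))

/-- With a cutoff `χ` equal to `1` near the origin, `ψ = χ - χ ∘ δ_2` is supported away from it, so
`f = K ψ` is a test function. The dyadic dilates of `ψ` telescope; hence the dilates of `f` add up
to `k`, except for a multiple of `δ₀` left over at the fine end. -/
lemma Distr.exists_hasKernel (k : Distr V) (hreg : k.IsRegular)
    (hhom : k.IsHomogeneous (-(homDim V : ℝ))) : ∃ κ : Kernel V, k.HasKernel κ := by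
  obtain ⟨K, hK, hkK⟩ := hreg
  have hh : ∀ (s : ℝ) (hs : 0 < s) (φ : Test V), k (φ.dilate s hs) = k φ := fun s hs φ => by
    rw [hhom s hs φ]; simp
  let bump : ContDiffBump (0 : V × ℝ) := ⟨1, 2, one_pos, one_lt_two⟩
  let χ : Test V :=
    { toFun := fun g => (bump g : ℂ)
      contDiff' := Complex.ofRealCLM.contDiff.comp bump.contDiff
      hasCompactSupport' := bump.hasCompactSupport.comp_left (g := ((↑) : ℝ → ℂ)) rfl
      tsupport_subset' := by simp }
  have hχ1 : ∀ g, ‖g‖ ≤ 1 → χ g = 1 := fun g hg => by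
    have : bump g = 1 := bump.one_of_mem_closedBall (by simpa using hg)
    change ((bump g : ℝ) : ℂ) = 1
    rw [this, Complex.ofReal_one]
  let ψ : Test V := χ - χ.dilate 2 two_pos
  have hψ : ∀ g, ψ g = χ g - χ (dilation 2 two_pos g) := fun g => rfl
  have hψ0 : ∀ g, ‖g‖ < 1 / 4 → ψ g = 0 := fun g hg => by
    rw [hψ, hχ1 g (by linarith), hχ1 _ ((norm_dilation_two_le g).trans (by linarith)), sub_self]
  have hψs : ∀ θ : Test V, (0 : V × ℝ) ∉ tsupport (ψ.mul θ) := fun θ => by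
    rw [notMem_tsupport_iff_eventuallyEq]
    filter_upwards [Metric.ball_mem_nhds (0 : V × ℝ) (by norm_num : (0 : ℝ) < 1 / 4)] with g hg
    rw [Test.mul_apply, hψ0 g (by simpa using hg), zero_mul]; rfl
  have hψs' : (0 : V × ℝ) ∉ tsupport ψ := by
    rw [notMem_tsupport_iff_eventuallyEq]
    filter_upwards [Metric.ball_mem_nhds (0 : V × ℝ) (by norm_num : (0 : ℝ) < 1 / 4)] with g hg
    rw [hψ0 g (by simpa using hg)]; rfl
  let f : Test V :=
    { toFun := fun g => K g * ψ g
      contDiff' := by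
        rw [contDiff_iff_contDiffAt]
        intro g
        by_cases hg : g = 0
        · subst hg
          refine (contDiffAt_const (c := (0 : ℂ))).congr_of_eventuallyEq ?_
          filter_upwards [notMem_tsupport_iff_eventuallyEq.1 hψs'] with g hg
          rw [hg]; simp
        · exact ((hK g hg).contDiffAt (isOpen_compl_singleton.mem_nhds hg)).mul
            ψ.contDiff.contDiffAt
      hasCompactSupport' := ψ.hasCompactSupport.mul_left
      tsupport_subset' := by simp }
  have hf : ∀ θ : Test V, k (ψ.mul θ) = ∫ g, f g * θ g := fun θ => by
    rw [hkK _ (hψs θ)]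
    refine integral_congr_ae (.of_forall fun g => ?_)
    change K g * (ψ g * θ g) = K g * ψ g * θ g
    ring
  -- The coefficient of `δ₀` is `k χ` and depends on the cutoff. The mean of `f` is `k χ - k (χ ∘
  -- δ_2)`, which vanishes because a distribution of degree `-Q` does not see dilations of its
  -- argument.
  refine ⟨⟨k χ, f, ?_⟩, fun φ => ?_⟩
  · have h1 : ∫ g, f g = k ψ := (hkK _ hψs').symm
    rw [h1]
    change k (χ - χ.dilate 2 two_pos) = 0
    rw [map_sub, hh, sub_self]
  · let r : ℤ → ℝ := fun j => dyadic (-j)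
    have hr : ∀ j, 0 < r j := fun j => dyadic_pos _
    have hrd : ∀ j, r j * dyadic j = 1 := fun j => by
      rw [← dyadic_add, neg_add_cancel]; simp [dyadic]
    have hdil : ∀ j (g : V × ℝ), dilation (dyadic j) (dyadic_pos j) (dilation (r j) (hr j) g) = g :=
      fun j g => by
        rw [dilation_dilation]
        ext <;> simp [dilation_apply, mul_comm (dyadic j), hrd]
    -- `a j` pairs `k` with `φ` cut off to size about `2^(-j)`, since `r j = 2^j`. The dyadic terms
    -- are its differences; for `N → ∞` the end `a (-N)` becomes `k φ`, and `a N` tends to `φ 0 * k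
    -- χ`.
    let a : ℤ → ℂ := fun j => k ((χ.dilate (r j) (hr j)).mul φ)
    have ha : ∀ j, a j - a (j + 1) = ∫ g, f g * φ (dilation (dyadic j) (dyadic_pos j) g) :=
      fun j => by
        have h1 := hf (φ.dilate (dyadic j) (dyadic_pos j))
        rw [← hh (r j) (hr j)] at h1
        refine Eq.trans ?_ h1
        rw [← map_sub]
        refine congrArg k (TestFunction.ext fun g => ?_)
        change χ (dilation (r j) (hr j) g) * φ g - χ (dilation (r (j + 1)) (hr _) g) * φ g =
          (χ (dilation (r j) (hr j) g) - χ (dilation 2 two_pos (dilation (r j) (hr j) g))) *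
            φ (dilation (dyadic j) (dyadic_pos j) (dilation (r j) (hr j) g))
        rw [hdil]
        have : dilation (r (j + 1)) (hr _) g = dilation 2 two_pos (dilation (r j) (hr j) g) := by
          have hr1 : r (j + 1) = 2 * r j := by
            change (2 : ℝ) ^ (-(-(j + 1))) = 2 * 2 ^ (-(-j))
            rw [neg_neg, neg_neg, zpow_add_one₀ two_ne_zero, mul_comm]
          rw [dilation_dilation]
          ext <;> simp [dilation_apply, hr1]
        rw [this]
        ring
    have haN : ∀ N : ℕ, a N = k (χ.mul (φ.dilate (dyadic N) (dyadic_pos N))) := fun N => by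
      rw [← hh (r N) (hr N)]
      refine congrArg k (TestFunction.ext fun g => ?_)
      change χ (dilation (r N) (hr N) g) * φ g = χ (dilation (r N) (hr N) g) *
        φ (dilation (dyadic N) (dyadic_pos N) (dilation (r N) (hr N) g))
      rw [hdil]
    have hlim1 : Tendsto (fun N : ℕ => a N) atTop (𝓝 (φ 0 * k χ)) := by
      simp only [haN]
      exact k.tendsto_mul_dilate χ φ
    have hlim2 : ∀ᶠ N : ℕ in atTop, a (-N) = k φ := by
      obtain ⟨R, hR⟩ := φ.hasCompactSupport.isCompact.isBounded.subset_closedBall (0 : V × ℝ)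
      have hz : Tendsto (fun N : ℕ => dyadic N * R) atTop (𝓝 0) := by
        simpa using tendsto_dyadic.mul_const R
      filter_upwards [hz.eventually_lt_const one_pos] with N hN
      refine congrArg k (TestFunction.ext fun g => ?_)
      change χ (dilation (r (-N)) (hr _) g) * φ g = φ g
      by_cases hg : φ g = 0
      · rw [hg, mul_zero]
      · have hgR : ‖g‖ ≤ R := by simpa using hR (subset_tsupport _ hg)
        have h1 : r (-N) = dyadic N := by simp [r]
        rw [hχ1, one_mul]
        refine (norm_dilation_le _ _ (h1.trans_le (dyadic_natCast_le_one N)) g).trans ?_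
        rw [h1]
        exact (mul_le_mul_of_nonneg_left hgR (dyadic_pos N).le).trans hN.le
    simp only [← ha, sum_Ico_neg_sub]
    rw [mul_comm (k χ)]
    exact (tendsto_const_nhds.congr' (hlim2.mono fun N h => h.symm)).sub hlim1

lemma Distr.HasKernel.op {k : Distr V} {κ : Kernel V} (h : k.HasKernel κ) :
    k.op.HasKernel κ.op := fun φ => by
  have h1 := h φ.op
  have e : ∀ j, ∫ g, κ.op.f g * φ (dilation (dyadic j) (dyadic_pos j) g) =
      ∫ g, κ.f g * φ.op (dilation (dyadic j) (dyadic_pos j) g) := fun j => by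
    rw [← integral_opMap]
    refine integral_congr_ae (.of_forall fun g => ?_)
    change κ.f (opMap (opMap g)) * φ _ = κ.f g * φ (opMap _)
    rw [opMap_dilation]
    congr 2
    ext <;> simp [opMap_apply]
  simp only [e]
  have h0 : φ.op 0 = φ 0 := by rw [Test.op_apply, map_zero]
  rw [h0] at h1
  exact h1

lemma Distr.HasKernel.isConv (S : AdaptedSymplectic V) {k : Distr V} {κ : Kernel V}
    (h : k.HasKernel κ) (φ : Test V) : IsConv S κ φ (conv S k φ) := fun x => by
  have h1 := h (φ.comp (invMulHomeo S x) (contDiff_invMulHomeo S x))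
  refine h1.trans_eq ?_
  have : φ.comp (invMulHomeo S x) (contDiff_invMulHomeo S x) 0 = φ x := by
    change φ (HeisenbergCalculus.mul S (inv 0) x) = φ x
    rw [inv_eq_neg, neg_zero, zero_mul']
  rw [this]
  rfl

end Distribution

/-! ### Analysis in the Bargmann–Fock space -/

section Fock

open Filter Topology

variable {V : Type*} [NormedAddCommGroup V] [NormedSpace ℝ V] [FiniteDimensional ℝ V]
  [MeasureSpace V] [BorelSpace V] [(volume : Measure V).IsAddHaarMeasure]
  (S : AdaptedSymplectic V)

lemma exists_pos_mul_sq_le : ∃ m, 0 < m ∧ ∀ u : V, m * ‖u‖ ^ 2 ≤ S.ω (S.J u) u := by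
  have hc : Continuous fun u : V => S.ω (S.J u) u := by fun_prop
  rcases (Metric.sphere (0 : V) 1).eq_empty_or_nonempty with h | h
  · refine ⟨1, one_pos, fun u => ?_⟩
    have hu : u = 0 := by
      by_contra hu
      have : ‖u‖⁻¹ • u ∈ Metric.sphere (0 : V) 1 := by
        rw [mem_sphere_zero_iff_norm, norm_smul, _root_.norm_inv, norm_norm,
          inv_mul_cancel₀ (norm_ne_zero_iff.2 hu)]
      rw [h] at this
      exact this
    simp [hu]
  · obtain ⟨w, hw, hmin⟩ := (isCompact_sphere (0 : V) 1).exists_isMinOn h hc.continuousOn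
    have hw0 : w ≠ 0 := fun h0 => by
      rw [h0, mem_sphere_zero_iff_norm, norm_zero] at hw
      exact zero_ne_one hw
    refine ⟨S.ω (S.J w) w, S.ω_J_pos w hw0, fun u => ?_⟩
    rcases eq_or_ne u 0 with rfl | hu
    · simp
    · have hu' := norm_ne_zero_iff.2 hu
      have h1 : ‖u‖⁻¹ • u ∈ Metric.sphere (0 : V) 1 := by
        rw [mem_sphere_zero_iff_norm, norm_smul, _root_.norm_inv, norm_norm, inv_mul_cancel₀ hu']
      have h2 : S.ω (S.J w) w ≤ S.ω (S.J (‖u‖⁻¹ • u)) (‖u‖⁻¹ • u) := hmin h1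
      simp only [map_smul, _root_.smul_apply, smul_eq_mul] at h2
      calc _ ≤ ‖u‖⁻¹ * (‖u‖⁻¹ * S.ω (S.J u) u) * ‖u‖ ^ 2 := by gcongr
        _ = _ := by field_simp

lemma integrable_exp_neg_sq : Integrable fun u : V => Real.exp (-S.ω (S.J u) u) := by
  obtain ⟨m, hm, hmq⟩ := exists_pos_mul_sq_le S
  let e : V ≃L[ℝ] EuclideanSpace ℝ (Fin (Module.finrank ℝ V)) := toEuclidean
  let E := (e : V →L[ℝ] EuclideanSpace ℝ (Fin (Module.finrank ℝ V)))
  set b : ℝ := m / (‖E‖ ^ 2 + 1)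
  have hb : 0 < b := by positivity
  have h1 : Integrable fun x : EuclideanSpace ℝ (Fin (Module.finrank ℝ V)) =>
      Real.exp (-b * ‖x‖ ^ 2) := by
    have := (GaussianFourier.integrable_cexp_neg_mul_sq_norm_add (b := b) (by simpa using hb) 0
      (0 : EuclideanSpace ℝ (Fin (Module.finrank ℝ V)))).norm
    refine this.congr (.of_forall fun x => ?_)
    simp only [Complex.norm_exp]
    congr 1
    simp
    norm_cast
    simp
  have h2 : (volume : Measure V).map e =
      Measure.addHaarScalarFactor ((volume : Measure V).map e) volume • volume :=
    Measure.isAddLeftInvariant_eq_smul (volume.map e) volume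
  have h3 : Integrable (fun x => Real.exp (-b * ‖x‖ ^ 2)) ((volume : Measure V).map e) := by
    rw [h2, ENNReal.smul_def]; exact h1.smul_measure (by simp)
  have h4 := (e.toHomeomorph.measurableEmbedding.integrable_map_iff).1 h3
  refine h4.mono' (by fun_prop) (.of_forall fun u => ?_)
  rw [Real.norm_of_nonneg (Real.exp_pos _).le]
  refine Real.exp_le_exp.2 ?_
  rw [neg_mul, neg_le_neg_iff]
  refine le_trans ?_ (hmq u)
  have h5 : ‖e u‖ ≤ ‖E‖ * ‖u‖ := E.le_opNorm u
  calc b * ‖e u‖ ^ 2 ≤ b * (‖E‖ * ‖u‖) ^ 2 := by gcongr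
    _ = m * (‖E‖ ^ 2 / (‖E‖ ^ 2 + 1)) * ‖u‖ ^ 2 := by
        simp only [b]; ring
    _ ≤ m * 1 * ‖u‖ ^ 2 := by
        gcongr
        rw [div_le_one (by positivity)]
        linarith
    _ = _ := by ring

lemma lintegral_exp_neg_sq_ne_top :
    ∫⁻ u : V, ENNReal.ofReal (Real.exp (-S.ω (S.J u) u)) ≠ ⊤ := by
  have := (integrable_exp_neg_sq S).lintegral_lt_top
  exact this.ne

lemma lintegral_exp_neg_sq_ne_zero :
    ∫⁻ u : V, ENNReal.ofReal (Real.exp (-S.ω (S.J u) u)) ≠ 0 := by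
  rw [Ne, lintegral_eq_zero_iff (by fun_prop)]
  intro h
  have h2 : ∀ᵐ _ : V, False := by
    filter_upwards [h] with u hu
    simp only [Pi.zero_apply, ENNReal.ofReal_eq_zero] at hu
    exact absurd hu (not_le.2 (Real.exp_pos _))
  simp at h2
  exact NeZero.ne (volume : Measure V) h2

instance : IsFiniteMeasure (gaussian S) := by
  refine ⟨?_⟩
  rw [gaussian, withDensity_apply _ MeasurableSet.univ, setLIntegral_univ]
  exact (lintegral_exp_neg_sq_ne_top S).lt_top

/-- Linear isometries of the hermitian structure preserve the Lebesgue measure. -/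
lemma measurePreserving_of_isometry (L : V ≃L[ℝ] V)
    (hL : ∀ u, S.ω (S.J (L u)) (L u) = S.ω (S.J u) u) :
    MeasurePreserving L (volume : Measure V) volume := by
  refine ⟨L.continuous.measurable, ?_⟩
  set r := Measure.addHaarScalarFactor ((volume : Measure V).map L) volume
  have h2 : (volume : Measure V).map L = r • volume :=
    Measure.isAddLeftInvariant_eq_smul (volume.map L) volume
  -- The Gaussian integral is `L`-invariant, finite and nonzero, so the factor `r` by which `L`
  -- scales Lebesgue measure must be `1`.
  set I := ∫⁻ u : V, ENNReal.ofReal (Real.exp (-S.ω (S.J u) u))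
  have h3 : I = r * I := by
    calc I = ∫⁻ u : V, ENNReal.ofReal (Real.exp (-S.ω (S.J (L u)) (L u))) := by simp only [hL]; rfl
      _ = ∫⁻ u : V, ENNReal.ofReal (Real.exp (-S.ω (S.J u) u)) ∂(volume.map L) := by
          rw [lintegral_map (by fun_prop) L.continuous.measurable]
      _ = r * I := by rw [h2, ENNReal.smul_def, lintegral_smul_measure, smul_eq_mul]
  have h4 : (r : ENNReal) = 1 := by
    have := (ENNReal.mul_left_inj (lintegral_exp_neg_sq_ne_zero S)
      (lintegral_exp_neg_sq_ne_top S)).1 ((one_mul I).trans h3)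
    exact this.symm
  rw [h2, ENNReal.smul_def, h4, one_smul]

/-- The complex line through `u`: `ζ ↦ ζ · u`, where `i` acts by `-J`. -/
noncomputable def line (u : V) : ℂ →L[ℝ] V :=
  Complex.reCLM.smulRight u - Complex.imCLM.smulRight (S.J u)

lemma line_apply (u : V) (ζ : ℂ) : line S u ζ = ζ.re • u - ζ.im • S.J u := rfl

lemma line_zero (u : V) : line S u 0 = 0 := map_zero _

/-- The rotation `u ↦ e^{iθ} u`. -/
noncomputable def rot (θ : ℝ) : V ≃L[ℝ] V :=
  .equivOfInverse (Real.cos θ • .id ℝ V - Real.sin θ • S.J) (Real.cos θ • .id ℝ V + Real.sin θ • S.J)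
    (fun u => by
      simp only [_root_.sub_apply, _root_.add_apply, _root_.smul_apply, ContinuousLinearMap.id_apply,
        map_sub, map_smul, S.J_J]
      have := Real.cos_sq_add_sin_sq θ
      match_scalars <;> linarith)
    (fun u => by
      simp only [_root_.sub_apply, _root_.add_apply, _root_.smul_apply, ContinuousLinearMap.id_apply,
        map_add, map_smul, S.J_J]
      have := Real.cos_sq_add_sin_sq θ
      match_scalars <;> linarith)

lemma rot_apply (θ : ℝ) (u : V) : rot S θ u = Real.cos θ • u - Real.sin θ • S.J u := rfl

lemma rot_sq (θ : ℝ) (u : V) : S.ω (S.J (rot S θ u)) (rot S θ u) = S.ω (S.J u) u := by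
  simp only [rot_apply, map_sub, map_smul, S.J_J, _root_.sub_apply, _root_.smul_apply, smul_eq_mul,
    map_neg, S.ω_self, _root_.neg_apply, S.ω_swap u (S.J u)]
  have := Real.cos_sq_add_sin_sq θ
  linear_combination S.ω (S.J u) u * this

lemma measurePreserving_rot (θ : ℝ) :
    MeasurePreserving (rot S θ) (gaussian S) (gaussian S) := by
  have h := measurePreserving_of_isometry S (rot S θ) (rot_sq S θ)
  refine ⟨h.measurable, Measure.ext fun s hs => ?_⟩
  rw [Measure.map_apply h.measurable hs, gaussian, withDensity_apply _ (h.measurable hs),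
    withDensity_apply _ hs, ← h.setLIntegral_comp_preimage hs (by fun_prop)]
  simp only [rot_sq]

/-- A holomorphic function restricted to a complex line. -/
lemma IsHolomorphic.hasDerivAt_line {F : V → ℂ} (hF : IsHolomorphic S F) (w u : V) (ζ : ℂ) :
    HasDerivAt (fun ζ => F (w + line S u ζ)) (fderiv ℝ F (w + line S u ζ) u) ζ := by
  have h1 : HasFDerivAt (fun ζ => F (w + line S u ζ))
      ((fderiv ℝ F (w + line S u ζ)).comp (line S u)) ζ :=
    (hF.1 _).hasFDerivAt.comp ζ ((line S u).hasFDerivAt.const_add w)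
  refine (hasFDerivAt_of_restrictScalars ℝ h1 (f' :=
    (ContinuousLinearMap.id ℂ ℂ).smulRight (fderiv ℝ F (w + line S u ζ) u)) ?_)
  ext z
  have := hF.2 (w + line S u ζ) u
  simp only [map_neg] at this
  generalize fderiv ℝ F (w + line S u ζ) = D at this ⊢
  simp [line_apply]
  linear_combination D u * (Complex.re_add_im z).symm - z.im * this

/-- The Gaussian measure is invariant under `u ↦ e^(iθ) u`, so `F` may be replaced by its average
over circles. On each complex line the one-variable mean value property makes that average `F 0`. -/
lemma IsHolomorphic.mean_value {F : V → ℂ} (hF : IsHolomorphic S F) (hi : Integrable F (gaussian S)) :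
    ∫ u, F u ∂gaussian S = (gaussian S).real Set.univ • F 0 := by
  have hcirc : ∀ u, ∫ θ in (0 : ℝ)..2 * Real.pi, F (rot S θ u) = (2 * Real.pi) • F 0 := fun u => by
    have hd : Differentiable ℂ fun ζ => F (0 + line S u ζ) := fun ζ =>
      (hF.hasDerivAt_line S 0 u ζ).differentiableAt
    have h1 := hd.diffContOnCl (s := Metric.ball (0 : ℂ) |1|) |>.circleAverage
    rw [Real.circleAverage_def] at h1
    rw [line_zero, zero_add] at h1
    rw [← h1, smul_smul, mul_inv_cancel₀ (by positivity), one_smul]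
    refine intervalIntegral.integral_congr fun θ _ => ?_
    simp [circleMap, line_apply, rot_apply, Complex.exp_ofReal_mul_I_re,
      Complex.exp_ofReal_mul_I_im]
  have hp : (0 : ℝ) ≤ 2 * Real.pi := by positivity
  have hmp : MeasurePreserving (fun p : ℝ × V => (p.1, rot S p.1 p.2))
      ((volume.restrict (Set.Ioc 0 (2 * Real.pi))).prod (gaussian S))
      ((volume.restrict (Set.Ioc 0 (2 * Real.pi))).prod (gaussian S)) :=
    (MeasurePreserving.id _).skew_product (g := fun θ u => rot S θ u)
      (by
        have : Continuous fun p : ℝ × V => rot S p.1 p.2 := by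
          simp only [rot_apply]; fun_prop
        exact this.measurable)
      (.of_forall fun θ => (measurePreserving_rot S θ).map_eq)
  have hi2 : Integrable (fun p : ℝ × V => F (rot S p.1 p.2))
      ((volume.restrict (Set.Ioc 0 (2 * Real.pi))).prod (gaussian S)) :=
    hmp.integrable_comp_of_integrable (hi.comp_snd _)
  have h2 : ∫ θ in (0 : ℝ)..2 * Real.pi, ∫ u, F (rot S θ u) ∂gaussian S =
      ∫ u, (∫ θ in (0 : ℝ)..2 * Real.pi, F (rot S θ u)) ∂gaussian S := by
    simp only [intervalIntegral.integral_of_le hp]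
    exact integral_integral_swap (f := fun θ u => F (rot S θ u)) hi2
  have h3 : ∀ θ, ∫ u, F (rot S θ u) ∂gaussian S = ∫ u, F u ∂gaussian S := fun θ =>
    (measurePreserving_rot S θ).integral_comp (rot S θ).toHomeomorph.measurableEmbedding F
  simp only [h3, hcirc, intervalIntegral.integral_const, integral_const, sub_zero] at h2
  rw [smul_comm] at h2
  exact smul_right_injective ℂ (by positivity : (2 * Real.pi) ≠ 0) h2

/-! ### Point evaluations, Cauchy estimates and completeness of the Fock space. -/

namespace BargmannFock

lemma norm_eq_toL2 (F : BargmannFock S) : ‖F‖ = ‖toL2 S F‖ := rfl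

/-- The vacuum vector. -/
def vacuum : BargmannFock S :=
  ⟨fun _ => 1, ⟨differentiable_const 1, fun u h => by simp⟩, memLp_const 1⟩

lemma vacuum_fn (u : V) : (vacuum S).fn u = 1 := rfl

lemma fn_add (F G : BargmannFock S) (u : V) : (F + G).fn u = F.fn u + G.fn u := rfl

lemma fn_smul (c : ℂ) (F : BargmannFock S) (u : V) : (c • F).fn u = c * F.fn u := rfl

variable {S}

lemma ext_fn {F G : BargmannFock S} (h : ∀ u, F.fn u = G.fn u) : F = G := Subtype.ext (funext h)

lemma isHolomorphic (F : BargmannFock S) : IsHolomorphic S F.fn := F.2.1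

lemma memLp (F : BargmannFock S) : MemLp F.fn 2 (gaussian S) := F.2.2

lemma continuous_fn (F : BargmannFock S) : Continuous F.fn := F.isHolomorphic.1.continuous

lemma vacuum_ne_zero : vacuum S ≠ 0 := fun h => by
  have : (vacuum S).fn 0 = (0 : BargmannFock S).fn 0 := by rw [h]
  exact one_ne_zero this

/-- The mean value property says that the vacuum is, up to a factor, the reproducing kernel at the
origin; the factor is found by taking `F` to be the vacuum. -/
lemma inner_vacuum (F : BargmannFock S) :
    inner ℂ (vacuum S) F = ((‖vacuum S‖ ^ 2 : ℝ) : ℂ) * F.fn 0 := by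
  have h1 : ∀ G : BargmannFock S,
      inner ℂ (vacuum S) G = (gaussian S).real Set.univ • G.fn 0 := fun G => by
    rw [inner_eq, ← G.isHolomorphic.mean_value S (G.memLp.integrable (by norm_num))]
    simp [vacuum_fn]
  have h2 := h1 (vacuum S)
  rw [inner_self_eq_norm_sq_to_K, vacuum_fn] at h2
  rw [h1 F, Complex.real_smul]
  congr 1
  simp at h2
  simp [h2]

lemma norm_fn_zero_le (F : BargmannFock S) : ‖F.fn 0‖ ≤ ‖vacuum S‖⁻¹ * ‖F‖ := by
  have h0 : 0 < ‖vacuum S‖ := norm_pos_iff.2 vacuum_ne_zero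
  have h := norm_inner_le_norm (𝕜 := ℂ) (vacuum S) F
  rw [inner_vacuum, norm_mul, Complex.norm_real, Real.norm_of_nonneg (by positivity), sq,
    mul_assoc] at h
  have h2 := le_of_mul_le_mul_left h h0
  rw [inv_mul_eq_div, le_div_iff₀ h0, mul_comm]
  exact h2

/-- The isometry `π(Ju, 0)` with `c = 1` carries the value at `u` to the value at the origin, at the
cost of its Gaussian factor. -/
lemma norm_fn_le (F : BargmannFock S) (u : V) :
    ‖F.fn u‖ ≤ Real.exp (S.ω (S.J u) u / 2) * (‖vacuum S‖⁻¹ * ‖F‖) := by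
  have h := norm_fn_zero_le (rep S 1 (S.J u, 0) F)
  rw [LinearIsometry.norm_map] at h
  have e : (rep S 1 (S.J u, 0) F).fn 0 = Complex.exp ((-(S.ω (S.J u) u / 2) : ℝ)) * F.fn u := by
    change repFactor S 1 (S.J u, 0) 0 * F.fn (0 - (1 : ℝ) • S.J (S.J u)) = _
    rw [S.J_J, one_smul, sub_neg_eq_add, zero_add, repFactor, S.ω_J_J]
    congr 2
    simp
    ring
  rw [e, norm_mul, Complex.norm_exp_ofReal, Real.exp_neg, inv_mul_eq_div,
    div_le_iff₀ (Real.exp_pos _), mul_comm] at h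
  exact h

/-- Evaluation at a point. -/
noncomputable def eval (u : V) : BargmannFock S →L[ℂ] ℂ :=
  LinearMap.mkContinuous
    { toFun := fun F => F.fn u
      map_add' := fun _ _ => rfl
      map_smul' := fun _ _ => rfl }
    (Real.exp (S.ω (S.J u) u / 2) * ‖vacuum S‖⁻¹)
    fun F => by rw [mul_assoc]; exact norm_fn_le F u

lemma eval_apply (u : V) (F : BargmannFock S) : eval u F = F.fn u := rfl

/-- Cauchy estimates on balls. -/
lemma exists_norm_fderiv_le (r : ℝ) : ∃ C, 0 ≤ C ∧ ∀ (F : BargmannFock S) (u : V), ‖u‖ ≤ r →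
    ‖fderiv ℝ F.fn u‖ ≤ C * ‖F‖ := by
  -- The unit circle in the complex line through `u` in a unit direction stays in the ball of radius
  -- `R`, where the pointwise bound is uniform.
  set R := |r| + (1 + ‖S.J‖)
  set C := Real.exp (‖S.ω‖ * ‖S.J‖ * R ^ 2 / 2) * ‖vacuum S‖⁻¹
  have hC : 0 ≤ C := by positivity
  refine ⟨C, hC, fun F u hu => ?_⟩
  refine ContinuousLinearMap.opNorm_le_of_unit_norm (by positivity) fun h hh => ?_
  have hd : Differentiable ℂ fun ζ => F.fn (u + line S h ζ) := fun ζ =>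
    (F.isHolomorphic.hasDerivAt_line S u h ζ).differentiableAt
  have h1 := Complex.norm_deriv_le_of_forall_mem_sphere_norm_le (c := 0) (R := 1) (C := C * ‖F‖)
    one_pos (hd.diffContOnCl (s := Metric.ball (0 : ℂ) 1)) fun ζ hζ => by
      have hζ1 : ‖ζ‖ = 1 := by simpa using hζ
      set w := u + line S h ζ
      have hw : ‖w‖ ≤ R := by
        refine (norm_add_le _ _).trans (add_le_add (hu.trans (le_abs_self r)) ?_)
        rw [line_apply]
        refine (norm_sub_le _ _).trans (add_le_add ?_ ?_)
        · rw [norm_smul, hh, mul_one, ← hζ1]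
          exact Complex.abs_re_le_norm ζ
        · rw [norm_smul]
          have h2 : ‖S.J h‖ ≤ ‖S.J‖ := (S.J.le_opNorm h).trans_eq (by rw [hh, mul_one])
          have h3 : ‖ζ.im‖ ≤ 1 := (Complex.abs_im_le_norm ζ).trans_eq hζ1
          calc _ ≤ 1 * ‖S.J‖ := mul_le_mul h3 h2 (norm_nonneg _) zero_le_one
            _ = _ := one_mul _
      refine (norm_fn_le F w).trans ?_
      rw [← mul_assoc]
      have hq : S.ω (S.J w) w ≤ ‖S.ω‖ * ‖S.J‖ * R ^ 2 := by
        refine (le_abs_self _).trans ((S.ω.le_opNorm₂ _ _).trans ?_)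
        calc ‖S.ω‖ * ‖S.J w‖ * ‖w‖ ≤ ‖S.ω‖ * (‖S.J‖ * R) * R := by
              gcongr
              exact (S.J.le_opNorm w).trans (by gcongr)
          _ = _ := by ring
      refine mul_le_mul_of_nonneg_right ?_ (norm_nonneg _)
      exact mul_le_mul_of_nonneg_right (Real.exp_le_exp.2 (by linarith)) (by positivity)
  rw [(F.isHolomorphic.hasDerivAt_line S u h 0).deriv, line_zero, add_zero, div_one] at h1
  exact h1

/-- A Cauchy sequence converges pointwise, and by the Cauchy estimates its derivatives converge
uniformly on balls, so the pointwise limit is holomorphic. It agrees with the L² limit because a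
subsequence converges to the latter almost everywhere. -/
instance : CompleteSpace (BargmannFock S) := by
  refine Metric.complete_of_cauchySeq_tendsto fun F hF => ?_
  have hev : ∀ u, ∃ y, Tendsto (fun n => (F n).fn u) atTop (𝓝 y) := fun u =>
    cauchySeq_tendsto_of_complete ((eval u).uniformContinuous.comp_cauchySeq hF)
  choose G hG using hev
  have hUC : ∀ r, UniformCauchySeqOn (fun n => fderiv ℝ (F n).fn) atTop (Metric.ball (0 : V) r) := by
    intro r
    obtain ⟨C, hC0, hC⟩ := exists_norm_fderiv_le (S := S) r
    rw [Metric.uniformCauchySeqOn_iff]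
    intro ε hε
    obtain ⟨N, hN⟩ := Metric.cauchySeq_iff.1 hF (ε / (C + 1)) (by positivity)
    refine ⟨N, fun m hm n hn u hu => ?_⟩
    have h1 := hC (F m - F n) u (by simpa using (mem_ball_zero_iff.1 hu).le)
    have h2 : fderiv ℝ (F m - F n).fn u = fderiv ℝ (F m).fn u - fderiv ℝ (F n).fn u :=
      fderiv_sub ((F m).isHolomorphic.1 u) ((F n).isHolomorphic.1 u)
    rw [dist_eq_norm, ← h2]
    refine h1.trans_lt ?_
    have h3 := hN m hm n hn
    rw [dist_eq_norm, lt_div_iff₀ (by positivity)] at h3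
    nlinarith [norm_nonneg (F m - F n)]
  have hD : ∀ u, ∃ D, Tendsto (fun n => fderiv ℝ (F n).fn u) atTop (𝓝 D) := fun u =>
    cauchySeq_tendsto_of_complete ((hUC (‖u‖ + 1)).cauchySeq (by simp))
  choose D hD using hD
  have hder : ∀ u, HasFDerivAt G (D u) u := fun u =>
    hasFDerivAt_of_tendstoUniformlyOn (l := atTop) (s := Metric.ball (0 : V) (‖u‖ + 1))
      Metric.isOpen_ball ((hUC (‖u‖ + 1)).tendstoUniformlyOn_of_tendsto fun x _ => hD x)
      (fun n x _ => ((F n).isHolomorphic.1 x).hasFDerivAt) (fun x _ => hG x) (by simp)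
  have hhol : IsHolomorphic S G := by
    refine ⟨fun u => (hder u).differentiableAt, fun u h => ?_⟩
    rw [(hder u).fderiv]
    have h1 : ∀ v, Tendsto (fun n => fderiv ℝ (F n).fn u v) atTop (𝓝 (D u v)) := fun v =>
      ((ContinuousLinearMap.apply ℝ ℂ v).continuous.tendsto _).comp (hD u)
    refine tendsto_nhds_unique (h1 _) (((h1 h).const_mul Complex.I).congr fun n => ?_)
    exact ((F n).isHolomorphic.2 u h).symm
  have hF2 : CauchySeq fun n => toL2 S (F n) := by
    rw [Metric.cauchySeq_iff] at hF ⊢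
    intro ε hε
    obtain ⟨N, hN⟩ := hF ε hε
    refine ⟨N, fun m hm n hn => ?_⟩
    have := hN m hm n hn
    rwa [dist_eq_norm, norm_eq_toL2, map_sub, ← dist_eq_norm] at this
  obtain ⟨f, hf⟩ := cauchySeq_tendsto_of_complete hF2
  have hfG : f =ᵐ[gaussian S] G := by
    obtain ⟨φ, hφ, hφf⟩ := (tendstoInMeasure_of_tendsto_Lp hf).exists_seq_tendsto_ae
    have h1 : ∀ᵐ u ∂gaussian S, ∀ n, toL2 S (F n) u = (F n).fn u :=
      ae_all_iff.2 fun n => (F n).memLp.coeFn_toLp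
    filter_upwards [hφf, h1] with u hu hu1
    refine tendsto_nhds_unique hu (((hG u).comp hφ.tendsto_atTop).congr fun n => ?_)
    exact (hu1 _).symm
  have hG2 : MemLp G 2 (gaussian S) := (Lp.memLp f).ae_eq hfG
  let G' : BargmannFock S := ⟨G, hhol, hG2⟩
  refine ⟨G', ?_⟩
  have h2 : toL2 S G' = f := by
    refine Lp.ext (Filter.EventuallyEq.trans ?_ hfG.symm)
    exact hG2.coeFn_toLp
  rw [tendsto_iff_norm_sub_tendsto_zero] at hf ⊢
  refine hf.congr fun n => ?_
  rw [norm_eq_toL2, map_sub, h2]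

end BargmannFock
end Fock

/-! ### The Bargmann–Fock representation as a unitary representation -/

section Rep

open Filter Topology

variable {V : Type*} [NormedAddCommGroup V] [NormedSpace ℝ V] [FiniteDimensional ℝ V]
  [MeasureSpace V] [BorelSpace V] [(volume : Measure V).IsAddHaarMeasure]
  (S : AdaptedSymplectic V) (c : ℝ)

lemma rep_fn (g : V × ℝ) (F : BargmannFock S) (u : V) :
    (rep S c g F).fn u = repFactor S c g u * F.fn (u - c • S.J g.1) := rfl

lemma continuous_repFactor (u : V) : Continuous fun g : V × ℝ => repFactor S c g u := by
  unfold repFactor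
  fun_prop

lemma continuous_rep_fn (F : BargmannFock S) (u : V) :
    Continuous fun g : V × ℝ => (rep S c g F).fn u := by
  simp only [rep_fn]
  exact (continuous_repFactor S c u).mul (F.continuous_fn.comp (by fun_prop))

/-- Continuity is visible when `G` is a reproducing kernel, since the coefficient is then a value of
`π(g) F`. Such vectors span a dense subspace, and isometry of `π(g)` makes the approximation of `G`
uniform in `g`. -/
lemma continuous_inner_rep (F G : BargmannFock S) :
    Continuous fun g : V × ℝ => inner ℂ G (rep S c g F) := by
  let D : Submodule ℂ (BargmannFock S) :=
    { carrier := {G | Continuous fun g : V × ℝ => inner ℂ G (rep S c g F)}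
      add_mem' := fun {G G'} h h' => by
        simp only [Set.mem_ofPred_eq, inner_add_left] at *
        exact h.add h'
      zero_mem' := by simp only [Set.mem_ofPred_eq, inner_zero_left]; exact continuous_const
      smul_mem' := fun a G h => by
        simp only [Set.mem_ofPred_eq, inner_smul_left] at *
        exact h.const_mul _ }
  have hD : D.topologicalClosure = ⊤ := by
    rw [Submodule.topologicalClosure_eq_top_iff, Submodule.eq_bot_iff]
    intro G hG
    refine BargmannFock.ext_fn fun u => ?_
    let K : BargmannFock S := (InnerProductSpace.toDual ℂ _).symm (BargmannFock.eval u)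
    have hK : ∀ F, inner ℂ K F = F.fn u := fun F => InnerProductSpace.toDual_symm_apply
    have hKD : K ∈ D := by
      change Continuous fun g : V × ℝ => inner ℂ K (rep S c g F)
      simp only [hK]
      exact continuous_rep_fn S c F u
    rw [← hK G, (Submodule.mem_orthogonal D G).1 hG K hKD]
    rfl
  have hG : G ∈ closure (D : Set (BargmannFock S)) := by
    rw [← Submodule.topologicalClosure_coe, hD]
    trivial
  refine continuous_of_uniform_approx_of_continuous fun U hU => ?_
  obtain ⟨ε, hε, hεU⟩ := Metric.mem_uniformity_dist.1 hU
  obtain ⟨G', hG', hd⟩ := Metric.mem_closure_iff.1 hG (ε / (‖F‖ + 1)) (by positivity)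
  refine ⟨_, hG', fun g => hεU ?_⟩
  rw [dist_eq_norm, ← inner_sub_left]
  refine (norm_inner_le_norm _ _).trans_lt ?_
  rw [LinearIsometry.norm_map, ← dist_eq_norm]
  rw [lt_div_iff₀ (by positivity)] at hd
  nlinarith [dist_nonneg (x := G) (y := G')]

/-- For isometries weak continuity implies strong continuity, since `‖π(g)F - π(g₀)F‖² = 2‖F‖² - 2
Re ⟨π(g₀)F, π(g)F⟩`. -/
lemma continuous_rep (F : BargmannFock S) : Continuous fun g : V × ℝ => rep S c g F := by
  rw [continuous_iff_continuousAt]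
  intro g₀
  rw [ContinuousAt, tendsto_iff_norm_sub_tendsto_zero]
  have h1 : Tendsto (fun g => ‖rep S c g F - rep S c g₀ F‖ ^ 2) (𝓝 g₀) (𝓝 0) := by
    have h2 : ∀ g, ‖rep S c g F - rep S c g₀ F‖ ^ 2 =
        2 * ‖F‖ ^ 2 - 2 * (inner ℂ (rep S c g₀ F) (rep S c g F)).re := fun g => by
      rw [norm_sub_rev, norm_sub_sq (𝕜 := ℂ), LinearIsometry.norm_map, LinearIsometry.norm_map]
      simp only [RCLike.re_to_complex]
      ring
    simp only [h2]
    have h3 : Continuous fun g : V × ℝ =>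
        2 * ‖F‖ ^ 2 - 2 * (inner ℂ (rep S c g₀ F) (rep S c g F)).re :=
      continuous_const.sub ((Complex.continuous_re.comp
        (continuous_inner_rep S c F (rep S c g₀ F))).const_mul 2)
    refine (h3.tendsto g₀).trans_eq ?_
    rw [inner_self_eq_norm_sq_to_K, LinearIsometry.norm_map]
    have : (((‖F‖ : ℂ)) ^ 2).re = ‖F‖ ^ 2 := by norm_cast
    congr 1
    exact sub_eq_zero.2 (congrArg _ this.symm)
  have h4 := (Real.continuous_sqrt.tendsto 0).comp h1
  rw [Real.sqrt_zero] at h4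
  exact h4.congr fun g => Real.sqrt_sq (norm_nonneg _)

/-- The Bargmann–Fock representation. -/
noncomputable def bf : UnitaryRep S (BargmannFock S) where
  op := rep S c
  op_zero := rep_zero S c
  op_mul := rep_mul S c
  cont := continuous_rep S c

lemma bf_op (g : V × ℝ) : (bf S c).op g = rep S c g := rfl

lemma repIntegral_eq {f : V × ℝ → ℂ} (hf : Integrable f) (F : BargmannFock S) :
    repIntegral S c f F = (bf S c).integ f F := ((bf S c).integ_apply hf F).symm

lemma integ_bf_fn {f : V × ℝ → ℂ} (hf : Integrable f) (F : BargmannFock S) (u : V) :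
    ((bf S c).integ f F).fn u = ∫ g, f g * (rep S c g F).fn u := by
  rw [UnitaryRep.integ_apply _ hf, ← BargmannFock.eval_apply,
    ← ContinuousLinearMap.integral_comp_comm _ ((bf S c).integrable_smul hf F)]
  rfl

/-- All the representations with `c > 0` are dilates of one another, so homogeneity of the kernel
can remove the dependence on `c`. -/
lemma rep_dilation (s : ℝ) (hs : 0 < s) (g : V × ℝ) :
    rep S c (dilation s hs g) = rep S (c * s) g := by
  ext1 F
  refine BargmannFock.ext_fn fun u => ?_
  rw [rep_fn, rep_fn, dilation_apply]
  congr 1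
  · unfold repFactor
    simp
    ring_nf
  · simp [smul_smul]

lemma rep_central (t : ℝ) (F : BargmannFock S) :
    rep S c (0, t) F = Complex.exp (2 * Complex.I * c ^ 2 * t) • F := by
  refine BargmannFock.ext_fn fun u => ?_
  rw [rep_fn, BargmannFock.fn_smul, repFactor]
  simp

/-- Approximate identities. -/
lemma UnitaryRep.exists_norm_integ_sub_lt {H : Type*} [NormedAddCommGroup H]
    [InnerProductSpace ℂ H] [CompleteSpace H] (ρ : UnitaryRep S H) (F : H) {ε : ℝ} (hε : 0 < ε) :
    ∃ φ : Test V, ‖ρ.integ φ F - F‖ < ε := by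
  obtain ⟨δ, hδ, hδF⟩ := Metric.continuous_iff.1 (ρ.cont F) 0 (ε / 2) (by positivity)
  let b : ContDiffBump (0 : V × ℝ) := ⟨δ / 2, δ, by positivity, by linarith⟩
  let φ : Test V :=
    { toFun := fun g => (b.normed volume g : ℂ)
      contDiff' := Complex.ofRealCLM.contDiff.comp b.contDiff_normed
      hasCompactSupport' := b.hasCompactSupport_normed.comp_left (g := ((↑) : ℝ → ℂ)) rfl
      tsupport_subset' := by simp }
  have hφ : ∀ g, φ g = (b.normed volume g : ℂ) := fun _ => rfl
  have h1 : ∫ g, φ g = 1 := by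
    simp only [hφ]
    rw [integral_complex_ofReal, b.integral_normed, Complex.ofReal_one]
  refine ⟨φ, ?_⟩
  have h2 : ρ.integ φ F - F = ∫ g, φ g • (ρ.op g F - F) := by
    simp only [smul_sub]
    rw [integral_sub (ρ.integrable_smul φ.integrable' F) (φ.integrable'.smul_const F),
      integral_smul_const, h1, one_smul, integ_apply _ φ.integrable']
  have h3 : ‖∫ g, φ g • (ρ.op g F - F)‖ ≤ ∫ g, b.normed volume g * (ε / 2) := by
    refine norm_integral_le_of_norm_le (b.integrable_normed.mul_const _) (.of_forall fun g => ?_)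
    rw [norm_smul, hφ, Complex.norm_real, Real.norm_of_nonneg (b.nonneg_normed g)]
    by_cases hg : g ∈ Metric.ball (0 : V × ℝ) δ
    · refine mul_le_mul_of_nonneg_left ?_ (b.nonneg_normed g)
      have := hδF g hg
      rw [ρ.op_zero, dist_eq_norm] at this
      exact this.le
    · have : b.normed volume g = 0 := by
        by_contra h
        have h4 : g ∈ Function.support (b.normed volume) := h
        rw [b.support_normed_eq] at h4
        exact hg h4
      simp [this]
  rw [integral_mul_const, b.integral_normed, one_mul] at h3
  rw [h2]
  exact h3.trans_lt (by linarith)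

/-- The central character is nontrivial, so a central translation can act on the Fock space by `-1`.
Half the difference of an approximate identity and this translate has mean zero and yet the same
image under `π`. -/
lemma exists_norm_integ_bf_sub_lt (hc : c ≠ 0) (F : BargmannFock S) {ε : ℝ} (hε : 0 < ε) :
    ∃ φ : Test V, ∫ g, φ g = 0 ∧ ‖(bf S c).integ φ F - F‖ < ε := by
  obtain ⟨φ, hφ⟩ := (bf S c).exists_norm_integ_sub_lt S F hε
  -- Chosen so that the central element `(0, τ)` acts by `exp (2 i c² τ) = exp (iπ) = -1`.
  set τ : ℝ := Real.pi / (2 * c ^ 2)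
  have hi := φ.integrable'.comp_mulG S (inv (0, τ))
  have hi' : Integrable (φ.translate S (0, τ)) := hi
  have hd : Integrable fun g => φ g - φ (mul S (inv (0, τ)) g) := φ.integrable'.sub hi
  set φ' : Test V := (1 / 2 : ℂ) • (φ - φ.translate S (0, τ)) with hφ'
  refine ⟨φ', ?_, ?_⟩
  · change ∫ g, (1 / 2 : ℂ) • (φ g - φ.translate S (0, τ) g) = 0
    rw [integral_smul, integral_sub φ.integrable' hi']
    simp only [Test.translate_apply]
    rw [integral_mul_left, sub_self, smul_zero]
  · have h1 : (bf S c).integ φ' F =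
        (1 / 2 : ℂ) • ((bf S c).integ φ F - (bf S c).op (0, τ) ((bf S c).integ φ F)) := by
      rw [UnitaryRep.op_integ _ φ.integrable', ← _root_.sub_apply,
        ← UnitaryRep.integ_sub _ φ.integrable' hi,
        UnitaryRep.integ_apply _ φ'.integrable',
        UnitaryRep.integ_apply _ hd, ← integral_smul]
      refine integral_congr_ae (.of_forall fun g => ?_)
      simp only [smul_smul]
      rfl
    have h2 : Complex.exp (2 * Complex.I * c ^ 2 * τ) = -1 := by
      rw [← Complex.exp_pi_mul_I]
      congr 1
      simp only [τ]
      push_cast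
      have : (c : ℂ) ≠ 0 := by exact_mod_cast hc
      field_simp
    rw [h1, bf_op, rep_central, h2, neg_one_smul, sub_neg_eq_add, ← two_smul ℂ, smul_smul]
    norm_num
    exact hφ

variable {S c}

lemma IsRepresentedBy.unique (hc : c ≠ 0) {k : Distr V} {A B : BargmannFock S →L[ℂ] BargmannFock S}
    (hA : IsRepresentedBy S c k A) (hB : IsRepresentedBy S c k B) : A = B := by
  ext1 F
  have h : F ∈ closure {F | A F = B F} := by
    rw [Metric.mem_closure_iff]
    intro ε hε
    obtain ⟨φ, hφ, hd⟩ := exists_norm_integ_bf_sub_lt S c hc F hε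
    refine ⟨_, ?_, (dist_comm _ _).trans_lt ((dist_eq_norm _ _).trans_lt hd)⟩
    rw [Set.mem_ofPred_eq, ← repIntegral_eq S c φ.integrable', hA φ hφ, hB φ hφ]
  rwa [(isClosed_eq A.continuous B.continuous).closure_eq] at h

variable (S c) in
lemma Distr.HasKernel.isRepresentedBy {k : Distr V} {κ : Kernel V} (h : k.HasKernel κ) :
    IsRepresentedBy S c k ((bf S c).mult κ) := fun φ hφ F => by
  have h1 := h.isConv S φ
  rw [repIntegral_eq S c φ.integrable', (bf S c).mult_integ h1 hφ,
    repIntegral_eq S c (h1.integrable S hφ)]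

lemma Distr.IsHomogeneous.op {k : Distr V} {d : ℝ} (h : k.IsHomogeneous d) :
    k.op.IsHomogeneous d := fun s hs φ => by
  change k (φ.dilate s hs).op = _ * k φ.op
  rw [← h s hs]
  congr 1
  exact TestFunction.ext fun g => congrArg φ (opMap_dilation s hs g).symm

variable (S) in
-- In degree `-Q` the pairing with `k` is invariant under dilations, and dilations are
-- automorphisms; hence convolution by `k` commutes with them.
lemma conv_dilate {k : Distr V} (hhom : k.IsHomogeneous (-(homDim V : ℝ))) (s : ℝ) (hs : 0 < s)
    (φ : Test V) (g : V × ℝ) : conv S k (φ.dilate s hs) g = conv S k φ (dilation s hs g) := by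
  have h1 := hhom s hs (φ.comp (invMulHomeo S (dilation s hs g)) (contDiff_invMulHomeo S _))
  rw [sub_self, Real.rpow_zero, Complex.ofReal_one, one_mul] at h1
  rw [conv, conv, ← h1]
  congr 1
  refine TestFunction.ext fun h => ?_
  change φ (dilation s hs (mul S (inv h) g)) = φ (mul S (inv (dilation s hs h)) (dilation s hs g))
  rw [dilation_mul, dilation_inv]

variable (S c) in
lemma repIntegral_mul (s : ℝ) (hs : 0 < s) (f : V × ℝ → ℂ) (F : BargmannFock S) :
    repIntegral S (c * s) f F = (s ^ homDim V)⁻¹ •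
      repIntegral S c (fun g => f (dilation s⁻¹ (inv_pos.2 hs) g)) F := by
  rw [repIntegral, repIntegral, ← integral_dilation s hs]
  refine integral_congr_ae (.of_forall fun g => ?_)
  have : dilation s⁻¹ (inv_pos.2 hs) (dilation s hs g) = g := by
    rw [dilation_apply, dilation_apply]
    ext <;> simp [hs.ne']
  simp only [this, rep_dilation]

/-- Passing from `c` to `c * s` replaces `φ` and `k ∗ φ` by the same dilate and the same Jacobian
factor, so the operator that represents `k` is unchanged. -/
lemma IsRepresentedBy.scale {k : Distr V} (hhom : k.IsHomogeneous (-(homDim V : ℝ)))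
    {A : BargmannFock S →L[ℂ] BargmannFock S} (hA : IsRepresentedBy S c k A) (s : ℝ) (hs : 0 < s) :
    IsRepresentedBy S (c * s) k A := fun φ hφ F => by
  rw [repIntegral_mul S c s hs, repIntegral_mul S c s hs, ← Complex.coe_smul, map_smul]
  have h1 := hA (φ.dilate s⁻¹ (inv_pos.2 hs)) (by
    simp only [Test.dilate_apply]
    rw [integral_dilation, hφ, smul_zero]) F
  have e : conv S k (φ.dilate s⁻¹ (inv_pos.2 hs)) =
      fun g => conv S k φ (dilation s⁻¹ (inv_pos.2 hs) g) := funext fun g => conv_dilate S hhom _ _ φ g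
  rw [e] at h1
  exact congrArg _ h1

/-- `π(k)` does not depend on `c > 0`. -/
lemma Distr.HasKernel.mult_bf_eq {k : Distr V} {κ : Kernel V} (h : k.HasKernel κ)
    (hhom : k.IsHomogeneous (-(homDim V : ℝ))) {c' : ℝ} (hc : 0 < c) (hc' : 0 < c') :
    (bf S c').mult κ = (bf S c).mult κ := by
  have h1 := (h.isRepresentedBy S c).scale hhom (c' / c) (div_pos hc' hc)
  rw [mul_div_cancel₀ _ hc.ne'] at h1
  exact (h.isRepresentedBy S c').unique hc'.ne' h1

end Rep

/-! ### The regular representation -/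

section Regular

open Filter Topology

lemma enorm_sq_eq_lintegral {α : Type*} [MeasurableSpace α] {μ : Measure α} (F : Lp ℂ 2 μ) :
    ‖F‖ₑ ^ 2 = ∫⁻ x, ‖F x‖ₑ ^ 2 ∂μ := by
  rw [Lp.enorm_def, eLpNorm_eq_lintegral_rpow_enorm_toReal (by simp) (by simp),
    ← ENNReal.rpow_natCast, ← ENNReal.rpow_mul]
  simp

lemma enorm_sq_toLp {α : Type*} [MeasurableSpace α] {μ : Measure α} {f : α → ℂ}
    (hf : MemLp f 2 μ) : ‖hf.toLp f‖ₑ ^ 2 = ∫⁻ x, ‖f x‖ₑ ^ 2 ∂μ := by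
  rw [enorm_sq_eq_lintegral]
  refine lintegral_congr_ae ?_
  filter_upwards [hf.coeFn_toLp] with x hx
  rw [hx]

variable {V : Type*} [NormedAddCommGroup V] [NormedSpace ℝ V] [FiniteDimensional ℝ V]
  [MeasureSpace V] [BorelSpace V] [(volume : Measure V).IsAddHaarMeasure]
  (S : AdaptedSymplectic V)

/-- A test function as an element of `L²(G)`. -/
noncomputable abbrev Test.toL2 (φ : Test V) : Lp ℂ 2 (volume : Measure (V × ℝ)) := φ.memLp.toLp φ

lemma Test.toL2_sub (φ ψ : Test V) : (φ - ψ).toL2 = φ.toL2 - ψ.toL2 := rfl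

lemma Test.toL2_smul (a : ℂ) (φ : Test V) : (a • φ).toL2 = a • φ.toL2 := rfl

lemma Test.norm_toL2_sq (φ : Test V) : ‖φ.toL2‖ ^ 2 = ∫ g, ‖φ g‖ ^ 2 := by
  have hi : Integrable fun g => ‖φ g‖ ^ 2 := φ.memLp.integrable_norm_pow (by norm_num)
  have h := enorm_sq_toLp φ.memLp
  have h2 := ofReal_integral_eq_lintegral_ofReal hi (.of_forall fun g => by positivity)
  have h3 : ∀ g, ENNReal.ofReal (‖φ g‖ ^ 2) = ‖φ g‖ₑ ^ 2 := fun g => by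
    rw [ENNReal.ofReal_pow (norm_nonneg _), ofReal_norm]
  simp only [h3] at h2
  rw [← h2, ← ofReal_norm, ← ENNReal.ofReal_pow (norm_nonneg _)] at h
  exact (ENNReal.ofReal_eq_ofReal_iff (by positivity) (by positivity)).1 h

/-- Test functions are dense in `L²(G)`. -/
lemma exists_norm_toL2_sub_lt' (F : Lp ℂ 2 (volume : Measure (V × ℝ))) {ε : ℝ} (hε : 0 < ε) :
    ∃ φ : Test V, ‖φ.toL2 - F‖ < ε := by
  obtain ⟨f, ⟨g, hfg, hg, hgs⟩, hd⟩ := Metric.mem_closure_iff.1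
    (Lp.dense_hasCompactSupport_contDiff (F := ℂ) (μ := (volume : Measure (V × ℝ))) (p := 2)
      (by simp) F) ε hε
  let φ : Test V := ⟨g, hgs, hg, by simp⟩
  have : φ.toL2 = f := Lp.ext (φ.memLp.coeFn_toLp.trans hfg.symm)
  refine ⟨φ, ?_⟩
  rw [this, ← dist_eq_norm, dist_comm]
  exact hd

/-- Test functions of mean zero are dense in `L²(G)`. -/
lemma exists_norm_toL2_sub_lt (F : Lp ℂ 2 (volume : Measure (V × ℝ))) {ε : ℝ} (hε : 0 < ε) :
    ∃ φ : Test V, ∫ g, φ g = 0 ∧ ‖φ.toL2 - F‖ < ε := by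
  obtain ⟨φ, hφ⟩ := exists_norm_toL2_sub_lt' F (half_pos hε)
  let b : ContDiffBump (0 : V × ℝ) := ⟨1, 2, one_pos, one_lt_two⟩
  let θ : Test V :=
    { toFun := fun g => (b.normed volume g : ℂ)
      contDiff' := Complex.ofRealCLM.contDiff.comp b.contDiff_normed
      hasCompactSupport' := b.hasCompactSupport_normed.comp_left (g := ((↑) : ℝ → ℂ)) rfl
      tsupport_subset' := by simp }
  have hθ : ∫ g, θ g = 1 := by
    change ∫ g, (b.normed volume g : ℂ) = 1
    rw [integral_complex_ofReal, b.integral_normed, Complex.ofReal_one]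
  set m : ℂ := ∫ g, φ g
  set N := ‖m‖ ^ 2 * ‖θ.toL2‖ ^ 2
  have hN : 0 ≤ N := by positivity
  set s : ℝ := (1 + N / (ε / 2) ^ 2)⁻¹
  have hs : 0 < s := by positivity
  have hs1 : s ≤ 1 := inv_le_one_of_one_le₀ (le_add_of_nonneg_right (by positivity))
  set c : ℂ := m * (s ^ homDim V : ℝ)
  -- The integral of `φ` is removed by a bump spread out by a small `s`: its mass is fixed, while
  -- its squared L²-norm is `s^Q N ≤ s N`. The choice of `s` makes `s N` smaller than `(ε / 2) ^ 2`.
  refine ⟨φ - c • θ.dilate s hs, ?_, ?_⟩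
  · change ∫ g, (φ g - c • θ.dilate s hs g) = 0
    have hi : Integrable fun g => c • θ.dilate s hs g := (θ.dilate s hs).integrable'.smul c
    rw [integral_sub φ.integrable' hi, integral_smul]
    simp only [Test.dilate_apply]
    rw [integral_dilation s hs θ, hθ]
    simp only [c, smul_eq_mul, Complex.real_smul, mul_one, mul_assoc]
    rw [← Complex.ofReal_mul, mul_inv_cancel₀ (by positivity)]
    simp [m]
  · have h1 : ‖c • (θ.dilate s hs).toL2‖ ^ 2 < (ε / 2) ^ 2 := by
      rw [norm_smul, mul_pow, Test.norm_toL2_sq]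
      simp only [Test.dilate_apply]
      rw [integral_dilation s hs fun g => ‖θ g‖ ^ 2, ← Test.norm_toL2_sq, norm_mul,
        Complex.norm_real, Real.norm_of_nonneg (by positivity), smul_eq_mul]
      have h2 : (‖m‖ * s ^ homDim V) ^ 2 * ((s ^ homDim V)⁻¹ * ‖θ.toL2‖ ^ 2) =
          s ^ homDim V * N := by
        have : s ^ homDim V ≠ 0 := by positivity
        simp only [N]
        field_simp
      rw [h2]
      have h3 : s ^ homDim V ≤ s := pow_le_of_le_one hs.le hs1 (by unfold homDim; omega)
      have h4 : s * (1 + N / (ε / 2) ^ 2) = 1 := inv_mul_cancel₀ (by positivity)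
      have h5 : s * ((ε / 2) ^ 2 + N) = (ε / 2) ^ 2 := by
        have : (ε / 2) ^ 2 + N = (1 + N / (ε / 2) ^ 2) * (ε / 2) ^ 2 := by field_simp
        rw [this, ← mul_assoc, h4, one_mul]
      have h6 := mul_le_mul_of_nonneg_right h3 hN
      have h7 : 0 < s * (ε / 2) ^ 2 := by positivity
      linarith
    have h2 := lt_of_pow_lt_pow_left₀ 2 (by positivity) h1
    rw [Test.toL2_sub, Test.toL2_smul, sub_right_comm]
    refine (norm_sub_le _ _).trans_lt ?_
    linarith

/-- A bound for mean zero test functions bounds the operator norm. -/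
lemma opNorm_le_of_test {P : Lp ℂ 2 (volume : Measure (V × ℝ)) →L[ℂ] Lp ℂ 2 (volume : Measure (V × ℝ))}
    {C : ℝ} (hC : 0 ≤ C) (h : ∀ φ : Test V, ∫ g, φ g = 0 → ‖P φ.toL2‖ ≤ C * ‖φ.toL2‖) :
    ‖P‖ ≤ C := by
  refine P.opNorm_le_bound hC fun F => ?_
  have hF : F ∈ closure {F | ‖P F‖ ≤ C * ‖F‖} := by
    rw [Metric.mem_closure_iff]
    intro ε hε
    obtain ⟨φ, hφ, hd⟩ := exists_norm_toL2_sub_lt F hε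
    exact ⟨φ.toL2, h φ hφ, (dist_comm _ _).trans_lt ((dist_eq_norm _ _).trans_lt hd)⟩
  rwa [(isClosed_le (by fun_prop) (by fun_prop)).closure_eq] at hF

variable {S} in
lemma IsConvolutionOperator.unique {k : Distr V}
    {P P' : Lp ℂ 2 (volume : Measure (V × ℝ)) →L[ℂ] Lp ℂ 2 (volume : Measure (V × ℝ))}
    (h : IsConvolutionOperator S k P) (h' : IsConvolutionOperator S k P') : P = P' := by
  ext1 F
  have hF : F ∈ closure {F | P F = P' F} := by
    rw [Metric.mem_closure_iff]
    intro ε hε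
    obtain ⟨φ, hφ, hd⟩ := exists_norm_toL2_sub_lt F hε
    exact ⟨φ.toL2, Lp.ext ((h φ).trans (h' φ).symm),
      (dist_comm _ _).trans_lt ((dist_eq_norm _ _).trans_lt hd)⟩
  rwa [(isClosed_eq P.continuous P'.continuous).closure_eq] at hF

/-- The left regular representation. -/
noncomputable def leftReg : UnitaryRep S (Lp ℂ 2 (volume : Measure (V × ℝ))) where
  op g := Lp.compMeasurePreservingₗᵢ ℂ (mul S (inv g)) (measurePreserving_mul_left S (inv g))
  op_zero := by
    refine LinearIsometry.ext fun F => ?_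
    refine Eq.trans ?_ (Lp.compMeasurePreserving_id_apply F)
    have e : mul S (inv 0) = id := by
      funext x
      rw [inv_eq_neg, neg_zero, zero_mul', id]
    change Lp.compMeasurePreserving (mul S (inv 0)) _ F = _
    congr 1
    simp only [e]
  op_mul g h := by
    refine LinearIsometry.ext fun F => ?_
    refine Eq.trans ?_ (Lp.compMeasurePreserving_comp_apply F
      (measurePreserving_mul_left S (inv h)) (measurePreserving_mul_left S (inv g)))
    have e : mul S (inv (mul S g h)) = mul S (inv h) ∘ mul S (inv g) := by
      funext x
      rw [inv_mul, mul_assoc', Function.comp]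
    change Lp.compMeasurePreserving (mul S (inv (mul S g h))) _ F = _
    simp only [e]
  cont F := by
    let m : C((V × ℝ) × (V × ℝ), V × ℝ) :=
      ⟨fun p => mul S (inv p.1) p.2, Continuous.mulG S (continuous_inv.comp continuous_fst)
        continuous_snd⟩
    exact Continuous.compMeasurePreservingLp (f := fun _ : V × ℝ => F) (g := m.curry)
      continuous_const m.curry.continuous (measurePreserving_mul_left S <| inv ·) (by simp)

lemma UnitaryRep.inner_integ {S : AdaptedSymplectic V} {H : Type*} [NormedAddCommGroup H]
    [InnerProductSpace ℂ H] [CompleteSpace H] (ρ : UnitaryRep S H) {f : V × ℝ → ℂ}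
    (hf : Integrable f) (F G : H) :
    inner ℂ G (ρ.integ f F) = ∫ g, f g * inner ℂ G (ρ.op g F) := by
  rw [integ_apply _ hf, ← integral_inner (ρ.integrable_smul hf F)]
  simp only [inner_smul_right]

/-- A vector valued integral in `L²` has no pointwise definition, so both sides are paired with test
functions, where Fubini identifies them. -/
lemma scale_leftReg_integ_ae {f : V × ℝ → ℂ} (hf : Integrable f) (φ : Test V) (ε : ℝ)
    (hε : 0 < ε) : ((leftReg S).scale ε hε).integ f φ.toL2 =ᵐ[volume] dconv S f ε hε φ := by
  refine ae_eq_of_integral_contDiff_smul_eq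
    ((Lp.memLp _).locallyIntegrable (by norm_num))
    (integrable_dconv S hf φ.integrable' ε hε).locallyIntegrable fun θ hθ hθs => ?_
  let θ' : Test V :=
    { toFun := fun g => (θ g : ℂ)
      contDiff' := Complex.ofRealCLM.contDiff.comp hθ
      hasCompactSupport' := hθs.comp_left (g := ((↑) : ℝ → ℂ)) rfl
      tsupport_subset' := by simp }
  have h1 : ∀ F : Lp ℂ 2 (volume : Measure (V × ℝ)), inner ℂ θ'.toL2 F = ∫ x, θ x • F x := fun F => by
    rw [L2.inner_def]
    refine integral_congr_ae ?_
    filter_upwards [θ'.memLp.coeFn_toLp] with x hx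
    rw [hx]
    change F x * star ((θ x : ℂ)) = _
    rw [Complex.real_smul, mul_comm]
    simp
  rw [← h1, UnitaryRep.inner_integ _ hf]
  have h2 : ∀ g, f g * inner ℂ θ'.toL2 (((leftReg S).scale ε hε).op g φ.toL2) =
      ∫ x, θ x • (f g * φ (mul S (inv (dilation ε hε g)) x)) := fun g => by
    rw [h1, ← integral_const_mul]
    refine integral_congr_ae ?_
    have h3 : ((leftReg S).scale ε hε).op g φ.toL2 =ᵐ[volume]
        fun x => φ (mul S (inv (dilation ε hε g)) x) :=
      MemLp.coeFn_toLp (φ.memLp.comp_measurePreserving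
        (measurePreserving_mul_left S (inv (dilation ε hε g))))
    filter_upwards [h3] with x hx
    rw [hx, mul_smul_comm]
  simp only [h2]
  have hi : Integrable (fun p : (V × ℝ) × (V × ℝ) =>
      θ p.2 • (f p.1 * φ (mul S (inv (dilation ε hε p.1)) p.2))) (volume.prod volume) := by
    obtain ⟨C, hC⟩ := hθ.continuous.bounded_above_of_compact_support hθs
    exact (integrable_prod_dconv S hf φ.integrable' ε hε).bdd_smul C
      (hθ.continuous.comp continuous_snd).aestronglyMeasurable (.of_forall fun p => hC p.2)
  rw [integral_integral_swap hi]
  refine integral_congr_ae (.of_forall fun x => ?_)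
  simp only [dconv, integral_smul]

/-- The multiplier of the regular representation is given by convolution. -/
lemma leftReg_mult_ae {κ : Kernel V} {φ : Test V} {ψ : V × ℝ → ℂ} (h : IsConv S κ φ ψ) :
    (leftReg S).mult κ φ.toL2 =ᵐ[volume] ψ := by
  have h1 := ((leftReg S).hasSum_piece κ φ.toL2).comp tendsto_Ico
  -- The partial sums converge in `L²`, hence almost everywhere along a subsequence; `IsConv` gives
  -- their pointwise limit.
  obtain ⟨n, hn, hlim⟩ := (tendstoInMeasure_of_tendsto_Lp h1).exists_seq_tendsto_ae
  have h2 : ∀ᵐ x, ∀ N : ℕ, (∑ j ∈ Finset.Ico (-N : ℤ) N, (leftReg S).piece κ j φ.toL2 :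
      Lp ℂ 2 (volume : Measure (V × ℝ))) x =
        ∑ j ∈ Finset.Ico (-N : ℤ) N, dconv S κ.f (dyadic j) (dyadic_pos j) φ x := by
    rw [ae_all_iff]
    intro N
    have h3 : ∀ᵐ x, ∀ j : ℤ, (leftReg S).piece κ j φ.toL2 x =
        dconv S κ.f (dyadic j) (dyadic_pos j) φ x :=
      ae_all_iff.2 fun j => scale_leftReg_integ_ae S κ.f.integrable' φ _ _
    filter_upwards [h3, Lp.coeFn_finsetSum (Finset.Ico (-N : ℤ) N)
      fun j => (leftReg S).piece κ j φ.toL2] with x hx hx2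
    rw [hx2]
    simp only [Finset.sum_apply, hx]
  filter_upwards [hlim, h2, Lp.coeFn_sub ((leftReg S).mult κ φ.toL2) (κ.a • φ.toL2),
    Lp.coeFn_smul κ.a φ.toL2, φ.memLp.coeFn_toLp] with x hx hx2 hx3 hx4 hx5
  rw [hx3, Pi.sub_apply, hx4, Pi.smul_apply, hx5, smul_eq_mul] at hx
  refine sub_left_injective (tendsto_nhds_unique hx (((h x).comp hn.tendsto_atTop).congr fun N => ?_))
  exact (hx2 (n N)).symm

lemma Distr.HasKernel.isConvolutionOperator {k : Distr V} {κ : Kernel V} (h : k.HasKernel κ) :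
    IsConvolutionOperator S k ((leftReg S).mult κ) := fun φ =>
  leftReg_mult_ae S (h.isConv S φ)

lemma Test.sharp_sharp (φ : Test V) : (fun g => star (φ.sharp (sigma g))) = φ := by
  funext g
  rw [Test.sharp_apply, sigma_sigma, star_star]

lemma Distr.HasKernel.exists_isConv_sharp {k : Distr V} {κ : Kernel V} (h : k.HasKernel κ)
    (φ : Test V) : ∃ ψ, IsConv S κ.sharp φ ψ :=
  ⟨_, φ.sharp_sharp ▸ (h.isConv S φ.sharp).sharp⟩

/-- The antilinear isometry `φ ↦ φ♯` of `L²(G)` carries convolution by `k` to convolution by `k♯`.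
-/
lemma Distr.HasKernel.norm_leftReg_mult_sharp_le {k : Distr V} {κ : Kernel V} (h : k.HasKernel κ) :
    ‖(leftReg S).mult κ.sharp‖ ≤ ‖(leftReg S).mult κ‖ := by
  have key : ∀ {f f' : Lp ℂ 2 (volume : Measure (V × ℝ))} {ψ : V × ℝ → ℂ}, f =ᵐ[volume] ψ →
      (f' =ᵐ[volume] fun g => star (ψ (sigma g))) → ‖f'‖ = ‖f‖ := fun {f f' ψ} hf hf' => by
    rw [Lp.norm_def, Lp.norm_def, eLpNorm_congr_ae hf, eLpNorm_congr_ae hf',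
      ← eLpNorm_comp_measurePreserving ((Lp.aestronglyMeasurable f).congr hf)
        measurePreserving_sigma]
    congr 1
    exact eLpNorm_congr_norm_ae (.of_forall fun g => by simp)
  refine opNorm_le_of_test (norm_nonneg _) fun φ _ => ?_
  have h1 := (h.isConv S φ.sharp).sharp
  rw [φ.sharp_sharp] at h1
  have h2 := key (leftReg_mult_ae S (h.isConv S φ.sharp)) (leftReg_mult_ae S h1)
  have h3 : ‖φ.sharp.toL2‖ = ‖φ.toL2‖ :=
    key φ.memLp.coeFn_toLp φ.sharp.memLp.coeFn_toLp
  rw [h2, ← h3]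
  exact ContinuousLinearMap.le_opNorm _ _

end Regular

/-! ### The Bargmann–Fock representation is weakly contained in the regular representation -/

section WeakContainment

open Filter Topology

lemma memLp_two_of_lintegral {α : Type*} [MeasurableSpace α] {μ : Measure α} {f : α → ℂ}
    (hm : AEStronglyMeasurable f μ) (h : ∫⁻ x, ‖f x‖ₑ ^ 2 ∂μ ≠ ⊤) : MemLp f 2 μ := by
  refine ⟨hm, ?_⟩
  rw [eLpNorm_lt_top_iff_lintegral_rpow_enorm_lt_top (by simp) (by simp)]
  simpa using h.lt_top

variable {V : Type*} [NormedAddCommGroup V] [NormedSpace ℝ V] [FiniteDimensional ℝ V]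
  [MeasureSpace V] [BorelSpace V] [(volume : Measure V).IsAddHaarMeasure]

/-! ### Norm bounds through asymptotic intertwiners. -/

section General

variable {S : AdaptedSymplectic V} {H : Type*} [NormedAddCommGroup H] [InnerProductSpace ℂ H]
  [CompleteSpace H] {H' : Type*} [NormedAddCommGroup H'] [InnerProductSpace ℂ H'] [CompleteSpace H']
  (ρ : UnitaryRep S H) (ρ' : UnitaryRep S H')

lemma UnitaryRep.norm_map_integ_sub_le (T : H →L[ℂ] H') {f : V × ℝ → ℂ} (hf : Integrable f)
    (F : H) : ‖T (ρ.integ f F) - ρ'.integ f (T F)‖ ≤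
      ∫ g, ‖f g‖ * ‖T (ρ.op g F) - ρ'.op g (T F)‖ := by
  have h1 : Integrable fun g => T (f g • ρ.op g F) :=
    T.integrable_comp (ρ.integrable_smul hf F)
  rw [integ_apply _ hf, integ_apply _ hf,
    ← ContinuousLinearMap.integral_comp_comm _ (ρ.integrable_smul hf F),
    ← integral_sub h1 (ρ'.integrable_smul hf _)]
  refine (norm_integral_le_integral_norm _).trans_eq ?_
  refine integral_congr_ae (.of_forall fun g => ?_)
  simp only
  rw [map_smul, ← smul_sub, norm_smul]

/-- A sequence of multiples of isometries which intertwine asymptotically. -/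
structure AsympIntertwiner (r : ℝ) (T : ℕ → H →L[ℂ] H') : Prop where
  norm_eq : ∀ n F, ‖T n F‖ = r * ‖F‖
  tendsto : ∀ F g, Tendsto (fun n => ‖T n (ρ.op g F) - ρ'.op g (T n F)‖) atTop (𝓝 0)

variable {ρ ρ'} {r : ℝ} {T : ℕ → H →L[ℂ] H'}

/-- `T n` asymptotically intertwines each `ρ(g)`, with errors bounded by `2 r ‖F‖`, so dominated
convergence transfers this to `ρ(f)` for integrable `f`. -/
lemma AsympIntertwiner.tendsto_integ (hT : AsympIntertwiner ρ ρ' r T) {f : V × ℝ → ℂ}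
    (hf : Integrable f) (F : H) :
    Tendsto (fun n => ‖ρ'.integ f (T n F)‖) atTop (𝓝 (r * ‖ρ.integ f F‖)) := by
  have h1 : Tendsto (fun n => ∫ g, ‖f g‖ * ‖T n (ρ.op g F) - ρ'.op g (T n F)‖) atTop
      (𝓝 (∫ _ : V × ℝ, (0 : ℝ))) := by
    refine tendsto_integral_of_dominated_convergence (fun g => ‖f g‖ * (2 * (r * ‖F‖)))
      (fun n => ?_) (hf.norm.mul_const _) (fun n => .of_forall fun g => ?_) (.of_forall fun g => ?_)
    · exact hf.aestronglyMeasurable.norm.mul (((T n).continuous.comp (ρ.cont F)).sub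
        (ρ'.cont _)).norm.aestronglyMeasurable
    · rw [norm_mul, norm_norm, norm_norm]
      refine mul_le_mul_of_nonneg_left ((norm_sub_le _ _).trans ?_) (norm_nonneg _)
      rw [LinearIsometry.norm_map, hT.norm_eq, hT.norm_eq, LinearIsometry.norm_map]
      linarith
    · simpa using (hT.tendsto F g).const_mul ‖f g‖
  rw [integral_zero] at h1
  rw [tendsto_iff_norm_sub_tendsto_zero]
  refine squeeze_zero (fun n => norm_nonneg _) (fun n => ?_) h1
  refine le_trans ?_ (ρ.norm_map_integ_sub_le ρ' (T n) hf F)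
  rw [← hT.norm_eq n, Real.norm_eq_abs, norm_sub_rev]
  exact abs_norm_sub_norm_le _ _

/-- Apply the preceding limit to both `φ` and `ψ = k ∗ φ`. Since `ρ'(ψ) = ρ'(k) ρ'(φ)`, the
inequality holds before the limit, and the scale `r` cancels afterwards. -/
lemma AsympIntertwiner.norm_mult_integ_le (hT : AsympIntertwiner ρ ρ' r T) (hr : 0 < r)
    {κ : Kernel V} {φ : Test V} {ψ : V × ℝ → ℂ} (h : IsConv S κ φ ψ) (hφ : ∫ g, φ g = 0) (F : H) :
    ‖ρ.mult κ (ρ.integ φ F)‖ ≤ ‖ρ'.mult κ‖ * ‖ρ.integ φ F‖ := by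
  have h1 := hT.tendsto_integ (h.integrable S hφ) F
  have h2 := (hT.tendsto_integ φ.integrable' F).const_mul ‖ρ'.mult κ‖
  have h3 := le_of_tendsto_of_tendsto' h1 h2 fun n => by
    rw [← ρ'.mult_integ h hφ]
    exact ContinuousLinearMap.le_opNorm _ _
  rw [ρ.mult_integ h hφ]
  rw [mul_left_comm] at h3
  exact le_of_mul_le_mul_left h3 hr

end General

/-! ### Matrix coefficients cut off in the centre as asymptotic intertwiners. -/

variable (S : AdaptedSymplectic V) (c : ℝ)

lemma BargmannFock.enorm_sq_eq (F : BargmannFock S) :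
    ‖F‖ₑ ^ 2 = ∫⁻ u, ENNReal.ofReal (Real.exp (-S.ω (S.J u) u)) * ‖F.fn u‖ₑ ^ 2 := by
  have h1 : ‖F‖ₑ = ‖toL2 S F‖ₑ := by rw [← ofReal_norm, ← ofReal_norm, norm_eq_toL2]
  rw [h1]
  refine (enorm_sq_toLp F.memLp).trans ?_
  rw [gaussian, lintegral_withDensity_eq_lintegral_mul]
  · rfl
  · fun_prop
  · exact F.continuous_fn.measurable.enorm.pow_const 2

/-- The matrix coefficient `(π(g⁻¹) F)(0)`. -/
noncomputable def coef (F : BargmannFock S) (g : V × ℝ) : ℂ := (rep S c (inv g) F).fn 0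

lemma continuous_coef (F : BargmannFock S) : Continuous (coef S c F) :=
  (continuous_rep_fn S c F 0).comp continuous_inv

lemma coef_rep (F : BargmannFock S) (g h : V × ℝ) :
    coef S c (rep S c h F) (mul S h g) = coef S c F g := by
  unfold coef
  have : rep S c (inv (mul S h g)) (rep S c h F) = rep S c (inv g) F := by
    rw [inv_mul, rep_mul]
    change rep S c (inv g) ((bf S c).op (inv h) ((bf S c).op h F)) = _
    rw [UnitaryRep.op_inv_op]
  rw [this]

lemma enorm_coef_sq (F : BargmannFock S) (g : V × ℝ) : ‖coef S c F g‖ₑ ^ 2 =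
    ENNReal.ofReal (Real.exp (-S.ω (S.J (c • S.J g.1)) (c • S.J g.1))) *
      ‖F.fn (c • S.J g.1)‖ₑ ^ 2 := by
  have h1 : ‖repFactor S c (inv g) 0‖ₑ ^ 2 =
      ENNReal.ofReal (Real.exp (-S.ω (S.J (c • S.J g.1)) (c • S.J g.1))) := by
    rw [← ofReal_norm, ← ENNReal.ofReal_pow (norm_nonneg _), repFactor, Complex.norm_exp,
      ← Real.exp_nat_mul]
    congr 2
    have : (c : ℂ) ^ 2 = ((c ^ 2 : ℝ) : ℂ) := by push_cast; rfl
    rw [this]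
    simp [inv, S.J_J, S.ω_swap g.1]
    norm_cast
    ring
  rw [coef, rep_fn, enorm_mul, mul_pow, h1]
  simp [inv]

/-- Square integrability modulo the centre. The squared coefficient at `(v, 0)` is exactly the
Gaussian density times `|F|²` at the point `c J v`, so the integral is `‖F‖²` times a Jacobian. -/
lemma exists_lintegral_coef (hc : c ≠ 0) : ∃ C : ENNReal, C ≠ 0 ∧ C ≠ ⊤ ∧
    ∀ F : BargmannFock S, ∫⁻ v, ‖coef S c F (v, 0)‖ₑ ^ 2 = C * ‖F‖ₑ ^ 2 := by
  let L : V ≃L[ℝ] V := .equivOfInverse (c • S.J) (-(c⁻¹ • S.J))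
    (fun u => by simp [S.J_J, smul_smul, hc]) (fun u => by simp [S.J_J, smul_smul, hc])
  set r := Measure.addHaarScalarFactor ((volume : Measure V).map L) volume
  have h2 : (volume : Measure V).map L = r • volume :=
    Measure.isAddLeftInvariant_eq_smul (volume.map L) volume
  refine ⟨r, ?_, by simp, fun F => ?_⟩
  · intro h0
    rw [ENNReal.coe_eq_zero] at h0
    rw [h0, zero_smul, Measure.map_eq_zero_iff L.continuous.measurable.aemeasurable] at h2
    exact NeZero.ne (volume : Measure V) h2
  · simp only [enorm_coef_sq]
    rw [BargmannFock.enorm_sq_eq, ← smul_eq_mul, ← lintegral_smul_measure, ← ENNReal.smul_def, ← h2,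
      lintegral_map _ L.continuous.measurable]
    · rfl
    · exact (by fun_prop : Measurable fun u : V => ENNReal.ofReal (Real.exp (-S.ω (S.J u) u))).mul
        (F.continuous_fn.measurable.enorm.pow_const 2)

/-- A normalized indicator function. -/
noncomputable def cutoff (n : ℕ) (t : ℝ) : ℝ :=
  (Set.Ioc (0 : ℝ) (n + 1)).indicator (fun _ => (√(n + 1))⁻¹) t

lemma measurable_cutoff (n : ℕ) : Measurable (cutoff n) :=
  measurable_const.indicator measurableSet_Ioc

lemma enorm_cutoff_sq (n : ℕ) (t : ℝ) : ‖cutoff n t‖ₑ ^ 2 =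
    (Set.Ioc (0 : ℝ) (n + 1)).indicator (fun _ => ENNReal.ofReal (n + 1 : ℝ)⁻¹) t := by
  unfold cutoff
  by_cases ht : t ∈ Set.Ioc (0 : ℝ) (n + 1)
  · rw [Set.indicator_of_mem ht, Set.indicator_of_mem ht, ← ofReal_norm,
      ← ENNReal.ofReal_pow (norm_nonneg _), Real.norm_of_nonneg (by positivity), inv_pow,
      Real.sq_sqrt (by positivity)]
  · rw [Set.indicator_of_notMem ht, Set.indicator_of_notMem ht]
    simp

lemma lintegral_cutoff_sq (n : ℕ) : ∫⁻ t, ‖cutoff n t‖ₑ ^ 2 = 1 := by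
  simp only [enorm_cutoff_sq]
  rw [lintegral_indicator measurableSet_Ioc, setLIntegral_const, Real.volume_Ioc, sub_zero,
    ← ENNReal.ofReal_mul (by positivity), inv_mul_cancel₀ (by positivity), ENNReal.ofReal_one]

lemma enorm_sub_sq_le (a b : ℝ) : ‖a - b‖ₑ ^ 2 ≤ 2 * ‖a‖ₑ ^ 2 + 2 * ‖b‖ₑ ^ 2 := by
  simp only [← ofReal_norm, Real.norm_eq_abs, ← ENNReal.ofReal_pow (abs_nonneg _), sq_abs]
  have h2 : (2 : ENNReal) = ENNReal.ofReal 2 := by simp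
  rw [h2, ← ENNReal.ofReal_mul (by norm_num), ← ENNReal.ofReal_mul (by norm_num),
    ← ENNReal.ofReal_add (by positivity) (by positivity)]
  exact ENNReal.ofReal_le_ofReal (by nlinarith [sq_nonneg (a + b)])

/-- The square of the `L²`-distance of the cutoff function and its translate. -/
noncomputable def cutoffDist (n : ℕ) (τ : ℝ) : ENNReal := ∫⁻ t, ‖cutoff n (t + τ) - cutoff n t‖ₑ ^ 2

lemma measurable_cutoffDist (n : ℕ) : Measurable (cutoffDist n) := by
  have h : Measurable fun p : ℝ × ℝ => ‖cutoff n (p.2 + p.1) - cutoff n p.2‖ₑ ^ 2 :=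
    (((measurable_cutoff n).comp (measurable_snd.add measurable_fst)).sub
      ((measurable_cutoff n).comp measurable_snd)).enorm.pow_const 2
  exact h.lintegral_prod_right'

lemma cutoffDist_le (n : ℕ) (τ : ℝ) : cutoffDist n τ ≤ 4 := by
  have h1 : Measurable fun t => ‖cutoff n (t + τ)‖ₑ ^ 2 :=
    ((measurable_cutoff n).comp (measurable_add_const τ)).enorm.pow_const 2
  calc cutoffDist n τ ≤ ∫⁻ t, (2 * ‖cutoff n (t + τ)‖ₑ ^ 2 + 2 * ‖cutoff n t‖ₑ ^ 2) :=
        lintegral_mono fun t => enorm_sub_sq_le _ _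
    _ = 2 * (∫⁻ t, ‖cutoff n (t + τ)‖ₑ ^ 2) + 2 * ∫⁻ t, ‖cutoff n t‖ₑ ^ 2 := by
        rw [lintegral_add_left (h1.const_mul 2), lintegral_const_mul _ h1,
          lintegral_const_mul _ ((measurable_cutoff n).enorm.pow_const 2)]
    _ = 4 := by
        rw [lintegral_add_right_eq_self (fun t => ‖cutoff n t‖ₑ ^ 2), lintegral_cutoff_sq]
        norm_num

/-- The Følner property of the centre: a translation by `τ` changes the indicator only within `|τ|`
of the two endpoints, a set of measure at most `4 |τ|`, while the squared height is `1 / (n + 1)`.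
-/
lemma cutoffDist_le_mul (n : ℕ) (τ : ℝ) :
    cutoffDist n τ ≤ ENNReal.ofReal (n + 1 : ℝ)⁻¹ * ENNReal.ofReal (4 * |τ|) := by
  set U : Set ℝ := Set.Icc (-|τ|) |τ| ∪ Set.Icc (n + 1 - |τ|) (n + 1 + |τ|)
  have hU : MeasurableSet U := measurableSet_Icc.union measurableSet_Icc
  have h1 : ∀ t, ‖cutoff n (t + τ) - cutoff n t‖ₑ ^ 2 ≤
      U.indicator (fun _ => ENNReal.ofReal (n + 1 : ℝ)⁻¹) t := fun t => by
    have hτ := abs_le.1 (le_refl |τ|)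
    by_cases ht : t ∈ U
    · rw [Set.indicator_of_mem ht]
      have h2 : ‖cutoff n (t + τ) - cutoff n t‖ ≤ (√(n + 1))⁻¹ := by
        have h3 : ∀ t, 0 ≤ cutoff n t ∧ cutoff n t ≤ (√(n + 1))⁻¹ := fun t => by
          unfold cutoff
          have : 0 ≤ (√((n : ℝ) + 1))⁻¹ := by positivity
          by_cases ht : t ∈ Set.Ioc (0 : ℝ) (n + 1)
          · rw [Set.indicator_of_mem ht]; exact ⟨this, le_refl _⟩
          · rw [Set.indicator_of_notMem ht]; exact ⟨le_refl _, this⟩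
        rw [Real.norm_eq_abs, abs_le]
        have := h3 t
        have := h3 (t + τ)
        constructor <;> linarith
      rw [← ofReal_norm, ← ENNReal.ofReal_pow (norm_nonneg _)]
      refine ENNReal.ofReal_le_ofReal ((pow_le_pow_left₀ (norm_nonneg _) h2 2).trans_eq ?_)
      rw [inv_pow, Real.sq_sqrt (by positivity)]
    · have h2 : t + τ ∈ Set.Ioc (0 : ℝ) (n + 1) ↔ t ∈ Set.Ioc (0 : ℝ) (n + 1) := by
        simp only [U, Set.mem_union, Set.mem_Icc, not_or, not_and_or, not_le] at ht
        have hn : (0 : ℝ) < n + 1 := by positivity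
        have hτ2 := hτ.2
        have hτ3 := neg_le.1 hτ.1
        simp only [Set.mem_Ioc]
        obtain ⟨h3 | h3, h4 | h4⟩ := ht <;> constructor <;> rintro ⟨h5, h6⟩ <;> constructor <;>
          linarith
      have h3 : cutoff n (t + τ) = cutoff n t := by
        unfold cutoff
        simp only [Set.indicator, h2]
      simp [h3]
  refine (lintegral_mono h1).trans ?_
  rw [lintegral_indicator hU, setLIntegral_const]
  gcongr
  refine (measure_union_le _ _).trans ?_
  rw [Real.volume_Icc, Real.volume_Icc, ← ENNReal.ofReal_add (by linarith [abs_nonneg τ])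
    (by linarith [abs_nonneg τ])]
  exact ENNReal.ofReal_le_ofReal (by linarith)

lemma tendsto_cutoffDist (τ : ℝ) : Tendsto (fun n => cutoffDist n τ) atTop (𝓝 0) := by
  refine tendsto_of_tendsto_of_tendsto_of_le_of_le tendsto_const_nhds ?_ (fun _ => zero_le)
    fun n => cutoffDist_le_mul n τ
  have h1 : Tendsto (fun n : ℕ => ((n : ℝ) + 1)⁻¹) atTop (𝓝 0) := by
    simpa using tendsto_one_div_add_atTop_nhds_zero_nat (𝕜 := ℝ)
  have h2 := ENNReal.Tendsto.mul_const (b := ENNReal.ofReal (4 * |τ|))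
    (ENNReal.tendsto_ofReal h1) (Or.inr ENNReal.ofReal_ne_top)
  simpa using h2

lemma enorm_coef_eq (F : BargmannFock S) (v : V) (t : ℝ) :
    ‖coef S c F (v, t)‖ₑ ^ 2 = ‖coef S c F (v, 0)‖ₑ ^ 2 := by
  rw [enorm_coef_sq, enorm_coef_sq]

lemma lintegral_coef_mul (F : BargmannFock S) {b : V × ℝ → ℝ} (hb : Measurable b) :
    ∫⁻ g, ‖coef S c F g * b g‖ₑ ^ 2 =
      ∫⁻ v, ‖coef S c F (v, 0)‖ₑ ^ 2 * ∫⁻ t, ‖b (v, t)‖ₑ ^ 2 := by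
  have hm : Measurable fun g : V × ℝ => ‖coef S c F g * b g‖ₑ ^ 2 :=
    ((continuous_coef S c F).measurable.mul
      (Complex.measurable_ofReal.comp hb)).enorm.pow_const 2
  rw [Measure.volume_eq_prod, lintegral_prod _ hm.aemeasurable]
  refine lintegral_congr fun v => ?_
  rw [← lintegral_const_mul]
  · refine lintegral_congr fun t => ?_
    rw [enorm_mul, mul_pow, enorm_coef_eq]
    congr 2
    rw [← ofReal_norm, ← ofReal_norm, Complex.norm_real]
  · exact (hb.comp measurable_prodMk_left).enorm.pow_const 2

lemma lintegral_coef_mul_cutoff (F : BargmannFock S) (n : ℕ) :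
    ∫⁻ g, ‖coef S c F g * cutoff n g.2‖ₑ ^ 2 = ∫⁻ v, ‖coef S c F (v, 0)‖ₑ ^ 2 := by
  rw [lintegral_coef_mul S c F (b := fun g => cutoff n g.2) ((measurable_cutoff n).comp measurable_snd)]
  simp only [lintegral_cutoff_sq, mul_one]

lemma memLp_coef_mul_cutoff (hc : c ≠ 0) (F : BargmannFock S) (n : ℕ) :
    MemLp (fun g : V × ℝ => coef S c F g * cutoff n g.2) 2 := by
  refine memLp_two_of_lintegral ((continuous_coef S c F).measurable.mul
    (Complex.measurable_ofReal.comp ((measurable_cutoff n).comp measurable_snd))).aestronglyMeasurable ?_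
  obtain ⟨C, -, hC, h⟩ := exists_lintegral_coef S c hc
  rw [lintegral_coef_mul_cutoff, h]
  exact ENNReal.mul_ne_top hC (by simp)

/-- Cut off matrix coefficients as a linear map. -/
noncomputable def coefLin (hc : c ≠ 0) (n : ℕ) :
    BargmannFock S →ₗ[ℂ] Lp ℂ 2 (volume : Measure (V × ℝ)) where
  toFun F := (memLp_coef_mul_cutoff S c hc F n).toLp _
  map_add' F G := by
    rw [← MemLp.toLp_add]
    congr 1
    funext g
    simp only [coef, map_add, BargmannFock.fn_add, add_mul, Pi.add_apply]
  map_smul' a F := by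
    rw [RingHom.id_apply, ← MemLp.toLp_const_smul]
    congr 1
    funext g
    simp only [coef, map_smul, BargmannFock.fn_smul, Pi.smul_apply, smul_eq_mul, mul_assoc]

lemma exists_norm_coefLin (hc : c ≠ 0) : ∃ r : ℝ, 0 < r ∧
    ∀ n F, ‖coefLin S c hc n F‖ = r * ‖F‖ := by
  obtain ⟨C, hC0, hC, h⟩ := exists_lintegral_coef S c hc
  refine ⟨√C.toReal, Real.sqrt_pos.2 (ENNReal.toReal_pos hC0 hC), fun n F => ?_⟩
  have h1 : ‖coefLin S c hc n F‖ₑ ^ 2 = C * ‖F‖ₑ ^ 2 := by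
    rw [← h, ← lintegral_coef_mul_cutoff S c F n]
    exact enorm_sq_toLp (memLp_coef_mul_cutoff S c hc F n)
  have h2 := congrArg ENNReal.toReal h1
  rw [ENNReal.toReal_mul, ENNReal.toReal_pow, ENNReal.toReal_pow, toReal_enorm, toReal_enorm] at h2
  rw [← Real.sqrt_sq (norm_nonneg (coefLin S c hc n F)), h2, Real.sqrt_mul ENNReal.toReal_nonneg,
    Real.sqrt_sq (norm_nonneg _)]

/-- Without the cutoff the coefficients intertwine exactly, by `coef_rep`. The error comes only from
the shift of the central cutoff by `h.2 + ω(h.1, v) / 2`. For each fixed `v` it tends to zero, and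
`cutoffDist ≤ 4` dominates it. -/
lemma tendsto_coefLin (hc : c ≠ 0) (F : BargmannFock S) (h : V × ℝ) :
    Tendsto (fun n => ‖coefLin S c hc n (rep S c h F) - (leftReg S).op h (coefLin S c hc n F)‖)
      atTop (𝓝 0) := by
  set τ : V → ℝ := fun v => h.2 + S.ω h.1 v / 2
  have hτ : Continuous τ := by fun_prop
  have e : ∀ n, ‖coefLin S c hc n (rep S c h F) - (leftReg S).op h (coefLin S c hc n F)‖ₑ ^ 2 =
      ∫⁻ v, ‖coef S c F (v, 0)‖ₑ ^ 2 * cutoffDist n (τ v) := fun n => by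
    have h1 : ‖coefLin S c hc n (rep S c h F) - (leftReg S).op h (coefLin S c hc n F)‖ₑ =
        ‖(leftReg S).op (inv h) (coefLin S c hc n (rep S c h F)) - coefLin S c hc n F‖ₑ := by
      rw [← ofReal_norm, ← ofReal_norm, ← (leftReg S).op_inv_op h (coefLin S c hc n F),
        ← map_sub, LinearIsometry.norm_map, UnitaryRep.op_inv_op]
    have h2 : (leftReg S).op (inv h) (coefLin S c hc n (rep S c h F)) - coefLin S c hc n F =ᵐ[volume]
        fun g : V × ℝ => coef S c F g * (cutoff n (g.2 + τ g.1) - cutoff n g.2 : ℝ) := by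
      filter_upwards [Lp.coeFn_sub ((leftReg S).op (inv h) (coefLin S c hc n (rep S c h F)))
        (coefLin S c hc n F), MemLp.coeFn_toLp ((memLp_coef_mul_cutoff S c hc (rep S c h F)
          n).comp_measurePreserving (measurePreserving_mul_left S (inv (inv h)))),
        (memLp_coef_mul_cutoff S c hc F n).coeFn_toLp] with g hg hg2 hg3
      rw [hg, Pi.sub_apply]
      refine (congrArg₂ (· - ·) hg2 hg3).trans ?_
      simp only [Function.comp, inv_inv', coef_rep]
      have : (mul S h g).2 = g.2 + τ g.1 := by simp only [mul, τ]; ring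
      rw [this]
      push_cast
      ring
    have hb : Measurable fun g : V × ℝ => cutoff n (g.2 + τ g.1) - cutoff n g.2 :=
      ((measurable_cutoff n).comp (measurable_snd.add (hτ.measurable.comp measurable_fst))).sub
        ((measurable_cutoff n).comp measurable_snd)
    rw [h1, enorm_sq_eq_lintegral]
    refine (lintegral_congr_ae (h2.fun_comp fun z => ‖z‖ₑ ^ 2)).trans ?_
    exact lintegral_coef_mul S c F hb
  have hm : Measurable fun v : V => ‖coef S c F (v, 0)‖ₑ ^ 2 :=
    ((continuous_coef S c F).comp (by fun_prop : Continuous fun v : V => (v, (0 : ℝ)))).measurable.enorm.pow_const 2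
  have h1 : Tendsto (fun n => ∫⁻ v, ‖coef S c F (v, 0)‖ₑ ^ 2 * cutoffDist n (τ v)) atTop
      (𝓝 (∫⁻ _ : V, 0)) := by
    refine tendsto_lintegral_of_dominated_convergence (fun v => ‖coef S c F (v, 0)‖ₑ ^ 2 * 4)
      (fun n => hm.mul ((measurable_cutoffDist n).comp hτ.measurable))
      (fun n => .of_forall fun v => mul_le_mul_right (cutoffDist_le n _) _) ?_ (.of_forall fun v => ?_)
    · obtain ⟨C, -, hC, h⟩ := exists_lintegral_coef S c hc
      rw [lintegral_mul_const _ hm, h]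
      exact ENNReal.mul_ne_top (ENNReal.mul_ne_top hC (by simp)) (by simp)
    · simpa using ENNReal.Tendsto.const_mul (tendsto_cutoffDist (τ v)) (Or.inr (by simp))
  rw [lintegral_zero] at h1
  have h2 := (ENNReal.tendsto_toReal ENNReal.zero_ne_top).comp (h1.congr fun n => (e n).symm)
  have h3 := (Real.continuous_sqrt.tendsto _).comp h2
  simp only [ENNReal.toReal_zero, Real.sqrt_zero] at h3
  refine h3.congr fun n => ?_
  simp only [Function.comp, ENNReal.toReal_pow, toReal_enorm]
  exact Real.sqrt_sq (norm_nonneg _)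

lemma exists_asympIntertwiner (hc : c ≠ 0) :
    ∃ r T, 0 < r ∧ AsympIntertwiner (bf S c) (leftReg S) r T := by
  obtain ⟨r, hr, h⟩ := exists_norm_coefLin S c hc
  refine ⟨r, fun n => (coefLin S c hc n).mkContinuous r fun F => (h n F).le, hr, h, fun F g => ?_⟩
  exact tendsto_coefLin S c hc F g

/-- The bound holds on vectors `π(φ) F` with `φ` of mean zero by weak containment, and these vectors
are dense. -/
lemma norm_bf_mult_le (hc : c ≠ 0) {κ : Kernel V} (h : ∀ φ : Test V, ∃ ψ, IsConv S κ φ ψ) :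
    ‖(bf S c).mult κ‖ ≤ ‖(leftReg S).mult κ‖ := by
  obtain ⟨r, T, hr, hT⟩ := exists_asympIntertwiner S c hc
  refine ContinuousLinearMap.opNorm_le_bound _ (norm_nonneg _) fun F => ?_
  have hF : F ∈ closure {F | ‖(bf S c).mult κ F‖ ≤ ‖(leftReg S).mult κ‖ * ‖F‖} := by
    rw [Metric.mem_closure_iff]
    intro ε hε
    obtain ⟨φ, hφ, hd⟩ := exists_norm_integ_bf_sub_lt S c hc F hε
    obtain ⟨ψ, hψ⟩ := h φ
    exact ⟨_, hT.norm_mult_integ_le hr hψ hφ F,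
      (dist_comm _ _).trans_lt ((dist_eq_norm _ _).trans_lt hd)⟩
  rwa [(isClosed_le (by fun_prop) (by fun_prop)).closure_eq] at hF

end WeakContainment

/-! ### The Plancherel formula -/

section Plancherel

open Filter Topology

variable {V : Type*} [NormedAddCommGroup V] [NormedSpace ℝ V] [FiniteDimensional ℝ V]
  [MeasureSpace V] [BorelSpace V] [(volume : Measure V).IsAddHaarMeasure]

/-- The Fourier transform in the central variable. -/
noncomputable def fib (f : V × ℝ → ℂ) (s : ℝ) (w : V) : ℂ :=
  ∫ t, Complex.exp (Complex.I * ((t * s : ℝ) : ℂ)) * f (w, t)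

lemma measurable_fib {f : V × ℝ → ℂ} (hf : Measurable f) :
    Measurable fun p : ℝ × V => fib f p.1 p.2 := by
  have h : Measurable fun q : (ℝ × V) × ℝ =>
      Complex.exp (Complex.I * ((q.2 * q.1.1 : ℝ) : ℂ)) * f (q.1.2, q.2) :=
    (by fun_prop : Measurable fun q : (ℝ × V) × ℝ =>
      Complex.exp (Complex.I * ((q.2 * q.1.1 : ℝ) : ℂ))).mul
      (hf.comp ((measurable_snd.comp measurable_fst).prodMk measurable_snd))
  exact h.stronglyMeasurable.integral_prod_right'.measurable

lemma norm_exp_I_mul (x : ℝ) : ‖Complex.exp (Complex.I * (x : ℂ))‖ = 1 := by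
  rw [mul_comm, Complex.norm_exp_ofReal_mul_I]

lemma integrable_exp_mul {f : V × ℝ → ℂ} (hf : Integrable f) {a : V × ℝ → ℝ} (ha : Continuous a) :
    Integrable fun g => Complex.exp (Complex.I * (a g : ℂ)) * f g :=
  hf.bdd_mul (c := 1) (by fun_prop) (.of_forall fun g => (norm_exp_I_mul _).le)

lemma integrable_fib {f : V × ℝ → ℂ} (hf : Integrable f) (s : ℝ) : Integrable (fib f s) :=
  (integrable_exp_mul hf (a := fun g => g.2 * s) (by fun_prop)).integral_prod_left

/-- The square of the `L²`-norm of a slice of the central Fourier transform. -/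
noncomputable def fibSq (f : V × ℝ → ℂ) (s : ℝ) : ENNReal := ∫⁻ w, ‖fib f s w‖ₑ ^ 2

lemma measurable_fibSq {f : V × ℝ → ℂ} (hf : Measurable f) : Measurable (fibSq f) :=
  ((measurable_fib hf).enorm.pow_const 2).lintegral_prod_right'

variable (V) in
-- One-dimensional Plancherel in the central variable on almost every fibre, followed by Tonelli.
lemma exists_lintegral_fibSq : ∃ C : ENNReal, C ≠ 0 ∧ C ≠ ⊤ ∧ ∀ f : V × ℝ → ℂ, Measurable f →
    Integrable f → ∫⁻ g, ‖f g‖ₑ ^ 2 ≠ ⊤ → ∫⁻ s, fibSq f s = C * ∫⁻ g, ‖f g‖ₑ ^ 2 := by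
  obtain ⟨C, hC0, hC, h⟩ := exists_lintegral_pairing_sq (volume : Measure ℝ)
    (ContinuousLinearMap.mul ℝ ℝ) fun w hw => by simpa using hw 1
  refine ⟨C, hC0, hC, fun f hm hi h2 => ?_⟩
  have hm2 : Measurable fun g => ‖f g‖ₑ ^ 2 := hm.enorm.pow_const 2
  unfold fibSq
  rw [lintegral_lintegral_swap ((measurable_fib hm).enorm.pow_const 2).aemeasurable]
  rw [Measure.volume_eq_prod, lintegral_prod _ hm2.aemeasurable] at h2 ⊢
  rw [← lintegral_const_mul _ hm2.lintegral_prod_right']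
  refine lintegral_congr_ae ?_
  filter_upwards [hi.prod_right_ae, ae_lt_top hm2.lintegral_prod_right' h2] with w hw hw2
  have hml : MemLp (fun t => f (w, t)) 2 := memLp_two_of_lintegral hw.aestronglyMeasurable hw2.ne
  exact h _ hw hml

/-- Complex conjugation reverses the frequency. This is how negative frequencies are brought within
reach of the representations with positive central character. -/
lemma fib_sharp (f : V × ℝ → ℂ) (s : ℝ) (w : V) :
    fib (fun g => star (f (sigma g))) s w = star (fib f (-s) (-w)) := by
  unfold fib
  refine Eq.trans ?_ integral_conj
  refine integral_congr_ae (.of_forall fun t => ?_)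
  simp only [sigma_apply, map_mul, ← Complex.exp_conj, Complex.conj_I, Complex.conj_ofReal]
  congr 2
  push_cast
  ring

lemma fibSq_sharp (f : V × ℝ → ℂ) (s : ℝ) :
    fibSq (fun g => star (f (sigma g))) s = fibSq f (-s) := by
  unfold fibSq
  rw [← (Measure.measurePreserving_neg (volume : Measure V)).lintegral_comp_emb
    (Homeomorph.neg V).measurableEmbedding fun w => ‖fib f (-s) w‖ₑ ^ 2]
  refine lintegral_congr fun w => ?_
  rw [fib_sharp]
  simp

variable (S : AdaptedSymplectic V) (c : ℝ)

/-- Moving `(v, 0)` from the right of `g` to its left creates the central element `(0, ω(g, v))`,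
which acts by a character. So composing `π(f)` with `π(v, 0)` amounts to modulating `f`, up to an
isometry on the left. -/
lemma norm_integ_rep (f : V × ℝ → ℂ) (hf : Integrable f) (v : V) (F : BargmannFock S) :
    ‖(bf S c).integ f (rep S c (v, 0) F)‖ =
      ‖(bf S c).integ (fun g => Complex.exp (Complex.I * ((2 * c ^ 2 * S.ω g.1 v : ℝ) : ℂ)) * f g) F‖ := by
  have hi := integrable_exp_mul hf (a := fun g => 2 * c ^ 2 * S.ω g.1 v) (by fun_prop)
  rw [← (rep S c (v, 0)).norm_map ((bf S c).integ _ F), ← bf_op, UnitaryRep.integ_apply _ hi,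
    UnitaryRep.integ_apply _ hf, ← LinearIsometry.coe_toContinuousLinearMap,
    ← ContinuousLinearMap.integral_comp_comm _ ((bf S c).integrable_smul hi F)]
  congr 1
  refine integral_congr_ae (.of_forall fun g => ?_)
  simp only [LinearIsometry.coe_toContinuousLinearMap]
  have h1 : mul S g (v, 0) = mul S (v, 0) (mul S (0, S.ω g.1 v) g) := by
    ext
    · simp [mul, add_comm]
    · simp [mul, S.ω_swap v g.1]; ring
  have h2 : Complex.exp (2 * Complex.I * c ^ 2 * S.ω g.1 v) =
      Complex.exp (Complex.I * ((2 * c ^ 2 * S.ω g.1 v : ℝ) : ℂ)) := by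
    congr 1
    push_cast
    ring
  rw [← UnitaryRep.op_mul_apply, h1, UnitaryRep.op_mul_apply, UnitaryRep.op_mul_apply,
    bf_op S c (0, S.ω g.1 v), rep_central, h2, map_smul, map_smul, smul_smul, mul_comm]

/-- Integrating out the centre against its character leaves the slice of `f` at frequency `2c²`. As
a function of `v`, the result is a symplectic Fourier transform of this slice times a coefficient.
-/
lemma integ_bf_fn_eq {f : V × ℝ → ℂ} (hf : Integrable f) (v u : V) (F : BargmannFock S) :
    ((bf S c).integ (fun g => Complex.exp (Complex.I * ((2 * c ^ 2 * S.ω g.1 v : ℝ) : ℂ)) * f g) F).fn u =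
      ∫ w, Complex.exp (Complex.I * ((2 * c ^ 2 * S.ω w v : ℝ) : ℂ)) *
        (fib f (2 * c ^ 2) w * (rep S c (w, 0) F).fn u) := by
  have hi := integrable_exp_mul hf (a := fun g => 2 * c ^ 2 * S.ω g.1 v) (by fun_prop)
  have hi2 : Integrable fun g => (Complex.exp (Complex.I * ((2 * c ^ 2 * S.ω g.1 v : ℝ) : ℂ)) * f g) *
      (rep S c g F).fn u :=
    (BargmannFock.eval u).integrable_comp ((bf S c).integrable_smul hi F)
  rw [integ_bf_fn S c hi, Measure.volume_eq_prod, integral_prod _ hi2]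
  refine integral_congr_ae (.of_forall fun w => ?_)
  simp only [fib]
  rw [← integral_mul_const, ← integral_const_mul]
  refine integral_congr_ae (.of_forall fun t => ?_)
  have h1 : rep S c (w, t) F = Complex.exp (Complex.I * ((t * (2 * c ^ 2) : ℝ) : ℂ)) •
      rep S c (w, 0) F := by
    have h2 : (w, t) = mul S (0, t) (w, 0) := by ext <;> simp [mul]
    rw [h2, ← bf_op, UnitaryRep.op_mul_apply, bf_op, rep_central]
    congr 2
    push_cast
    ring
  simp only [h1, BargmannFock.fn_smul]
  ring

/-- A Plancherel formula for `π_c`, with the Hilbert–Schmidt norm replaced by an average over the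
translates of the vacuum. Plancherel in `v` is applied for each fixed point `u` of the Fock model,
and the integration over `u` then uses that `π(w, 0)` is isometric. -/
lemma exists_lintegral_integ_sq (hc : c ≠ 0) : ∃ C : ENNReal, C ≠ 0 ∧ C ≠ ⊤ ∧
    ∀ f : V × ℝ → ℂ, Measurable f → Integrable f → fibSq f (2 * c ^ 2) ≠ ⊤ →
      ∫⁻ v, ‖(bf S c).integ f (rep S c (v, 0) (BargmannFock.vacuum S))‖ₑ ^ 2 =
        C * fibSq f (2 * c ^ 2) := by
  obtain ⟨C, hC0, hC, h⟩ := exists_lintegral_pairing_sq (volume : Measure V)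
    ((2 * c ^ 2) • S.ω) fun w hw => by
      by_contra h0
      have := hw (S.J w)
      simp only [_root_.smul_apply, smul_eq_mul, mul_eq_zero] at this
      have h2 := S.ω_J_pos w h0
      rcases this with h3 | h3
      · simp [hc] at h3
      · exact h2.ne' h3
  simp only [_root_.smul_apply, smul_eq_mul] at h
  set F := BargmannFock.vacuum S
  have hF : ‖F‖ₑ ≠ 0 := by
    rw [← ofReal_norm, Ne, ENNReal.ofReal_eq_zero, not_le]
    exact norm_pos_iff.2 BargmannFock.vacuum_ne_zero
  refine ⟨C * ‖F‖ₑ ^ 2, mul_ne_zero hC0 (pow_ne_zero 2 hF), ENNReal.mul_ne_top hC (by simp),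
    fun f hm hi h2 => ?_⟩
  set ψ := fib f (2 * c ^ 2)
  have hψm : Measurable ψ := (measurable_fib hm).comp (measurable_const.prodMk measurable_id)
  have hψi : Integrable ψ := integrable_fib hi _
  obtain ⟨e, he_def⟩ : ∃ e : V → V → ℂ, ∀ w u, e w u = (rep S c (w, 0) F).fn u :=
    ⟨_, fun _ _ => rfl⟩
  have he : Continuous fun p : V × V => e p.1 p.2 := by
    simp only [he_def, rep_fn, F, BargmannFock.vacuum_fn, mul_one]
    unfold repFactor
    fun_prop
  have hq : Measurable fun u : V => ENNReal.ofReal (Real.exp (-S.ω (S.J u) u)) := by fun_prop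
  obtain ⟨Y, hY_def⟩ : ∃ Y : V → V → ℂ, ∀ v u, Y v u =
      ∫ w, Complex.exp (Complex.I * ((2 * c ^ 2 * S.ω w v : ℝ) : ℂ)) * (ψ w * e w u) :=
    ⟨_, fun _ _ => rfl⟩
  have hY : Measurable fun p : V × V => Y p.1 p.2 := by
    simp only [hY_def]
    have h : Measurable fun q : (V × V) × V =>
        Complex.exp (Complex.I * ((2 * c ^ 2 * S.ω q.2 q.1.1 : ℝ) : ℂ)) * (ψ q.2 * e q.2 q.1.2) :=
      (by fun_prop : Continuous fun q : (V × V) × V =>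
        Complex.exp (Complex.I * ((2 * c ^ 2 * S.ω q.2 q.1.1 : ℝ) : ℂ))).measurable.mul
        ((hψm.comp measurable_snd).mul
          (he.comp (by fun_prop : Continuous fun q : (V × V) × V => (q.2, q.1.2))).measurable)
    exact h.stronglyMeasurable.integral_prod_right'.measurable
  have h3 : ∀ v, ‖(bf S c).integ f (rep S c (v, 0) F)‖ₑ ^ 2 =
      ∫⁻ u, ENNReal.ofReal (Real.exp (-S.ω (S.J u) u)) * ‖Y v u‖ₑ ^ 2 := fun v => by
    rw [← ofReal_norm, norm_integ_rep S c f hi, ofReal_norm, BargmannFock.enorm_sq_eq]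
    refine lintegral_congr fun u => ?_
    rw [integ_bf_fn_eq S c hi, hY_def]
    simp only [he_def]
    rfl
  have h4 : ∀ u, ∫⁻ v, ‖Y v u‖ₑ ^ 2 = C * ∫⁻ w, ‖ψ w * e w u‖ₑ ^ 2 := fun u => by
    have heu : Continuous fun w => e w u := he.comp (by fun_prop : Continuous fun w => (w, u))
    -- The coefficient is bounded in `w` for fixed `u`, so its product with the slice stays in `L¹ ∩
    -- L²`, as Plancherel requires.
    have hb : ∀ w, ‖e w u‖ ≤ Real.exp (S.ω (S.J u) u / 2) * (‖F‖⁻¹ * ‖F‖) := fun w => by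
      have := BargmannFock.norm_fn_le (rep S c (w, 0) F) u
      rwa [LinearIsometry.norm_map, ← he_def] at this
    simp only [hY_def]
    refine h (fun w => ψ w * e w u) (hψi.mul_bdd heu.aestronglyMeasurable (.of_forall hb)) ?_
    refine (memLp_two_of_lintegral hψm.aestronglyMeasurable h2).of_le_mul
      (c := Real.exp (S.ω (S.J u) u / 2) * (‖F‖⁻¹ * ‖F‖)) (hψm.mul heu.measurable).aestronglyMeasurable (.of_forall fun w => ?_)
    rw [norm_mul, mul_comm]
    exact mul_le_mul_of_nonneg_right (hb w) (norm_nonneg _)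
  simp only [h3]
  rw [lintegral_lintegral_swap ((hq.comp measurable_snd).mul (hY.enorm.pow_const 2)).aemeasurable]
  have h5 : ∀ u, ∫⁻ v, ENNReal.ofReal (Real.exp (-S.ω (S.J u) u)) * ‖Y v u‖ₑ ^ 2 =
      ∫⁻ w, C * (‖ψ w‖ₑ ^ 2 * (ENNReal.ofReal (Real.exp (-S.ω (S.J u) u)) * ‖e w u‖ₑ ^ 2)) := fun u => by
    have heu : Continuous fun w => e w u := he.comp (by fun_prop : Continuous fun w => (w, u))
    have hYu : Measurable fun v => Y v u := hY.comp (measurable_id.prodMk measurable_const)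
    have hψu : Measurable fun w => ψ w * e w u := hψm.mul heu.measurable
    rw [lintegral_const_mul _ (hYu.enorm.pow_const 2), h4, ← mul_assoc,
      ← lintegral_const_mul _ (hψu.enorm.pow_const 2)]
    refine lintegral_congr fun w => ?_
    rw [enorm_mul]
    ring
  simp only [h5]
  have hM : Measurable fun p : V × V =>
      C * (‖ψ p.2‖ₑ ^ 2 * (ENNReal.ofReal (Real.exp (-S.ω (S.J p.1) p.1)) * ‖e p.2 p.1‖ₑ ^ 2)) :=
    (((hψm.comp measurable_snd).enorm.pow_const 2).mul ((hq.comp measurable_fst).mul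
      ((he.comp continuous_swap).measurable.enorm.pow_const 2))).const_mul C
  rw [lintegral_lintegral_swap hM.aemeasurable]
  -- The Gaussian integral over `u` is `‖π(w, 0) Ω‖² = ‖Ω‖²`, independently of `w`.
  have h6 : ∀ w, ∫⁻ u, C * (‖ψ w‖ₑ ^ 2 * (ENNReal.ofReal (Real.exp (-S.ω (S.J u) u)) * ‖e w u‖ₑ ^ 2)) =
      C * ‖F‖ₑ ^ 2 * ‖ψ w‖ₑ ^ 2 := fun w => by
    have hew : Measurable fun u => ENNReal.ofReal (Real.exp (-S.ω (S.J u) u)) * ‖e w u‖ₑ ^ 2 :=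
      hq.mul ((he.comp (by fun_prop : Continuous fun u => (w, u))).measurable.enorm.pow_const 2)
    rw [lintegral_const_mul _ (hew.const_mul _), lintegral_const_mul _ hew]
    simp only [he_def]
    rw [← BargmannFock.enorm_sq_eq, ← ofReal_norm (rep S c (w, 0) F), LinearIsometry.norm_map,
      ofReal_norm]
    ring
  simp only [h6]
  rw [lintegral_const_mul _ (hψm.enorm.pow_const 2)]
  rfl

variable {S}

lemma IsConv.measurable {κ : Kernel V} {φ : Test V} {ψ : V × ℝ → ℂ} (h : IsConv S κ φ ψ) :
    Measurable ψ := by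
  have h1 : ∀ j, Measurable (dconv S κ.f (dyadic j) (dyadic_pos j) φ) := fun j => by
    have : Continuous fun p : (V × ℝ) × (V × ℝ) =>
        κ.f p.2 * φ (mul S (inv (dilation (dyadic j) (dyadic_pos j) p.2)) p.1) :=
      (κ.f.continuous.comp continuous_snd).mul (φ.continuous.comp (Continuous.mulG S
        (continuous_inv.comp ((dilation _ _).continuous.comp continuous_snd)) continuous_fst))
    exact this.stronglyMeasurable.integral_prod_right'.measurable
  have h2 : Measurable fun x => ψ x - κ.a * φ x :=
    measurable_of_tendsto_metrizable (fun N : ℕ => Finset.measurable_fun_sum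
      (Finset.Ico (-N : ℤ) N) fun j _ => h1 j) (tendsto_pi_nhds.2 h)
  refine (congrArg Measurable (funext fun x => ?_)).mpr
    (h2.add (φ.continuous.measurable.const_mul κ.a))
  rw [Pi.add_apply, sub_add_cancel]

/-- The convolution represents the image of `φ` under a bounded operator on `L²(G)`, hence is itself
square integrable. -/
lemma IsConv.lintegral_ne_top {κ : Kernel V} {φ : Test V} {ψ : V × ℝ → ℂ} (h : IsConv S κ φ ψ) :
    ∫⁻ g, ‖ψ g‖ₑ ^ 2 ≠ ⊤ := by
  have h1 := (enorm_sq_eq_lintegral ((leftReg S).mult κ φ.toL2)).trans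
    (lintegral_congr_ae ((leftReg_mult_ae S h).fun_comp fun z => ‖z‖ₑ ^ 2))
  exact ne_of_eq_of_ne h1.symm (ENNReal.pow_ne_top enorm_ne_top)

/-- By the Plancherel formula both slices are averages of squared norms over translates of the
vacuum, and `π(k ∗ φ) = π(k) π(φ)` compares the integrands pointwise. Only frequencies whose slices
are finite are used, which are almost all. -/
lemma IsConv.ae_fibSq_le {κ : Kernel V} {φ : Test V} {ψ : V × ℝ → ℂ} (h : IsConv S κ φ ψ)
    (hφ : ∫ g, φ g = 0) {M : ℝ} (hM : ∀ c, 0 < c → ‖(bf S c).mult κ‖ ≤ M) :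
    ∀ᵐ s : ℝ, 0 < s → fibSq ψ s ≤ ENNReal.ofReal M ^ 2 * fibSq φ s := by
  obtain ⟨C, hC0, hC, hP⟩ := exists_lintegral_fibSq V
  have hmφ : Measurable φ := φ.continuous.measurable
  have hfin : ∀ f : V × ℝ → ℂ, Measurable f → Integrable f → ∫⁻ g, ‖f g‖ₑ ^ 2 ≠ ⊤ →
      ∀ᵐ s, fibSq f s < ⊤ := fun f h1 h2 h3 => by
    refine ae_lt_top (measurable_fibSq h1) ?_
    rw [hP f h1 h2 h3]
    exact ENNReal.mul_ne_top hC h3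
  have hφ2 : ∫⁻ g, ‖φ g‖ₑ ^ 2 ≠ ⊤ := by
    rw [← enorm_sq_toLp φ.memLp]
    exact ENNReal.pow_ne_top enorm_ne_top
  filter_upwards [hfin ψ h.measurable (h.integrable S hφ) h.lintegral_ne_top,
    hfin φ hmφ φ.integrable' hφ2] with s hs1 hs2 hs
  -- The representation whose central frequency `2 c ^ 2` is `s`.
  set c := √(s / 2)
  have hc : 0 < c := Real.sqrt_pos.2 (by positivity)
  have hcs : 2 * c ^ 2 = s := by
    rw [Real.sq_sqrt (by positivity)]
    ring
  obtain ⟨D, hD0, hD, hQ⟩ := exists_lintegral_integ_sq S c hc.ne'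
  have h1 := hQ ψ h.measurable (h.integrable S hφ) (by rw [hcs]; exact hs1.ne)
  have h2 := hQ φ hmφ φ.integrable' (by rw [hcs]; exact hs2.ne)
  rw [hcs] at h1 h2
  rw [← ENNReal.mul_le_mul_iff_right hD0 hD, mul_left_comm, ← h1, ← h2,
    ← lintegral_const_mul' _ _ (by simp)]
  refine lintegral_mono fun v => ?_
  rw [← mul_pow]
  refine pow_le_pow_left' ?_ 2
  rw [← (bf S c).mult_integ h hφ, ← ofReal_norm, ← ofReal_norm, ← ENNReal.ofReal_mul
    ((norm_nonneg _).trans (hM c hc))]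
  refine ENNReal.ofReal_le_ofReal ((ContinuousLinearMap.le_opNorm _ _).trans ?_)
  exact mul_le_mul_of_nonneg_right (hM c hc) (norm_nonneg _)

/-- The norm of a convolution operator is bounded by its norms in the Bargmann–Fock
representations. -/
lemma Distr.HasKernel.norm_leftReg_mult_le {k : Distr V} {κ : Kernel V} (h : k.HasKernel κ) {M : ℝ}
    (hM : ∀ c, 0 < c → ‖(bf S c).mult κ‖ ≤ M) (hM' : ∀ c, 0 < c → ‖(bf S c).mult κ.sharp‖ ≤ M) :
    ‖(leftReg S).mult κ‖ ≤ M := by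
  have hM0 : 0 ≤ M := (norm_nonneg _).trans (hM 1 one_pos)
  refine opNorm_le_of_test hM0 fun φ hφ => ?_
  have hψ := h.isConv S φ
  set ψ := conv S k φ
  have hφ2 : ∫⁻ g, ‖φ g‖ₑ ^ 2 ≠ ⊤ := by
    rw [← enorm_sq_toLp φ.memLp]
    exact ENNReal.pow_ne_top enorm_ne_top
  have hφs : ∫ g, φ.sharp g = 0 := by
    have : ∫ g, φ.sharp g = star (∫ g, φ g) := by
      rw [← integral_sigma φ]; exact integral_conj
    rw [this, hφ, star_zero]
  have h1 := hψ.ae_fibSq_le hφ hM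
  -- Negative frequencies of `ψ` are the positive ones of `ψ♯ = k♯ ∗ φ♯`; the frequency `0` is a
  -- null set.
  have h2 : ∀ᵐ s : ℝ, 0 < s → fibSq (fun g => star (ψ (sigma g))) s ≤
      ENNReal.ofReal M ^ 2 * fibSq (fun g => star (φ (sigma g))) s :=
    IsConv.ae_fibSq_le (φ := φ.sharp) hψ.sharp hφs hM'
  have h3 : ∀ᵐ s : ℝ, fibSq ψ s ≤ ENNReal.ofReal M ^ 2 * fibSq φ s := by
    filter_upwards [h1, (Measure.measurePreserving_neg (volume : Measure ℝ)).quasiMeasurePreserving.ae h2,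
      Measure.ae_ne volume 0] with s hs1 hs2 hs
    rcases lt_or_gt_of_ne hs with h4 | h4
    · have := hs2 (neg_pos.2 h4)
      rwa [fibSq_sharp, fibSq_sharp, neg_neg] at this
    · exact hs1 h4
  obtain ⟨C, hC0, hC, hP⟩ := exists_lintegral_fibSq V
  have h4 : ∫⁻ g, ‖ψ g‖ₑ ^ 2 ≤ ENNReal.ofReal M ^ 2 * ∫⁻ g, ‖φ g‖ₑ ^ 2 := by
    rw [← ENNReal.mul_le_mul_iff_right hC0 hC, mul_left_comm,
      ← hP ψ hψ.measurable (hψ.integrable S hφ) hψ.lintegral_ne_top,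
      ← hP φ φ.continuous.measurable φ.integrable' hφ2, ← lintegral_const_mul' _ _ (by simp)]
    exact lintegral_mono_ae h3
  have h5 : ‖(leftReg S).mult κ φ.toL2‖ₑ ^ 2 ≤ (ENNReal.ofReal M * ‖φ.toL2‖ₑ) ^ 2 := by
    rw [enorm_sq_eq_lintegral, mul_pow, enorm_sq_toLp φ.memLp]
    exact (lintegral_congr_ae ((leftReg_mult_ae S hψ).fun_comp fun z => ‖z‖ₑ ^ 2)).trans_le h4
  have h6 := (ENNReal.pow_le_pow_left_iff two_ne_zero).1 h5
  rw [← ofReal_norm, ← ofReal_norm, ← ENNReal.ofReal_mul hM0] at h6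
  exact (ENNReal.ofReal_le_ofReal_iff (by positivity)).1 h6

end Plancherel
end HeisenbergCalculus

open HeisenbergCalculus MeasureTheory in
/-- Let `k` be a regular distribution on the Heisenberg group, homogeneous of degree `-Q`, let `P`
be the model operator `φ ↦ k ∗ φ` on `L²(G)`, and let `π` be the Bargmann–Fock representation.
Then `P`, `π(P)` and `π(P^op)` are well defined bounded operators, and
`‖P‖ = max {‖π(P)‖, ‖π(P^op)‖}`. -/
theorem mainTheorem9 {V : Type*} [NormedAddCommGroup V] [NormedSpace ℝ V] [FiniteDimensional ℝ V]
    [MeasureSpace V] [BorelSpace V] [(volume : Measure V).IsAddHaarMeasure]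
    (S : AdaptedSymplectic V) (c : ℝ) (hc : 0 < c)
    (k : Distr V) (hreg : k.IsRegular) (hhom : k.IsHomogeneous (-(homDim V : ℝ))) :
    (∃! P : Lp ℂ 2 (volume : Measure (V × ℝ)) →L[ℂ] Lp ℂ 2 (volume : Measure (V × ℝ)),
      IsConvolutionOperator S k P) ∧
    (∃! A : BargmannFock S →L[ℂ] BargmannFock S, IsRepresentedBy S c k A) ∧
    (∃! B : BargmannFock S →L[ℂ] BargmannFock S, IsRepresentedBy S c k.op B) ∧
    ∀ (P : Lp ℂ 2 (volume : Measure (V × ℝ)) →L[ℂ] Lp ℂ 2 (volume : Measure (V × ℝ)))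
      (A B : BargmannFock S →L[ℂ] BargmannFock S),
      IsConvolutionOperator S k P → IsRepresentedBy S c k A → IsRepresentedBy S c k.op B →
      ‖P‖ = max ‖A‖ ‖B‖ := by
  obtain ⟨κ, hκ⟩ := k.exists_hasKernel hreg hhom
  have hP := hκ.isConvolutionOperator S
  have hA := hκ.isRepresentedBy S c
  have hB := hκ.op.isRepresentedBy S c
  refine ⟨⟨_, hP, fun P hP' => hP'.unique hP⟩, ⟨_, hA, fun A hA' => hA'.unique hc.ne' hA⟩,
    ⟨_, hB, fun B hB' => hB'.unique hc.ne' hB⟩, fun P A B hP' hA' hB' => ?_⟩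
  rw [hP'.unique hP, hA'.unique hc.ne' hA, hB'.unique hc.ne' hB]
  -- `k♯` is the adjoint kernel of `k^op`, and an operator has the norm of its adjoint.
  have hsharp : ∀ c, ‖(bf S c).mult κ.sharp‖ = ‖(bf S c).mult κ.op‖ := fun c => by
    rw [← Kernel.invol_op, ← UnitaryRep.star_mult, norm_star]
  -- The Plancherel bound needs all `c' > 0`, one for each frequency; by homogeneity the given `c`
  -- controls them all.
  refine le_antisymm (hκ.norm_leftReg_mult_le (fun c' hc' => ?_) fun c' hc' => ?_) (max_le ?_ ?_)
  · rw [hκ.mult_bf_eq hhom hc hc']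
    exact le_max_left _ _
  · rw [hsharp, hκ.op.mult_bf_eq hhom.op hc hc']
    exact le_max_right _ _
  · exact norm_bf_mult_le S c hc.ne' fun φ => ⟨_, hκ.isConv S φ⟩
  -- For `k^op` weak containment is applied to `k♯`, since `φ ↦ φ♯` directly compares its
  -- convolution operator with `P`.
  · rw [← hsharp]
    exact (norm_bf_mult_le S c hc.ne' (hκ.exists_isConv_sharp S)).trans
      (hκ.norm_leftReg_mult_sharp_le S)
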